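/- **Setting.** All graphs are plane straight-line graphs. A *frame cell* has sixteen boundary vertices $v_0,\dots,v_8,\bar v_1,\dots,\bar v_7$ and possibly one or both of the interior vertices $p,q$. They are points of $\mathbb R^2$, no three on a line, in increasing $x$-order $\bar v_4,\bar v_5,\bar v_6,\bar v_7,v_8,p,\bar v_3,\bar v_2,\bar v_1,v_0,v_1,v_2,v_3,q,v_7,v_6,v_5,v_4$ and in increasing $y$-order $v_4,v_5,v_6,v_7,v_8,q,v_3,v_2,v_1,v_0,\bar v_1,\bar v_2,\bar v_3,p,\bar v_7,\bar v_6,\bar v_5,\bar v_4$ (with $p$, $q$ left out if absent). The boundary cycle consists of the north boundary $\bar v_4\bar v_3\bar v_2\bar v_1v_0$, the east boundary $v_0v_1v_2v_3v_4$, the west boundary $\bar v_4\bar v_5\bar v_6\bar v_7v_8$ and the south boundary $v_8v_7v_6v_5v_4$. The north and east boundaries lie on the convex hull of all vertices of the cell. The west and south boundaries are strictly convex chains bulging into the cell, and every line through an edge of the west (south) boundary has all boundary vertices of the cell that are not on the west (south) boundary strictly on its north-east side. If present, $p$ is south-west of the segment $\bar v_3\bar v_7$ and $q$ is south-west of the segment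 $v_3v_7$. **Gadgets.** A *local coloring* $\chi$ consists of black, one shade (light or dark) of red, and one shade of blue. Each gadget has an edge-colored graph; $U^\chi$ is its subgraph of edges with a color in $\chi$. The boundary cycle is black; write $a\!:\!b,c,\dots$ for the edges $ab,ac,\dots$. The other edges are as follows. For the monochromatic types SE, SW, NS, NW, NE, EW the red version is listed as (light | dark); in the blue version red is replaced by blue and the two shades are exchanged. * Blank: black $v_8\!:\!\bar v_3,\bar v_2,\bar v_1,v_0,v_1,v_2,v_3$; $\bar v_3\!:\!\bar v_5,\bar v_6,\bar v_7$; $v_3\!:\!v_5,v_6,v_7$. * SE: black $v_8\!:\!\bar v_3,\bar v_2,\bar v_1,v_0,v_1$; $\bar v_3\!:\!\bar v_5,\bar v_6,\bar v_7$; $v_1v_7,v_2v_6,v_3v_5,v_3v_6$; wire $(v_2v_7\mid v_1v_6)$. * SW: black $v_6\!:\!\bar v_5,\bar v_3,\bar v_2,\bar v_1,v_0,v_1,v_2,v_3$; $\bar v_7v_7,\bar v_6v_7,\bar v_3\bar v_5,v_3v_5$; wire $(\bar v_5v_7\mid\bar v_6v_6)$. * NW: black $v_8\!:\!\bar v_2,\bar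 v_1,v_0,v_1,v_2,v_3$; $v_3\!:\!v_5,v_6,v_7$; $\bar v_3\bar v_5,\bar v_2\bar v_6,\bar v_2\bar v_7$; wire $(\bar v_2\bar v_5\mid\bar v_3\bar v_6)$. * NS (with $p$): black $p\!:\!\bar v_7,\bar v_2,\bar v_1,v_0,v_1,v_2,v_3,v_6$; $\bar v_3\!:\!\bar v_5,\bar v_6,\bar v_7$; $\bar v_7v_7,v_3v_5,v_3v_6$; wire $(\bar v_2\bar v_7,\,pv_7\mid\bar v_3p,\,\bar v_7v_6)$. * EW (with $q$): black $q\!:\!v_7,v_1,v_0,\bar v_1,\bar v_2,\bar v_3,\bar v_5$; $v_3\!:\!v_5,v_6,v_7$; $\bar v_7v_7,\bar v_6v_7,v_2v_7,\bar v_3\bar v_5$; wire $(\bar v_5v_7,\,v_2q\mid\bar v_6q,\,v_1v_7)$. * NE (with $p,q$): black $p\!:\!\bar v_7,\bar v_2,\bar v_1,v_0,v_1,q$; $\bar v_3\!:\!\bar v_5,\bar v_6,\bar v_7$; $v_3\!:\!v_5,v_6,v_7$; $\bar v_7v_7,qv_7,v_1q,v_2v_7$; wire $(\bar v_2\bar v_7,\,pv_7,\,v_2q\mid\bar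 v_3p,\,\bar v_7q,\,v_1v_7)$. * Crossing i: black $v_6\!:\!\bar v_5,\bar v_3,\bar v_2,\bar v_1,v_0,v_1$; $\bar v_7v_7,\bar v_6v_7,\bar v_3\bar v_5,v_3v_5,v_2v_5$; red $(v_2v_6\mid v_1v_5)$; blue $(\bar v_6v_6\mid\bar v_5v_7)$. * Crossing ii: black $v_8\!:\!\bar v_3,\bar v_2,\bar v_1,v_0,v_1,v_2$; $\bar v_3\!:\!\bar v_5,\bar v_6,\bar v_7$; $v_2v_7,v_3v_5$; red $(v_3v_7\mid v_2v_6)$; blue $(v_2v_5\mid v_3v_6)$. * Crossing iii: black $v_8\!:\!\bar v_1,v_0,v_1,v_2,v_3$; $v_3\!:\!v_5,v_6,v_7$; $\bar v_1\bar v_7,\bar v_3\bar v_6,\bar v_3\bar v_5$; red $(\bar v_1\bar v_6\mid\bar v_2\bar v_7)$; blue $(\bar v_3\bar v_7\mid\bar v_2\bar v_6)$. * Crossing iv (with $p$): black $p\!:\!\bar v_7,\bar v_1,v_0,v_1,v_2,v_3,v_6$; $\bar v_7v_7,\bar v_2\bar v_7,\bar v_2\bar v_6,\bar v_3\bar v_5,v_3v_5,v_3v_6$;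 red $(\bar v_2\bar v_5\mid\bar v_3\bar v_6)$; blue $(\bar v_2p,\,\bar v_7v_6\mid\bar v_1\bar v_7,\,pv_7)$. The *intended triangulations* of a gadget on a frame cell are those graphs $U^\chi$ that have no crossing edges. **Validity.** The north-, south-, east- and west-degree of a vertex is the number of its neighbors strictly in that direction. North is *unconstrained* for $v_0,\bar v_1,\bar v_2,\bar v_3,\bar v_4,v_4$; east for $v_0,v_1,v_2,v_3,v_4,\bar v_4$; south for $v_0,v_1,v_2,v_3$; west for $v_0,\bar v_1,\bar v_2,\bar v_3$; all other directions are *constrained*. A *triangulation of the gadget* is a plane straight-line graph on exactly the vertices of the gadget whose bounded faces are triangles and whose outer face is bounded by the boundary cycle. In it, a vertex *matches* $\chi$ if in each of its constrained directions it has the same degree as in $U^\chi$. The triangulation is *valid* if (1) every vertex matches some local coloring; (2) some single local coloring is matched by all of $\bar v_4,\bar v_5,\bar v_6,\bar v_7,v_8$; and (3) some single local coloring is matched by all of $v_4,v_5,v_6,v_7,v_8$. **Theorem.** For each of the seventeen gadgets (Blank; SE, SW, NS, NW, NE, EW in red and in blue; Crossing i–iv) and every frame cell with the vertices of that gadget,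 the gadget is correct: its valid triangulations are exactly its intended triangulations. -/

import Mathlib

namespace CellGadget

/-- Names of the vertices of a frame cell: `vi` is $v_i$, `bi` is $\bar v_i$, and `p`, `q` are the
optional interior vertices. -/
inductive Vtx
  | v0 | v1 | v2 | v3 | v4 | v5 | v6 | v7 | v8
  | b1 | b2 | b3 | b4 | b5 | b6 | b7
  | p | q
  deriving DecidableEq

open Vtx

instance : Fintype Vtx :=
  ⟨{v0, v1, v2, v3, v4, v5, v6, v7, v8, b1, b2, b3, b4, b5, b6, b7, p, q}, by
    intro x; cases x <;> decide⟩

/-- All vertex names in order of increasing `x`-coordinate. -/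
def xOrder : List Vtx :=
  [b4, b5, b6, b7, v8, p, b3, b2, b1, v0, v1, v2, v3, q, v7, v6, v5, v4]

/-- All vertex names in order of increasing `y`-coordinate. -/
def yOrder : List Vtx :=
  [v4, v5, v6, v7, v8, q, v3, v2, v1, v0, b1, b2, b3, p, b7, b6, b5, b4]

/-- The four boundary paths, each listed by increasing `x`-coordinate. -/
def northPath : List Vtx := [b4, b3, b2, b1, v0]

def eastPath : List Vtx := [v0, v1, v2, v3, v4]

def westPath : List Vtx := [b4, b5, b6, b7, v8]

def southPath : List Vtx := [v8, v7, v6, v5, v4]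

/-- Consecutive pairs of a list. -/
def links (l : List Vtx) : List (Vtx × Vtx) := l.zip l.tail

/-- The edges of the boundary path north of the cell and then east of it, from $\bar v_4$ to
$v_4$. -/
def upperEdges : List (Vtx × Vtx) := links northPath ++ links eastPath

/-- The edges of the boundary path west of the cell and then south of it, from $\bar v_4$ to
$v_4$. -/
def lowerEdges : List (Vtx × Vtx) := links westPath ++ links southPath

/-- The sixteen edges of the boundary cycle of a frame cell. -/
def boundaryEdges : List (Vtx × Vtx) := upperEdges ++ lowerEdges

/-- Twice the signed area of the triangle `x y w`. If `x` is to the west of `y`, it is negative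
exactly if `w` lies below the line `x y`, and positive exactly if `w` lies above that line. -/
def orient (x y w : ℝ × ℝ) : ℝ :=
  (y.1 - x.1) * (w.2 - x.2) - (y.2 - x.2) * (w.1 - x.1)

/-- `z` places the vertices in `V` (the sixteen boundary vertices, and possibly `p` and `q`) as the
vertices of a frame cell. The positions of names outside `V` are irrelevant. From the two coordinate
orders and the convexity conditions it follows that `boundaryEdges` is drawn as a simple
polygon in which `v0, b1, ..., b7, v8, v7, ..., v1` is the counterclockwise order, and
that `p` and `q` lie inside it. -/
structure IsFrameCell (V : Finset Vtx) (z : Vtx → ℝ × ℝ) : Prop where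
  x_order : (xOrder.filter (· ∈ V)).Pairwise fun a b => (z a).1 < (z b).1
  y_order : (yOrder.filter (· ∈ V)).Pairwise fun a b => (z a).2 < (z b).2
  general_position : ∀ a ∈ V, ∀ b ∈ V, ∀ c ∈ V, a ≠ b → a ≠ c → b ≠ c →
    orient (z a) (z b) (z c) ≠ 0
  /-- The north and the east boundary lie on the convex hull of all vertices of the cell. -/
  north_east : ∀ e ∈ upperEdges, ∀ c ∈ V, c ≠ e.1 → c ≠ e.2 →
    orient (z e.1) (z e.2) (z c) < 0
  /-- The west and the south boundary are convex chains that bulge into the cell. -/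
  west_convex : ∀ e ∈ links westPath, ∀ c ∈ westPath, c ≠ e.1 → c ≠ e.2 →
    orient (z e.1) (z e.2) (z c) < 0
  south_convex : ∀ e ∈ links southPath, ∀ c ∈ southPath, c ≠ e.1 → c ≠ e.2 →
    orient (z e.1) (z e.2) (z c) < 0
  /-- The west boundary is nearly vertical: each line through one of its edges has all the other
  boundary vertices of the cell on its (north-)east side. -/
  west_steep : ∀ e ∈ links westPath, ∀ c ∈ northPath ++ eastPath ++ southPath, c ∉ westPath →
    0 < orient (z e.1) (z e.2) (z c)
  /-- The south boundary is nearly horizontal: each line through one of its edges has all the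
  other boundary vertices of the cell on its north(-east) side. -/
  south_flat : ∀ e ∈ links southPath, ∀ c ∈ northPath ++ eastPath ++ westPath, c ∉ southPath →
    0 < orient (z e.1) (z e.2) (z c)
  /-- `p`, if present, is to the south and west of the segment from $\bar v_7$ to $\bar v_3$. -/
  p_place : p ∈ V → orient (z b7) (z b3) (z p) < 0
  /-- `q`, if present, is to the south and west of the segment from $v_3$ to $v_7$. -/
  q_place : q ∈ V → orient (z v3) (z v7) (z q) < 0

/-! ### Tile types and the edge-coloured graphs of their gadgets -/

inductive Hue
  | red | blue
  deriving DecidableEq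

inductive Shade
  | light | dark
  deriving DecidableEq

/-- A local coloring consists of black, one shade of red, and one shade of blue. -/
abbrev LocalColoring := Hue → Shade

/-- The seventeen tile types. The letters of a monochromatic type are the sides of the tile at which
its wire ends. -/
inductive TileType
  | blank
  | SE (h : Hue) | SW (h : Hue) | NS (h : Hue) | NW (h : Hue) | NE (h : Hue) | EW (h : Hue)
  | crossing1 | crossing2 | crossing3 | crossing4
  deriving DecidableEq

namespace TileType

/-- The interior vertices of the gadget. -/
def interior : TileType → Finset Vtx
  | NS _ => {p}
  | EW _ => {q}
  | NE _ => {p, q}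
  | crossing4 => {p}
  | _ => ∅

/-- The vertex set of the gadget. -/
def vertices (t : TileType) : Finset Vtx :=
  (northPath ++ eastPath ++ southPath ++ westPath).toFinset ∪ t.interior

/-- All edges from one vertex to the vertices of a list. -/
def fan (a : Vtx) (l : List Vtx) : List (Vtx × Vtx) := l.map fun b => (a, b)

/-- The black edges of the gadget in the interior of the frame cell. -/
def blackEdges : TileType → List (Vtx × Vtx)
  | blank => fan v8 [b3, b2, b1, v0, v1, v2, v3] ++ fan b3 [b5, b6, b7] ++ fan v3 [v5, v6, v7]
  | SE _ => fan v8 [b3, b2, b1, v0, v1] ++ fan b3 [b5, b6, b7] ++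
      [(v1, v7), (v2, v6), (v3, v5), (v3, v6)]
  | SW _ => fan v6 [b5, b3, b2, b1, v0, v1, v2, v3] ++
      [(b7, v7), (b6, v7), (b3, b5), (v3, v5)]
  | NW _ => fan v8 [b2, b1, v0, v1, v2, v3] ++ fan v3 [v5, v6, v7] ++
      [(b3, b5), (b2, b6), (b2, b7)]
  | NS _ => fan p [b7, b2, b1, v0, v1, v2, v3, v6] ++ fan b3 [b5, b6, b7] ++
      [(b7, v7), (v3, v5), (v3, v6)]
  | EW _ => fan q [v7, v1, v0, b1, b2, b3, b5] ++ fan v3 [v5, v6, v7] ++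
      [(b7, v7), (b6, v7), (v2, v7), (b3, b5)]
  | NE _ => fan p [b7, b2, b1, v0, v1, q] ++ fan b3 [b5, b6, b7] ++ fan v3 [v5, v6, v7] ++
      [(b7, v7), (q, v7), (v1, q), (v2, v7)]
  | crossing1 => fan v6 [b5, b3, b2, b1, v0, v1] ++
      [(b7, v7), (b6, v7), (b3, b5), (v3, v5), (v2, v5)]
  | crossing2 => fan v8 [b3, b2, b1, v0, v1, v2] ++ fan b3 [b5, b6, b7] ++
      [(v2, v7), (v3, v5)]
  | crossing3 => fan v8 [b1, v0, v1, v2, v3] ++ fan v3 [v5, v6, v7] ++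
      [(b1, b7), (b3, b6), (b3, b5)]
  | crossing4 => fan p [b7, b1, v0, v1, v2, v3, v6] ++
      [(b7, v7), (b2, b7), (b2, b6), (b3, b5), (v3, v5), (v3, v6)]

/-- The wire of a monochromatic gadget of hue `h`, given by the light and the dark edges of the red
version. The blue version is obtained by exchanging colors and shades simultaneously. -/
def wire (h : Hue) (lightRed darkRed : List (Vtx × Vtx)) : Hue → Shade → List (Vtx × Vtx) :=
  fun h' s =>
    if h' = h then
      match h, s with
      | .red, .light => lightRed
      | .red, .dark => darkRed
      | .blue, .light => darkRed
      | .blue, .dark => lightRed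
    else []

/-- The edges of the gadget of a given hue and shade. -/
def coloredEdges : TileType → Hue → Shade → List (Vtx × Vtx)
  | blank => fun _ _ => []
  | SE h => wire h [(v2, v7)] [(v1, v6)]
  | SW h => wire h [(b5, v7)] [(b6, v6)]
  | NW h => wire h [(b2, b5)] [(b3, b6)]
  | NS h => wire h [(b2, b7), (p, v7)] [(b3, p), (b7, v6)]
  | EW h => wire h [(b5, v7), (v2, q)] [(b6, q), (v1, v7)]
  | NE h => wire h [(b2, b7), (p, v7), (v2, q)] [(b3, p), (b7, q), (v1, v7)]
  | crossing1 => fun h s => match h, s with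
    | .red, .light => [(v2, v6)]
    | .red, .dark => [(v1, v5)]
    | .blue, .light => [(b6, v6)]
    | .blue, .dark => [(b5, v7)]
  | crossing2 => fun h s => match h, s with
    | .red, .light => [(v3, v7)]
    | .red, .dark => [(v2, v6)]
    | .blue, .light => [(v2, v5)]
    | .blue, .dark => [(v3, v6)]
  | crossing3 => fun h s => match h, s with
    | .red, .light => [(b1, b6)]
    | .red, .dark => [(b2, b7)]
    | .blue, .light => [(b3, b7)]
    | .blue, .dark => [(b2, b6)]
  | crossing4 => fun h s => match h, s with
    | .red, .light => [(b2, b5)]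
    | .red, .dark => [(b3, b6)]
    | .blue, .light => [(b2, p), (b7, v6)]
    | .blue, .dark => [(b1, b7), (p, v7)]

/-- The subgraph $U^\chi$ of the edge-colored graph of the gadget that consists of the
edges (including the boundary of the frame cell, which is black) with a color in `χ`. -/
def U (t : TileType) (χ : LocalColoring) : SimpleGraph Vtx :=
  SimpleGraph.fromRel fun a b =>
    (a, b) ∈ boundaryEdges ++ t.blackEdges ++ t.coloredEdges .red (χ .red) ++
      t.coloredEdges .blue (χ .blue)

end TileType

/-! ### Triangulations of a gadget -/

/-- No two distinct edges of `T` cross: the relative interiors of the segments that represent them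
are disjoint. -/
def NonCrossing (z : Vtx → ℝ × ℝ) (T : SimpleGraph Vtx) : Prop :=
  ∀ a b c d, T.Adj a b → T.Adj c d → s(a, b) ≠ s(c, d) →
    Disjoint (openSegment ℝ (z a) (z b)) (openSegment ℝ (z c) (z d))

/-- The union of the segments that represent a list of edges. -/
def polyline (z : Vtx → ℝ × ℝ) (l : List (Vtx × Vtx)) : Set (ℝ × ℝ) :=
  {x | ∃ e ∈ l, x ∈ segment ℝ (z e.1) (z e.2)}

/-- The closed region that is bounded by the boundary cycle of a frame cell. Both paths of the
cycle from $\bar v_4$ to $v_4$ are `x`-monotone, so it consists of the points that lie vertically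
between them. -/
def region (z : Vtx → ℝ × ℝ) : Set (ℝ × ℝ) :=
  {x | ∃ s ∈ polyline z lowerEdges, ∃ u ∈ polyline z upperEdges,
    s.1 = x.1 ∧ u.1 = x.1 ∧ s.2 ≤ x.2 ∧ x.2 ≤ u.2}

/-- `T` is a plane straight-line triangulation with vertex set `V` whose outer face is bounded by
the boundary cycle of the frame cell. -/
structure IsTriangulation (V : Finset Vtx) (z : Vtx → ℝ × ℝ) (T : SimpleGraph Vtx) : Prop where
  mem_vertices : ∀ a b, T.Adj a b → a ∈ V
  nonCrossing : NonCrossing z T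
  boundary : ∀ e ∈ boundaryEdges, T.Adj e.1 e.2
  inside : ∀ a b, T.Adj a b → segment ℝ (z a) (z b) ⊆ region z
  /-- All bounded faces are triangles: the region is covered by triangles whose sides are edges of
  `T` and that have no vertex in the interior. -/
  faces : ∀ x ∈ region z, ∃ a b c, T.Adj a b ∧ T.Adj b c ∧ T.Adj a c ∧
    x ∈ convexHull ℝ {z a, z b, z c} ∧
    ∀ v ∈ V, z v ∉ _root_.interior (convexHull ℝ {z a, z b, z c})

/-! ### Cardinal degrees, validity, and correctness -/

inductive Direction
  | north | south | east | west
  deriving DecidableEq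

/-- `D.Sees x y`: the point `y` lies strictly in direction `D` from the point `x`. -/
def Direction.Sees : Direction → ℝ × ℝ → ℝ × ℝ → Prop
  | .north, x, y => x.2 < y.2
  | .south, x, y => y.2 < x.2
  | .east, x, y => x.1 < y.1
  | .west, x, y => y.1 < x.1

/-- The degree of `v` in direction `D`. -/
noncomputable def cardinalDegree (z : Vtx → ℝ × ℝ) (T : SimpleGraph Vtx) (D : Direction)
    (v : Vtx) : ℕ :=
  {u | T.Adj v u ∧ D.Sees (z v) (z u)}.ncard

/-- The vertices for which a cardinal direction is unconstrained. -/
def unconstrained : Direction → List Vtx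
  | .north => [v0, b1, b2, b3, b4, v4]
  | .east => [v0, v1, v2, v3, v4, b4]
  | .south => [v0, v1, v2, v3]
  | .west => [v0, b1, b2, b3]

/-- In `T`, the vertex `v` matches the local coloring `χ` in all its constrained directions. -/
def Matches (t : TileType) (z : Vtx → ℝ × ℝ) (T : SimpleGraph Vtx) (v : Vtx)
    (χ : LocalColoring) : Prop :=
  ∀ D : Direction, v ∉ unconstrained D → cardinalDegree z T D v = cardinalDegree z (t.U χ) D v

/-- `T` is a valid triangulation of the gadget of type `t` on the frame cell `z`. -/
structure IsValid (t : TileType) (z : Vtx → ℝ × ℝ) (T : SimpleGraph Vtx) : Prop where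
  triangulation : IsTriangulation t.vertices z T
  each_vertex : ∀ v ∈ t.vertices, ∃ χ, Matches t z T v χ
  west : ∃ χ, ∀ v ∈ westPath, Matches t z T v χ
  south : ∃ χ, ∀ v ∈ southPath, Matches t z T v χ

/-- The intended triangulations of the gadget: those of the (at most four) graphs $U^\chi$ that
have no crossing edges. -/
def intended (t : TileType) (z : Vtx → ℝ × ℝ) : Set (SimpleGraph Vtx) :=
  {T | NonCrossing z T ∧ ∃ χ, T = t.U χ}

/-- The gadget of type `t` on the frame cell `z` is correct: its valid triangulations are exactly
its intended triangulations. -/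
def IsCorrect (t : TileType) (z : Vtx → ℝ × ℝ) : Prop :=
  {T | IsValid t z T} = intended t z

end CellGadget

/-! The theorem is a finite statement in disguise. Whether two edges cross depends only on the
orientations of triples of vertices. The axioms of a frame cell fix the orientation of every triple
of boundary vertices and of some triples with p or q (`IsFrameCell.orientation_sound`). The
remaining orientations are unknown signs that obey the signotope axiom: for four points i, j, k, l
in x-order, the signs of ijk, ijl, ikl, jkl change at most once. The coordinate orders fix which
vertices lie in which direction of each other, so every degree counts the edges in a fixed set of
pairs. Edges and orientations thus become Boolean variables (`Describes`).

A valid triangulation satisfies constraints in these variables: crossing edges exclude each other,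
unknown orientations are consistent, and the degrees are prescribed. The degrees on the west
boundary are those of one coloring, the degrees on the south boundary are those of one, possibly
different, coloring, and at all other vertices every coloring prescribes the same degrees. For every
combination of a west and a south coloring, unit propagation guided by a stored decision tree ends
in contradictions or in states that determine all edges and agree with some graph of the gadget
(`IsValid.exists_eq_U`).

Conversely, the graph of a coloring matches this coloring by definition, so if it has no crossings,
it only remains to see that it is a triangulation. A path is swept from the lower to the upper
boundary of the cell, one empty triangle at a time. The triangles cover the cell, and all edges of
the paths stay above the lower boundary (`sweep_sound`, `isTriangulation_of_intendedCheck`).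

Both computations are checked by the kernel for eleven gadgets. The six blue ones arise from the red
ones by exchanging colors and shades (`IsCorrect.of_exchange`). -/

namespace CellGadget

/-! ### A propagating search on bit masks

The search below is evaluated by the kernel. It is therefore written with recursors and in
continuation-passing style; `force` makes the kernel evaluate a number to a literal. The kernel
hashes a literal by its lowest 64 bits. A set is therefore represented by a number that has a
checksum in these bits; the elements of the set are given by the other bits. -/

section Search

/-- `k a`, where `a` is evaluated first. -/
noncomputable def force {β : Type} (a : ℕ) (k : ℕ → β) : β :=
  Nat.rec (motive := fun _ => β) (k 0) (fun n _ => k (Nat.succ n)) a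

theorem force_eq {β : Type} (a : ℕ) (k : ℕ → β) : force a k = k a := by
  cases a <;> rfl

noncomputable def ifZero {β : Type} (a : ℕ) (x y : β) : β :=
  Nat.rec (motive := fun _ => β) x (fun _ _ => y) a

theorem ifZero_eq {β : Type} (a : ℕ) (x y : β) : ifZero a x y = if a = 0 then x else y := by
  cases a <;> rfl

/-! ### Sets of numbers as bit masks with a checksum. -/

/-- The elements of `a` that are not in `b`. -/
def diff (a b : ℕ) : ℕ := Nat.xor a (Nat.land a b)

theorem testBit_land (a b i : ℕ) : (Nat.land a b).testBit i = (a.testBit i && b.testBit i) :=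
  Nat.testBit_and a b i

theorem testBit_lor (a b i : ℕ) : (Nat.lor a b).testBit i = (a.testBit i || b.testBit i) :=
  Nat.testBit_or a b i

theorem testBit_diff (a b i : ℕ) : (diff a b).testBit i = (a.testBit i && !b.testBit i) := by
  have h := Nat.testBit_xor a (a &&& b) i
  rw [Nat.testBit_and] at h
  change (a ^^^ (a &&& b)).testBit i = _
  rw [h]
  cases a.testBit i <;> cases b.testBit i <;> rfl

/-- `a` without the checksum. -/
def body (a : ℕ) : ℕ := Nat.shiftRight a 64

/-- Put a checksum in front of `a`. -/
def tag (a : ℕ) : ℕ := Nat.xor (Nat.shiftLeft a 64) (Nat.mod a 2305843009213693951)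

theorem testBit_body (a i : ℕ) : (body a).testBit i = a.testBit (64 + i) :=
  Nat.testBit_shiftRight a

theorem body_tag (a : ℕ) : body (tag a) = a := by
  refine Nat.eq_of_testBit_eq fun i => ?_
  rw [testBit_body]
  change ((a <<< 64) ^^^ (a % 2305843009213693951)).testBit (64 + i) = _
  rw [Nat.testBit_xor, Nat.testBit_shiftLeft, Nat.testBit_lt_two_pow (x := a % _)]
  · simp
  -- The modulus is 2 ^ 61 - 1, so the checksum fits into the 64 low bits.
  · calc a % 2305843009213693951 < 2305843009213693951 := Nat.mod_lt _ (by norm_num)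
      _ ≤ 2 ^ 64 := by norm_num
      _ ≤ 2 ^ (64 + i) := Nat.pow_le_pow_right (by norm_num) (by omega)

/-- The set that is represented by `a`. -/
def bits (a : ℕ) : Set ℕ := {i | (body a).testBit i = true}

theorem mem_bits {a i : ℕ} : i ∈ bits a ↔ (body a).testBit i = true := Iff.rfl

theorem mem_bits_tag {a i : ℕ} : i ∈ bits (tag a) ↔ a.testBit i = true := by
  rw [mem_bits, body_tag]

/-- Bitwise operations act correctly on the body, whatever they make of the checksum. Hence
intermediate results need no new checksum; only `join`, whose results are kept, restores it. -/
theorem mem_bits_land {a b i : ℕ} : i ∈ bits (Nat.land a b) ↔ i ∈ bits a ∧ i ∈ bits b := by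
  simp only [mem_bits, testBit_body, testBit_land, Bool.and_eq_true]

theorem mem_bits_lor {a b i : ℕ} : i ∈ bits (Nat.lor a b) ↔ i ∈ bits a ∨ i ∈ bits b := by
  simp only [mem_bits, testBit_body, testBit_lor, Bool.or_eq_true]

theorem mem_bits_diff {a b i : ℕ} : i ∈ bits (diff a b) ↔ i ∈ bits a ∧ i ∉ bits b := by
  simp only [mem_bits, testBit_body, testBit_diff, Bool.and_eq_true, Bool.not_eq_true',
    Bool.not_eq_true]

theorem body_eq_zero {a : ℕ} : body a = 0 ↔ bits a = ∅ := by
  rw [Set.eq_empty_iff_forall_notMem]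
  constructor
  · intro h i hi
    rw [mem_bits, h, Nat.zero_testBit] at hi
    exact Bool.false_ne_true hi
  · intro h
    refine Nat.eq_of_testBit_eq fun i => ?_
    rw [Nat.zero_testBit]
    exact Bool.eq_false_iff.2 (h i)

theorem exists_mem_bits {a : ℕ} (h : body a ≠ 0) : ∃ i, i ∈ bits a :=
  Set.nonempty_iff_ne_empty.2 (mt body_eq_zero.2 h)

/-- The union of two sets. -/
def join (a b : ℕ) : ℕ := tag (body (Nat.lor a b))

theorem mem_bits_join {a b i : ℕ} : i ∈ bits (join a b) ↔ i ∈ bits a ∨ i ∈ bits b := by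
  rw [join, mem_bits_tag, ← mem_bits, mem_bits_lor]

theorem bits_finite (a : ℕ) : (bits a).Finite := by
  refine (Set.finite_lt_nat (body a)).subset fun i hi => ?_
  exact lt_of_lt_of_le Nat.lt_two_pow_self (Nat.ge_two_pow_of_testBit hi)

/-! ### Counting the elements of a mask. -/

/-- `a` without its lowest bit. -/
def dropLow (a : ℕ) : ℕ := Nat.land a (Nat.sub a 1)

/-- Induction by halving: an odd number loses bit 0, and 2b loses the bit one place above the one
that b loses. -/
theorem exists_testBit_dropLow : ∀ a : ℕ, a ≠ 0 → ∃ i, a.testBit i = true ∧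
    ∀ j, (dropLow a).testBit j = (a.testBit j && !decide (j = i)) := by
  intro a
  induction a using Nat.strong_induction_on with
  | _ a ih =>
    intro ha
    rcases Nat.even_or_odd' a with ⟨b, rfl | rfl⟩
    · obtain ⟨i, hi, h⟩ := ih b (by omega) (by omega)
      refine ⟨i + 1, ?_, fun j => ?_⟩
      · rwa [Nat.testBit_succ, show 2 * b / 2 = b by omega]
      · change (2 * b &&& (2 * b - 1)).testBit j = _
        rw [Nat.testBit_and]
        cases j with
        | zero => simp
        | succ j =>
          have h' : (b &&& (b - 1)).testBit j = _ := h j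
          rw [Nat.testBit_and] at h'
          rw [Nat.testBit_succ, Nat.testBit_succ, show (2 * b - 1) / 2 = b - 1 by omega,
            show 2 * b / 2 = b by omega, h']
          simp
    · refine ⟨0, by simp, fun j => ?_⟩
      change ((2 * b + 1) &&& (2 * b + 1 - 1)).testBit j = _
      rw [Nat.testBit_and]
      cases j with
      | zero => simp
      | succ j =>
        rw [Nat.testBit_succ, Nat.testBit_succ, show (2 * b + 1) / 2 = b by omega,
          show (2 * b + 1 - 1) / 2 = b by omega]
        simp

/-- The set of positions of the bits of `a`. -/
def ones (a : ℕ) : Set ℕ := {i | a.testBit i = true}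

theorem ones_body (a : ℕ) : ones (body a) = bits a := rfl

theorem ones_zero : ones 0 = ∅ := by
  ext
  simp [ones]

theorem ones_finite (a : ℕ) : (ones a).Finite := by
  rw [← body_tag a]
  exact bits_finite _

theorem ones_eq_empty {a : ℕ} : ones a = ∅ ↔ a = 0 := by
  have := body_eq_zero (a := tag a)
  rwa [body_tag, ← ones_body, body_tag, iff_comm] at this

theorem exists_ones_dropLow {a : ℕ} (ha : a ≠ 0) :
    ∃ i ∈ ones a, ones (dropLow a) = ones a \ {i} := by
  obtain ⟨i, hi, h⟩ := exists_testBit_dropLow a ha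
  refine ⟨i, hi, ?_⟩
  ext j
  simp [ones, h]

theorem ncard_ones_dropLow {a : ℕ} (ha : a ≠ 0) :
    (ones (dropLow a)).ncard + 1 = (ones a).ncard := by
  obtain ⟨i, hi, h⟩ := exists_ones_dropLow ha
  rw [h, Set.ncard_sdiff_singleton_add_one hi (ones_finite a)]

theorem ncard_ones_eq_zero {a : ℕ} : (ones a).ncard = 0 ↔ a = 0 := by
  rw [Set.ncard_eq_zero (ones_finite a), ones_eq_empty]

/-- `a` without its lowest `k` bits. -/
noncomputable def strip (k : ℕ) : ℕ → ℕ :=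
  Nat.rec (motive := fun _ => ℕ → ℕ) (fun a => a) (fun _ ih a => ih (dropLow a)) k

theorem strip_ne_zero {k a : ℕ} : strip k a ≠ 0 ↔ k < (ones a).ncard := by
  induction k generalizing a with
  | zero => rw [Nat.pos_iff_ne_zero, Ne, Ne, ncard_ones_eq_zero]; rfl
  | succ k ih =>
    change strip k (dropLow a) ≠ 0 ↔ _
    rw [ih]
    by_cases ha : a = 0
    · subst ha
      have : (ones 0).ncard = 0 := ncard_ones_eq_zero.2 rfl
      change k < (ones 0).ncard ↔ _
      omega
    · have := ncard_ones_dropLow ha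
      omega

/-- A number that is not zero exactly if `a` has at least `k` bits. -/
noncomputable def atLeast (k a : ℕ) : ℕ :=
  Nat.rec (motive := fun _ => ℕ) 1 (fun k _ => strip k a) k

theorem atLeast_ne_zero {k a : ℕ} : atLeast k a ≠ 0 ↔ k ≤ (ones a).ncard := by
  cases k with
  | zero => simp [atLeast]
  | succ k => exact strip_ne_zero

/-- The number of bits of `a`, if it is at most `n`. -/
noncomputable def popcount (n : ℕ) : ℕ → ℕ :=
  Nat.rec (motive := fun _ => ℕ → ℕ) (fun _ => 0)
    (fun _ ih a => ifZero a 0 (Nat.succ (ih (dropLow a)))) n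

theorem popcount_eq {n a : ℕ} (h : (ones a).ncard ≤ n) : popcount n a = (ones a).ncard := by
  induction n generalizing a with
  | zero => exact (Nat.le_zero.1 h).symm
  | succ n ih =>
    have e : popcount (n + 1) a = if a = 0 then 0 else (popcount n (dropLow a)) + 1 :=
      ifZero_eq _ _ _
    rw [e]
    split_ifs with ha
    · exact (ncard_ones_eq_zero.2 ha).symm
    · have := ncard_ones_dropLow ha
      rw [ih (by omega), this]

/-- The number whose bits are at the positions in a list. -/
noncomputable def sumBits (l : List ℕ) : ℕ :=
  List.rec (motive := fun _ => ℕ) 0 (fun v _ m => Nat.lor (Nat.pow 2 v) m) l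

theorem testBit_sumBits {l : List ℕ} {i : ℕ} : (sumBits l).testBit i = true ↔ i ∈ l := by
  induction l with
  | nil => exact iff_of_false (by change ¬ (Nat.testBit 0 i = true); simp) (by simp)
  | cons v l ih =>
    change (Nat.lor (2 ^ v) (sumBits l)).testBit i = true ↔ _
    rw [testBit_lor, Bool.or_eq_true, ih, List.mem_cons, Nat.testBit_two_pow, decide_eq_true_iff,
      eq_comm]

/-- The representation of the set of the elements of a list. -/
noncomputable def maskOf (l : List ℕ) : ℕ := tag (sumBits l)

theorem mem_bits_maskOf {l : List ℕ} {i : ℕ} : i ∈ bits (maskOf l) ↔ i ∈ l := by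
  rw [maskOf, mem_bits_tag, testBit_sumBits]

/-! ### Rules and their propagation. -/

/-- A constraint on a set of numbers. -/
inductive Rule
  /-- The set contains a bit of `p` or misses a bit of `n`. -/
  | clause (p n : ℕ)
  /-- If the set contains a bit of `e`, then it contains no bit of `m`. -/
  | excl (e m : ℕ)
  /-- The set contains exactly `k` bits of `m`. -/
  | count (m k : ℕ)

def Rule.Holds (α : ℕ → Prop) : Rule → Prop
  | clause p n => (∃ i ∈ bits p, α i) ∨ ∃ i ∈ bits n, ¬ α i
  | excl e m => (∃ i ∈ bits e, α i) → ∀ i ∈ bits m, ¬ α i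
  | count m k => {i | i ∈ bits m ∧ α i}.ncard = k

/-- The set contains all bits of `t` and no bit of `f`. -/
def Consistent (α : ℕ → Prop) (t f : ℕ) : Prop := (∀ i ∈ bits t, α i) ∧ ∀ i ∈ bits f, ¬ α i

/-- Derive consequences of a rule. The continuation `drop` is used if the rule is then exhausted. -/
noncomputable def Rule.step (r : Rule) (t f : ℕ) (keep drop : ℕ → ℕ → Bool) : Bool :=
  Rule.rec (motive := fun _ => Bool)
    (fun p n =>
      ifZero (body (Nat.lor (Nat.land p t) (Nat.land n f)))
        -- `m` consists of the undecided variables of the clause, and `dropLow` tests whether there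
        -- is at most one. If there is none, the clause is violated; a contradiction counts as
        -- success.
        ((fun m =>
          ifZero (dropLow (body m))
            (ifZero (body m) true
              (ifZero (body (Nat.land m p)) (force (join f m) (drop t))
                (ifZero (body (Nat.land m n)) (force (join t m) fun t => drop t f) (keep t f))))
            (keep t f)) (Nat.lor (diff p f) (diff n t)))
        (drop t f))
    (fun e m =>
      ifZero (body (Nat.land e t))
        (ifZero (body (diff e f)) (drop t f) (keep t f))
        (force (join f m) (drop t)))
    (fun m k =>
      -- `lo` contains the elements of `m` known to be in the set and `hi` those not known to be
      -- outside, so the count lies between their sizes.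
      (fun lo hi =>
        ifZero (atLeast (Nat.succ k) (body lo))
          (ifZero (atLeast k (body hi)) true
            (ifZero (atLeast k (body lo))
              (ifZero (atLeast (Nat.succ k) (body hi))
                (force (join t hi) fun t => drop t f) (keep t f))
              (force (join f (diff m lo)) (drop t))))
          true) (Nat.land m t) (diff m f))
    r

variable {α : ℕ → Prop}

theorem eq_of_dropLow_eq_zero {a i j : ℕ} (h : dropLow (body a) = 0) (hi : i ∈ bits a)
    (hj : j ∈ bits a) : i = j := by
  have ha : body a ≠ 0 := fun h => by
    rw [body_eq_zero] at h
    exact Set.eq_empty_iff_forall_notMem.1 h i hi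
  obtain ⟨l, -, hl⟩ := exists_ones_dropLow ha
  rw [h, ones_zero, ones_body] at hl
  have h1 : ∀ x ∈ bits a, x = l := fun x hx => by
    by_contra hc
    exact (Set.ext_iff.1 hl x).2 ⟨hx, hc⟩
  rw [h1 i hi, h1 j hj]

theorem Consistent.join_left {t f a : ℕ} (h : Consistent α t f) (ha : ∀ i ∈ bits a, α i) :
    Consistent α (join t a) f :=
  ⟨fun i hi => (mem_bits_join.1 hi).elim (h.1 i) (ha i), h.2⟩

theorem Consistent.join_right {t f a : ℕ} (h : Consistent α t f) (ha : ∀ i ∈ bits a, ¬ α i) :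
    Consistent α t (join f a) :=
  ⟨h.1, fun i hi => (mem_bits_join.1 hi).elim (h.2 i) (ha i)⟩

/-- The result `true` means that a contradiction was found or that a continuation succeeded. The
existence of `α` rules out the former, and every derived fact holds for `α`. -/
theorem Rule.step_sound {r : Rule} {t f : ℕ} {keep drop : ℕ → ℕ → Bool} (h : Consistent α t f)
    (hr : r.Holds α) (hs : r.step t f keep drop = true) :
    ∃ t f, Consistent α t f ∧ (keep t f = true ∨ drop t f = true) := by
  have zero : ∀ {a i}, body a = 0 → i ∉ bits a := fun ha =>
    Set.eq_empty_iff_forall_notMem.1 (body_eq_zero.1 ha) _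
  cases r with
  | clause p n =>
    simp only [Rule.step, ifZero_eq, force_eq] at hs
    have hor : (∃ i ∈ bits (Nat.lor (diff p f) (diff n t)), i ∈ bits p ∧ α i) ∨
        ∃ i ∈ bits (Nat.lor (diff p f) (diff n t)), i ∈ bits n ∧ ¬ α i := by
      refine hr.imp ?_ ?_
      · rintro ⟨i, hi, hα⟩
        exact ⟨i, mem_bits_lor.2 (.inl (mem_bits_diff.2 ⟨hi, fun hf => h.2 i hf hα⟩)), hi, hα⟩
      · rintro ⟨i, hi, hα⟩
        exact ⟨i, mem_bits_lor.2 (.inr (mem_bits_diff.2 ⟨hi, fun ht => hα (h.1 i ht)⟩)), hi, hα⟩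
    split_ifs at hs with h1 h2 h3 h4 h5
    · exfalso
      rcases hor with ⟨i, hi, -⟩ | ⟨i, hi, -⟩
      exacts [zero h3 hi, zero h3 hi]
    · refine ⟨_, _, h.join_right fun i hi => ?_, .inr hs⟩
      rcases hor with ⟨j, hj, hp, -⟩ | ⟨j, hj, -, hα⟩
      · exact absurd (mem_bits_land.2 ⟨hj, hp⟩) (zero h4)
      · rwa [eq_of_dropLow_eq_zero h2 hi hj]
    · refine ⟨_, _, h.join_left fun i hi => ?_, .inr hs⟩
      rcases hor with ⟨j, hj, -, hα⟩ | ⟨j, hj, hn, -⟩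
      · rwa [eq_of_dropLow_eq_zero h2 hi hj]
      · exact absurd (mem_bits_land.2 ⟨hj, hn⟩) (zero h5)
    · exact ⟨_, _, h, .inl hs⟩
    · exact ⟨_, _, h, .inl hs⟩
    · exact ⟨_, _, h, .inr hs⟩
  | excl e m =>
    simp only [Rule.step, ifZero_eq, force_eq] at hs
    split_ifs at hs with h1 h2
    · exact ⟨_, _, h, .inr hs⟩
    · exact ⟨_, _, h, .inl hs⟩
    · obtain ⟨i, hi⟩ := exists_mem_bits h1
      rw [mem_bits_land] at hi
      exact ⟨_, _, h.join_right (hr ⟨i, hi.1, h.1 i hi.2⟩), .inr hs⟩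
  | count m k =>
    simp only [Rule.step, ifZero_eq, force_eq] at hs
    change {i | i ∈ bits m ∧ α i}.ncard = k at hr
    have hfin : {i | i ∈ bits m ∧ α i}.Finite := (bits_finite m).subset fun i hi => hi.1
    have hlo : bits (Nat.land m t) ⊆ {i | i ∈ bits m ∧ α i} := fun i hi =>
      ⟨(mem_bits_land.1 hi).1, h.1 i (mem_bits_land.1 hi).2⟩
    have hhi : {i | i ∈ bits m ∧ α i} ⊆ bits (diff m f) := fun i hi =>
      mem_bits_diff.2 ⟨hi.1, fun hf => h.2 i hf hi.2⟩
    have clo : (ones (body (Nat.land m t))).ncard ≤ _ := Set.ncard_le_ncard hlo hfin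
    have chi : _ ≤ (ones (body (diff m f))).ncard := Set.ncard_le_ncard hhi (bits_finite _)
    split_ifs at hs with h1 h2 h3 h4
    · have := mt atLeast_ne_zero.2 (not_not.2 h2)
      omega
    · have := mt atLeast_ne_zero.2 (not_not.2 h4)
      refine ⟨_, _, h.join_left fun i hi => ?_, .inr hs⟩
      have e := Set.eq_of_subset_of_ncard_le hhi
        (by change (ones (body (diff m f))).ncard ≤ _; omega) (bits_finite _)
      rw [← e] at hi
      exact hi.2
    · exact ⟨_, _, h, .inl hs⟩
    · have := atLeast_ne_zero.1 h3
      refine ⟨_, _, h.join_right fun i hi hα => ?_, .inr hs⟩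
      have e := Set.eq_of_subset_of_ncard_le hlo
        (by change _ ≤ (ones (body (Nat.land m t))).ncard; omega) hfin
      rw [mem_bits_diff, e] at hi
      exact hi.2 ⟨hi.1, hα⟩
    · have := atLeast_ne_zero.1 h1
      omega

/-- Apply each rule once. -/
noncomputable def pass (rs : List Rule) :
    List Rule → (ℕ → ℕ → List Rule → Bool) → ℕ → ℕ → Bool :=
  List.rec (motive := fun _ => List Rule → (ℕ → ℕ → List Rule → Bool) → ℕ → ℕ → Bool)
    (fun acc k t f => k t f acc)
    (fun r _ ih acc k t f => r.step t f (ih (r :: acc) k) (ih acc k)) rs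

theorem pass_sound {rs acc : List Rule} {k : ℕ → ℕ → List Rule → Bool} {t f : ℕ}
    (h : Consistent α t f) (hrs : ∀ r ∈ rs, r.Holds α) (hacc : ∀ r ∈ acc, r.Holds α)
    (hs : pass rs acc k t f = true) :
    ∃ t f acc, Consistent α t f ∧ (∀ r ∈ acc, r.Holds α) ∧ k t f acc = true := by
  induction rs generalizing acc t f with
  | nil => exact ⟨t, f, acc, h, hacc, hs⟩
  | cons r rs ih =>
    obtain ⟨t', f', h', hs'⟩ := Rule.step_sound h (hrs r (by simp)) hs
    have hrs' : ∀ r ∈ rs, r.Holds α := fun r hr => hrs r (by simp [hr])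
    rcases hs' with hs' | hs'
    · exact ih h' hrs'
        (fun r' hr' => (List.mem_cons.1 hr').elim (· ▸ hrs r (by simp)) (hacc r')) hs'
    · exact ih h' hrs' hacc hs'

/-- Apply all rules until nothing changes, but at most `n` times. -/
noncomputable def settle (n : ℕ) : List Rule → (ℕ → ℕ → List Rule → Bool) → ℕ → ℕ → Bool :=
  Nat.rec (motive := fun _ => List Rule → (ℕ → ℕ → List Rule → Bool) → ℕ → ℕ → Bool)
    (fun rs k t f => k t f rs)
    (fun _ ih rs k t f =>
      pass rs [] (fun t' f' rs' =>
        ifZero (body (Nat.land t' f'))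
          (ifZero (body (Nat.lor (diff t' t) (diff f' f))) (k t' f' rs') (ih rs' k t' f'))
          true) t f) n

theorem settle_sound {n : ℕ} {rs : List Rule} {k : ℕ → ℕ → List Rule → Bool} {t f : ℕ}
    (h : Consistent α t f) (hrs : ∀ r ∈ rs, r.Holds α) (hs : settle n rs k t f = true) :
    ∃ t f rs, Consistent α t f ∧ (∀ r ∈ rs, r.Holds α) ∧ k t f rs = true := by
  induction n generalizing rs t f with
  | zero => exact ⟨t, f, rs, h, hrs, hs⟩
  | succ n ih =>
    obtain ⟨t', f', rs', h', hrs', hs'⟩ := pass_sound h hrs (by simp) hs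
    rw [ifZero_eq, ifZero_eq] at hs'
    split_ifs at hs' with h1 h2
    · exact ⟨_, _, _, h', hrs', hs'⟩
    · exact ih h' hrs' hs'
    · obtain ⟨i, hi⟩ := exists_mem_bits h1
      rw [mem_bits_land] at hi
      exact absurd (h'.1 i hi.1) (h'.2 i hi.2)

/-! ### Search along a decision tree. -/

/-- A decision tree. -/
inductive Tree
  | tip
  | node (v : ℕ) (l r : Tree)

/-- Propagate, and branch according to the decision tree, until `leaf` holds. -/
noncomputable def search (leaf : ℕ → ℕ → Bool) (T : Tree) : List Rule → ℕ → ℕ → Bool :=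
  Tree.rec (motive := fun _ => List Rule → ℕ → ℕ → Bool)
    -- The bound 12 affects only how much is derived; `settle_sound` holds for every bound.
    (fun rs t f => settle 12 rs (fun t f _ => leaf t f) t f)
    (fun v _ _ l r rs t f =>
      settle 12 rs (fun t f rs =>
        -- `Bool.rec` takes the value for `false` first, so this is a conjunction: the branch with
        -- `v` in the set is evaluated first, and the other one only if it succeeds.
        Bool.rec false (force (join f (maskOf [v])) (r rs t))
          (force (join t (maskOf [v])) fun t => l rs t f)) t f) T

/-- The set `α` itself selects a path through the tree. No contradiction can arise along it, so the
path reaches a tip, where `leaf` was evaluated. -/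
theorem search_sound {leaf : ℕ → ℕ → Bool} {T : Tree} {rs : List Rule} {t f : ℕ}
    (h : Consistent α t f) (hrs : ∀ r ∈ rs, r.Holds α) (hs : search leaf T rs t f = true) :
    ∃ t f, Consistent α t f ∧ leaf t f = true := by
  induction T generalizing rs t f with
  | tip =>
    change settle 12 rs (fun t f _ => leaf t f) t f = true at hs
    obtain ⟨t, f, -, h, -, hs⟩ := settle_sound h hrs hs
    exact ⟨t, f, h, hs⟩
  | node v l r ihl ihr =>
    change settle 12 rs (fun t f rs =>
        Bool.rec false (force (join f (maskOf [v])) (search leaf r rs t))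
          (force (join t (maskOf [v])) fun t => search leaf l rs t f)) t f = true at hs
    obtain ⟨t, f, rs, h, hrs, hs⟩ := settle_sound h hrs hs
    simp only [force_eq] at hs
    have hv : ∀ i ∈ bits (maskOf [v]), i = v := fun i hi => by
      simpa using mem_bits_maskOf.1 hi
    cases hl : search leaf l rs (join t (maskOf [v])) f with
    | false =>
      have : (Bool.rec false (search leaf r rs t (join f (maskOf [v])))
        (search leaf l rs (join t (maskOf [v])) f) : Bool) = true := hs
      rw [hl] at this
      exact absurd this (by simp)
    | true =>
      have : (Bool.rec false (search leaf r rs t (join f (maskOf [v])))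
        (search leaf l rs (join t (maskOf [v])) f) : Bool) = true := hs
      rw [hl] at this
      by_cases hα : α v
      · exact ihl (h.join_left fun i hi => hv i hi ▸ hα) hrs hl
      · exact ihr (h.join_right fun i hi => hv i hi ▸ hα) hrs this

end Search

open Vtx

/-! ### The combinatorial description of the gadgets

Vertices are numbered by their position in `xOrder`. -/

/-- The vertex with number `i`. -/
def vtx (i : ℕ) : Vtx := xOrder.getD i v0

/-- The number of a vertex. -/
def idx : Vtx → ℕ
  | b4 => 0 | b5 => 1 | b6 => 2 | b7 => 3 | v8 => 4 | p => 5 | b3 => 6 | b2 => 7 | b1 => 8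
  | v0 => 9 | v1 => 10 | v2 => 11 | v3 => 12 | q => 13 | v7 => 14 | v6 => 15 | v5 => 16 | v4 => 17

/-- Number of the edge between `i` and `j`. -/
noncomputable def code (i j : ℕ) : ℕ :=
  ifZero (Nat.sub j i) (Nat.add (Nat.mul 18 j) i) (Nat.add (Nat.mul 18 i) j)

/-- Number of the statement that the middle vertex of `i < j < k` is below the line through the
other two. -/
def triple (i j k : ℕ) : ℕ := Nat.add (Nat.mul 324 (Nat.succ k)) (Nat.add (Nat.mul 18 i) j)

/-- The rank of a vertex in `yOrder`. -/
def yRank (i : ℕ) : ℕ := [17, 16, 15, 14, 4, 13, 12, 11, 10, 9, 8, 7, 6, 5, 3, 2, 1, 0].getD i 0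

def isWest (i : ℕ) : Bool := Nat.ble i 4

def isSouth (i : ℕ) : Bool := Nat.beq i 4 || Nat.ble 14 i

def isInner (i : ℕ) : Bool := Nat.beq i 5 || Nat.beq i 13

/-- Whether the middle vertex of `i < j < k` is below the line through the other two, if this is
the same for all frame cells. -/
def orientation (i j k : ℕ) : Option Bool :=
  -- The middle vertex is on the north or east boundary, hence on the convex hull.
  bif Nat.ble 6 j && Nat.ble j 12 then some false
  else bif Nat.ble k 4 then some false
  else bif isSouth i && isSouth j && isSouth k then some false
  -- Here the middle vertex is on the west boundary and the last one is not, or the middle vertex is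
  -- on the south boundary and the first one is not. Convexity of the chain and its steepness or
  -- flatness decide.
  else bif !(isInner i || isInner j || isInner k) then some true
  -- With p or q involved, the sign is known if the middle vertex is the highest or the lowest of
  -- the three, or from the placement of p and q.
  else bif Nat.blt (yRank i) (yRank j) && Nat.blt (yRank k) (yRank j) then some false
  else bif Nat.blt (yRank j) (yRank i) && Nat.blt (yRank j) (yRank k) then some true
  else bif Nat.beq i 3 && Nat.beq j 5 && Nat.beq k 6 then some true
  else bif Nat.beq i 12 && Nat.beq j 13 && Nat.beq k 14 then some true
  else none

def pairs : List ℕ → List (ℕ × ℕ)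
  | [] => []
  | a :: l => l.map (fun b => (a, b)) ++ pairs l

def triples : List ℕ → List (ℕ × ℕ × ℕ)
  | [] => []
  | a :: l => (pairs l).map (fun b => (a, b)) ++ triples l

def quadruples : List ℕ → List (ℕ × ℕ × ℕ × ℕ)
  | [] => []
  | a :: l => (triples l).map (fun b => (a, b)) ++ quadruples l

/-- The chords between two vertices of the west boundary or two vertices of the south boundary,
which are outside the cell. -/
def blocked : List (ℕ × ℕ) :=
  [(0, 2), (0, 3), (0, 4), (1, 3), (1, 4), (2, 4),
    (4, 15), (4, 16), (4, 17), (14, 16), (14, 17), (15, 17)]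

def boundaryPairs : List (ℕ × ℕ) := boundaryEdges.map fun e => (idx e.1, idx e.2)

/-! ### Known facts, exclusions and clauses. -/

variable (V : List ℕ)

noncomputable def initTrue : ℕ :=
  maskOf (boundaryPairs.map (fun e => code e.1 e.2) ++
    ((triples V).filter fun s => orientation s.1 s.2.1 s.2.2 == some true).map
      fun s => triple s.1 s.2.1 s.2.2)

noncomputable def initFalse : ℕ :=
  maskOf (blocked.map (fun e => code e.1 e.2) ++
    ((triples V).filter fun s => orientation s.1 s.2.1 s.2.2 == some false).map
      fun s => triple s.1 s.2.1 s.2.2)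

/-- All pairs that are not pairs of two members of `V`. -/
noncomputable def foreign : ℕ :=
  maskOf (((pairs (List.range 18)).filter fun e => !(V.elem e.1 && V.elem e.2)).map
    fun e => code e.1 e.2)

noncomputable def allPairs : ℕ := maskOf ((pairs (List.range 18)).map fun e => code e.1 e.2)

/-- The boundary vertices in cyclic order. -/
def cycle : List ℕ := [0, 1, 2, 3, 4, 14, 15, 16, 17, 12, 11, 10, 9, 8, 7, 6]

def splits {γ : Type*} : List γ → List (List γ × γ × List γ)
  | [] => []
  | a :: l => ([], a, l) :: (splits l).map fun s => (a :: s.1, s.2.1, s.2.2)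

/-- The pairs of a vertex `v` in `l` and the mask of all chords at `v`. -/
noncomputable def withStars {β : Type} (l : List ℕ) : (List (ℕ × ℕ) → β) → β :=
  List.rec (motive := fun _ => (List (ℕ × ℕ) → β) → β) (fun k => k [])
    (fun v _ ih k => force (maskOf (cycle.map (code v))) fun m => ih fun r => k ((v, m) :: r)) l

noncomputable def union (l : List (ℕ × ℕ)) : ℕ :=
  List.rec (motive := fun _ => ℕ) 0 (fun a _ m => Nat.lor a.2 m) l

/-- Chords of the boundary cycle whose ends interleave are not both edges. -/
noncomputable def exclRules : List Rule :=
  withStars cycle fun l =>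
    (splits l).flatMap fun s => (splits s.2.2).map fun u =>
      force (maskOf [code s.2.1.1 u.2.1.1]) fun e =>
        -- The vertices in `u.1` are between the ends of the chord on the cycle and those in `s.1 ++
        -- u.2.2` are not, so a chord in both unions joins the two sides. Every chord has its own
        -- rule, which is why `Rule.excl` is propagated in one direction only.
        force (tag (body (Nat.land (union u.1) (union (s.1 ++ u.2.2))))) fun m => Rule.excl e m

/-- A clause that consists of statements `l.1` or their negations. -/
noncomputable def clauseOf (l : List (ℕ × Bool)) : Rule :=
  force (maskOf ((l.filter fun x => x.2).map Prod.fst)) fun p =>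
    force (maskOf ((l.filter fun x => !x.2).map Prod.fst)) fun n => Rule.clause p n

/-- Forbids the sign pattern `!s`, `s`, `!s`. Imposed for both `s` on all three-term subsequences of
ijk, ijl, ikl, jkl, it says that the signs change at most once. -/
def signotope (a b c : ℕ) (s : Bool) : List (ℕ × Bool) := [(a, s), (b, !s), (c, s)]

/-- For i, j, k, l in x-order, the edges ik and jl cross if ijk and jkl have the same sign, and il
and jk cross if ijl and ikl have different signs. The edges ij and kl never cross. -/
noncomputable def crossClauses (i j k l : ℕ) (s : Bool) : List (List (ℕ × Bool)) :=
  [[(code i k, false), (code j l, false), (triple i j k, s), (triple j k l, s)],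
    [(code i l, false), (code j k, false), (triple i j l, s), (triple i k l, !s)]]

def signClauses (i j k l : ℕ) (s : Bool) : List (List (ℕ × Bool)) :=
  [signotope (triple i j k) (triple i j l) (triple i k l) s,
    signotope (triple i j k) (triple i j l) (triple j k l) s,
    signotope (triple i j k) (triple i k l) (triple j k l) s,
    signotope (triple i j l) (triple i k l) (triple j k l) s]

/-- Chords between boundary vertices are treated by `exclRules`. The sign clauses are restricted to
quadruples that contain b7 and p, or q and v7. -/
noncomputable def quadClauses (x : ℕ × ℕ × ℕ × ℕ) : List (List (ℕ × Bool)) :=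
  match x with
  | (i, j, k, l) =>
    bif !(isInner i || isInner j || isInner k || isInner l) then []
    else (crossClauses i j k l true ++ crossClauses i j k l false) ++
      bif ([i, j, k, l].elem 3 && [i, j, k, l].elem 5) ||
        ([i, j, k, l].elem 13 && [i, j, k, l].elem 14)
      then signClauses i j k l true ++ signClauses i j k l false else []

/-- Any selection of true clauses is sound. Those with b4 or v4, the numbers 0 and 17, are left out.
-/
noncomputable def clauseRules : List Rule :=
  ((quadruples (V.filter fun i => !(Nat.beq i 0 || Nat.beq i 17))).flatMap quadClauses).map clauseOf


/-! ### Colorings, degree rules and certificates. -/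

def mkColoring (r b : Shade) : LocalColoring
  | .red => r
  | .blue => b

def colorings : List LocalColoring :=
  [mkColoring .light .light, mkColoring .light .dark, mkColoring .dark .light,
    mkColoring .dark .dark]

def TileType.edges (t : TileType) (χ : LocalColoring) : List (Vtx × Vtx) :=
  boundaryEdges ++ t.blackEdges ++ t.coloredEdges .red (χ .red) ++ t.coloredEdges .blue (χ .blue)

/-- The mask of the graph `t.U χ`. -/
noncomputable def TileType.mask (t : TileType) (χ : LocalColoring) : ℕ :=
  maskOf ((t.edges χ).map fun e => code (idx e.1) (idx e.2))

/-- The numbers of the vertices of a gadget. -/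
def TileType.members (t : TileType) : List ℕ :=
  (List.range 18).filter fun i => !isInner i || decide (vtx i ∈ t.interior)

/-- Whether the vertex `j` is in direction `D` from the vertex `i`. -/
def seen (D : Direction) (i j : ℕ) : Bool :=
  match D with
  | .north => Nat.blt (yRank i) (yRank j)
  | .south => Nat.blt (yRank j) (yRank i)
  | .east => Nat.blt i j
  | .west => Nat.blt j i

noncomputable def seenMask (V : List ℕ) (D : Direction) (i : ℕ) : ℕ :=
  maskOf ((V.filter (seen D i)).map (code i))

/-- The vertices and directions that are constrained. -/
def constrained (l : List ℕ) : List (ℕ × Direction) :=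
  l.flatMap fun i => ([.north, .south, .east, .west].filter
    fun D => !(unconstrained D).elem (vtx i)).map fun D => (i, D)

/-- The masks of the constrained directions of the vertices in `l`, and the degrees that they have
in the graph with the mask `u`. -/
noncomputable def countRules (V : List ℕ) (u : ℕ) (l : List ℕ) : List Rule :=
  (constrained l).map fun c =>
    force (seenMask V c.2 c.1) fun m =>
      force (popcount 18 (body (Nat.land m u))) fun k => Rule.count m k

/-- Whether two graphs have the same degrees in the constrained directions of the vertices in
`l`. -/
noncomputable def sameDegrees (V : List ℕ) (u u' : ℕ) (l : List ℕ) : Bool :=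
  (constrained l).all fun c => force (seenMask V c.2 c.1) fun m =>
    Nat.beq (popcount 18 (body (Nat.land m u))) (popcount 18 (body (Nat.land m u')))

def westList : List ℕ := [0, 1, 2, 3, 4]

def southList : List ℕ := [4, 14, 15, 16, 17]

def otherList (V : List ℕ) : List ℕ := V.filter fun i => !(isWest i || isSouth i)

/-- The graph with mask `u` has the edges in `t` and misses those in `f`. -/
noncomputable def agrees (t f u : ℕ) : Bool :=
  Nat.beq (body (diff u t)) 0 && Nat.beq (body (diff (diff allPairs u) f)) 0

/-- A decision tree in preorder, where zero is a tip. -/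
def treeOf (l : List ℕ) : Tree :=
  -- The list is read from the right with a stack of finished trees; the upper one becomes the
  -- branch in which `v` holds. Zero is free as a marker, because as a code it would denote a loop.
  (l.foldr (fun v st => match v, st with
    | 0, st => Tree.tip :: st
    | v, a :: b :: st => Tree.node v a b :: st
    | _, st => st) []).headD Tree.tip

/-- `w` and `s` list colorings that represent all degrees at the west and south boundary. -/
structure Certificate where
  w : List LocalColoring
  s : List LocalColoring
  trees : List (List (List ℕ))

noncomputable def repsCheck (t : TileType) (V : List ℕ) (reps : List LocalColoring) (l : List ℕ) :
    Bool :=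
  colorings.all fun χ => reps.any fun χ' => sameDegrees V (t.mask χ) (t.mask χ') l

noncomputable def validCheck (t : TileType) (c : Certificate) : Bool :=
  (fun V => repsCheck t V c.w westList && repsCheck t V c.s southList &&
    -- A single representative: away from the west and south boundaries, the constrained degrees do
    -- not depend on the coloring.
    repsCheck t V [mkColoring .light .light] (otherList V) &&
    (force (initTrue V) fun t₀ => force (join (initFalse V) (foreign V)) fun f₀ =>
      -- `zip` truncates, so the lengths are compared to ensure that every pair of representatives
      -- has a tree.
      (fun rs => decide (c.w.length ≤ c.trees.length) &&
        (c.w.zip c.trees).all fun a => decide (c.s.length ≤ a.2.length) &&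
        (c.s.zip a.2).all fun b =>
          search (fun t' f' => colorings.any fun χ => agrees t' f' (t.mask χ)) (treeOf b.2)
            (countRules V (t.mask a.1) westList ++ countRules V (t.mask b.1) southList ++
              countRules V (t.mask (mkColoring .light .light)) (otherList V) ++ rs) t₀ f₀)
        (exclRules ++ clauseRules V))) t.members


/-! ### Orientations of points in the plane -/

section Plane

variable {a b c d x : ℝ × ℝ}

theorem orient_rotate (a b c : ℝ × ℝ) : orient b c a = orient a b c := by
  unfold orient
  ring

theorem orient_swap (a b c : ℝ × ℝ) : orient a c b = -orient a b c := by
  unfold orient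
  ring

theorem orient_reverse (a b c : ℝ × ℝ) : orient b a c = -orient a b c := by
  unfold orient
  ring

theorem orient_self_left (a b : ℝ × ℝ) : orient a b a = 0 := by
  unfold orient
  ring

theorem orient_self_right (a b : ℝ × ℝ) : orient a b b = 0 := by
  unfold orient
  ring

/-- The line through b and d has a strictly below it and c not above it, so the path from a over b
to c bends downwards. -/
theorem orient_neg_of_edge_above (hab : a.1 < b.1) (hbc : b.1 < c.1) (hbd : b.1 < d.1)
    (ha : orient b d a < 0) (hc : orient b d c ≤ 0) : orient a b c < 0 := by
  have e : orient a b c * (d.1 - b.1) =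
      (c.1 - b.1) * orient b d a + (b.1 - a.1) * orient b d c := by
    unfold orient
    ring
  have h1 := mul_neg_of_pos_of_neg (sub_pos.2 hbc) ha
  have h2 := mul_nonpos_of_nonneg_of_nonpos (sub_pos.2 hab).le hc
  exact neg_of_mul_neg_left (by linarith) (sub_pos.2 hbd).le

theorem orient_pos_of_edge_left (hab : a.1 < b.1) (hbc : b.1 < c.1) (had : a.1 < d.1)
    (hb : orient a d b ≤ 0) (hc : 0 < orient a d c) : 0 < orient a b c := by
  have e : orient a b c * (d.1 - a.1) =
      (b.1 - a.1) * orient a d c - (c.1 - a.1) * orient a d b := by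
    unfold orient
    ring
  have h1 := mul_pos (sub_pos.2 hab) hc
  have h2 := mul_nonpos_of_nonneg_of_nonpos (sub_pos.2 (hab.trans hbc)).le hb
  exact pos_of_mul_pos_left (by linarith) (sub_pos.2 had).le

theorem orient_pos_of_edge_right (hab : a.1 < b.1) (hbc : b.1 < c.1) (hdc : d.1 < c.1)
    (ha : 0 < orient d c a) (hb : orient d c b ≤ 0) : 0 < orient a b c := by
  have e : orient a b c * (c.1 - d.1) =
      (c.1 - b.1) * orient d c a - (c.1 - a.1) * orient d c b := by
    unfold orient
    ring
  have h1 := mul_pos (sub_pos.2 hbc) ha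
  have h2 := mul_nonpos_of_nonneg_of_nonpos (sub_pos.2 (hab.trans hbc)).le hb
  exact pos_of_mul_pos_left (by linarith) (sub_pos.2 hdc).le

theorem orient_neg_of_high (hab : a.1 < b.1) (hbc : b.1 < c.1) (ha : a.2 < b.2) (hc : c.2 < b.2) :
    orient a b c < 0 := by
  have h1 := mul_pos (sub_pos.2 hab) (sub_pos.2 hc)
  have h2 := mul_pos (sub_pos.2 hbc) (sub_pos.2 ha)
  unfold orient
  linarith

theorem orient_pos_of_low (hab : a.1 < b.1) (hbc : b.1 < c.1) (ha : b.2 < a.2) (hc : b.2 < c.2) :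
    0 < orient a b c := by
  have h1 := mul_pos (sub_pos.2 hab) (sub_pos.2 hc)
  have h2 := mul_pos (sub_pos.2 hbc) (sub_pos.2 ha)
  unfold orient
  linarith

/-- `y` is a combination of `x` and `w` with positive coefficients. -/
def Between (x y w : ℝ) : Prop := ∃ r s t : ℝ, 0 < r ∧ 0 < s ∧ 0 < t ∧ s * y = r * x + t * w

theorem Between.pos {x y w : ℝ} (h : Between x y w) (hx : 0 < x) (hw : 0 < w) : 0 < y := by
  obtain ⟨r, s, t, hr, hs, ht, e⟩ := h
  exact pos_of_mul_pos_right (e ▸ by positivity) hs.le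

theorem Between.neg {x y w : ℝ} (h : Between x y w) (hx : x < 0) (hw : w < 0) : y < 0 := by
  obtain ⟨r, s, t, hr, hs, ht, e⟩ := h
  have h1 := mul_neg_of_pos_of_neg hr hx
  have h2 := mul_neg_of_pos_of_neg ht hw
  exact neg_of_mul_neg_right (e ▸ add_neg h1 h2) hs.le

/-- These four relations give the signotope axiom: of any three terms in the sequence abc, abd, acd,
bcd, the middle one is a positive combination of the other two. -/
theorem between_fix_first (hab : a.1 < b.1) (hbc : b.1 < c.1) (hcd : c.1 < d.1) :
    Between (orient a b c) (orient a b d) (orient a c d) :=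
  ⟨d.1 - a.1, c.1 - a.1, b.1 - a.1, by linarith, by linarith, by linarith, by unfold orient; ring⟩

theorem between_fix_second (hab : a.1 < b.1) (hbc : b.1 < c.1) (hcd : c.1 < d.1) :
    Between (orient a b c) (orient a b d) (orient b c d) :=
  ⟨d.1 - b.1, c.1 - b.1, b.1 - a.1, by linarith, by linarith, by linarith, by unfold orient; ring⟩

theorem between_fix_third (hab : a.1 < b.1) (hbc : b.1 < c.1) (hcd : c.1 < d.1) :
    Between (orient a b c) (orient a c d) (orient b c d) :=
  ⟨d.1 - c.1, c.1 - b.1, c.1 - a.1, by linarith, by linarith, by linarith, by unfold orient; ring⟩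

theorem between_fix_fourth (hab : a.1 < b.1) (hbc : b.1 < c.1) (hcd : c.1 < d.1) :
    Between (orient a b d) (orient a c d) (orient b c d) :=
  ⟨d.1 - c.1, d.1 - b.1, d.1 - a.1, by linarith, by linarith, by linarith, by unfold orient; ring⟩

/-- Two segments cross if each of them has its ends on different sides of the other one. -/
theorem not_disjoint_openSegment (h1 : orient a b c * orient a b d < 0)
    (h2 : orient c d a * orient c d b < 0) :
    ¬ Disjoint (openSegment ℝ a b) (openSegment ℝ c d) := by
  have key : ∀ u v : ℝ, u * v < 0 → 0 < u / (u - v) ∧ 0 < 1 - u / (u - v) ∧ u - v ≠ 0 := by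
    intro u v h
    rcases mul_neg_iff.1 h with ⟨hu, hv⟩ | ⟨hu, hv⟩
    · have : 0 < u - v := by linarith
      refine ⟨div_pos hu this, ?_, this.ne'⟩
      rw [one_sub_div this.ne']
      exact div_pos (by linarith) this
    · have : u - v < 0 := by linarith
      refine ⟨div_pos_of_neg_of_neg hu this, ?_, this.ne⟩
      rw [one_sub_div this.ne]
      exact div_pos_of_neg_of_neg (by linarith) this
  obtain ⟨s0, s1, s2⟩ := key _ _ h2
  obtain ⟨t0, t1, t2⟩ := key _ _ h1
  rw [Set.not_disjoint_iff]
  -- The crossing point divides each segment in the ratio of the distances of its ends from the line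
  -- of the other one.
  refine ⟨_, ⟨_, _, s1, s0, by ring, rfl⟩, ⟨_, _, t1, t0, by ring, ?_⟩⟩
  have e : orient a b c - orient a b d = -(orient c d a - orient c d b) := by
    unfold orient
    ring
  rw [e, div_neg]
  generalize hD : orient c d a - orient c d b = D at *
  have hx : ((1 - orient c d a / D) * a.1 + orient c d a / D * b.1) =
      ((1 - -(orient a b c / D)) * c.1 + -(orient a b c / D) * d.1) := by
    field_simp
    rw [← hD]
    unfold orient
    ring
  have hy : ((1 - orient c d a / D) * a.2 + orient c d a / D * b.2) =
      ((1 - -(orient a b c / D)) * c.2 + -(orient a b c / D) * d.2) := by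
    field_simp
    rw [← hD]
    unfold orient
    ring
  exact Prod.ext hx.symm hy.symm

/-- The segments `a c` and `b d` cross if `b` and `c` are on the same side of the other one. -/
theorem not_disjoint_of_interleaved (hab : a.1 < b.1) (hbc : b.1 < c.1) (hcd : c.1 < d.1)
    (h : 0 < orient a b c * orient b c d) :
    ¬ Disjoint (openSegment ℝ a c) (openSegment ℝ b d) := by
  have hs : 0 < orient a b c * orient a c d ∧ 0 < orient b c d * orient a b d := by
    rcases pos_and_pos_or_neg_and_neg_of_mul_pos h with ⟨h1, h2⟩ | ⟨h1, h2⟩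
    · exact ⟨mul_pos h1 ((between_fix_third hab hbc hcd).pos h1 h2),
        mul_pos h2 ((between_fix_second hab hbc hcd).pos h1 h2)⟩
    · exact ⟨mul_pos_of_neg_of_neg h1 ((between_fix_third hab hbc hcd).neg h1 h2),
        mul_pos_of_neg_of_neg h2 ((between_fix_second hab hbc hcd).neg h1 h2)⟩
  apply not_disjoint_openSegment
  · rw [orient_swap a b c]
    linarith [hs.1]
  · rw [orient_swap b c d, orient_rotate a b d]
    linarith [hs.2]

/-- The segments `a d` and `b c` cross if `b` and `c` are on different sides of the former. -/
theorem not_disjoint_of_nested (hab : a.1 < b.1) (hbc : b.1 < c.1) (hcd : c.1 < d.1)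
    (h : orient a b d * orient a c d < 0) :
    ¬ Disjoint (openSegment ℝ a d) (openSegment ℝ b c) := by
  -- The ends a and d also lie on different sides of the line bc: the signs of abc and bcd are
  -- forced to be those of abd and acd.
  have hs : orient a b c * orient b c d < 0 := by
    by_contra! hc
    rcases mul_neg_iff.1 h with ⟨h1, h2⟩ | ⟨h1, h2⟩
    · have h3 : 0 < orient a b c := by
        by_contra! h3
        obtain ⟨r, s, t, hr, hs, ht, e⟩ := between_fix_first hab hbc hcd
        nlinarith
      have h4 : orient b c d < 0 := by
        by_contra! h4
        obtain ⟨r, s, t, hr, hs, ht, e⟩ := between_fix_fourth hab hbc hcd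
        nlinarith
      nlinarith
    · have h3 : orient a b c < 0 := by
        by_contra! h3
        obtain ⟨r, s, t, hr, hs, ht, e⟩ := between_fix_first hab hbc hcd
        nlinarith
      have h4 : 0 < orient b c d := by
        by_contra! h4
        obtain ⟨r, s, t, hr, hs, ht, e⟩ := between_fix_fourth hab hbc hcd
        nlinarith
      nlinarith
  apply not_disjoint_openSegment
  · rw [orient_swap a b d, orient_swap a c d]
    linarith
  · rwa [orient_rotate a b c]

end Plane


/-! ### The coordinates of a frame cell -/

theorem idx_lt (u : Vtx) : idx u < 18 := by cases u <;> decide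

theorem vtx_idx (u : Vtx) : vtx (idx u) = u := by cases u <;> rfl

theorem idx_vtx : ∀ i < 18, idx (vtx i) = i := by decide

theorem idx_injective : Function.Injective idx := fun u v h => by
  rw [← vtx_idx u, h, vtx_idx]

open TileType Hue in
instance : Fintype TileType :=
  ⟨{blank, SE red, SE blue, SW red, SW blue, NS red, NS blue, NW red, NW blue, NE red, NE blue,
    EW red, EW blue, crossing1, crossing2, crossing3, crossing4}, by
    rintro (_ | ⟨_ | _⟩ | ⟨_ | _⟩ | ⟨_ | _⟩ | ⟨_ | _⟩ | ⟨_ | _⟩ | ⟨_ | _⟩ | _ | _ | _ | _) <;>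
      decide⟩

theorem TileType.mem_members {t : TileType} {i : ℕ} :
    i ∈ t.members ↔ i < 18 ∧ vtx i ∈ t.vertices := by
  by_cases hi : i < 18
  · revert t i
    decide +kernel
  · exact iff_of_false
      (fun h => hi (List.mem_range.1 (List.mem_filter.1 h).1)) fun h => hi h.1

theorem TileType.idx_mem {t : TileType} {u : Vtx} : idx u ∈ t.members ↔ u ∈ t.vertices := by
  rw [TileType.mem_members, vtx_idx, and_iff_right (idx_lt u)]

theorem TileType.members_sorted (t : TileType) : t.members.Pairwise (· < ·) := by
  revert t
  decide +kernel

theorem TileType.length_members_le (t : TileType) : t.members.length ≤ 18 := by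
  revert t
  decide +kernel

theorem TileType.mem_members_of_outer {t : TileType} {i : ℕ} (hi : i < 18)
    (h : isInner i = false) : i ∈ t.members :=
  List.mem_filter.2 ⟨List.mem_range.2 hi, by simp [h]⟩

/-- The sorted list of vertices gives the order of any two of them. -/
theorem lt_of_pairwise_filter {l : List Vtx} {V : Finset Vtx} {f : Vtx → ℝ}
    (h : (l.filter (· ∈ V)).Pairwise fun a b => f a < f b) {i j : ℕ} (hi : i < j)
    (hj : j < l.length) (hiV : l.getD i v0 ∈ V) (hjV : l.getD j v0 ∈ V) :
    f (l.getD i v0) < f (l.getD j v0) := by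
  rw [List.getD_eq_getElem _ _ (hi.trans hj)] at hiV ⊢
  rw [List.getD_eq_getElem _ _ hj] at hjV ⊢
  rw [List.pairwise_filter] at h
  exact List.pairwise_iff_getElem.1 h i j (hi.trans hj) hj hi (by simpa using hiV)
    (by simpa using hjV)

variable {t : TileType} {z : Vtx → ℝ × ℝ}

theorem IsFrameCell.fst_lt (hz : IsFrameCell t.vertices z) {i j : ℕ} (hi : i ∈ t.members)
    (hj : j ∈ t.members) (h : i < j) : (z (vtx i)).1 < (z (vtx j)).1 := by
  rw [TileType.mem_members] at hi hj
  exact lt_of_pairwise_filter (f := fun u => (z u).1) hz.x_order h hj.1 hi.2 hj.2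

theorem IsFrameCell.snd_lt (hz : IsFrameCell t.vertices z) {i j : ℕ} (hi : i ∈ t.members)
    (hj : j ∈ t.members) (h : yRank i < yRank j) : (z (vtx i)).2 < (z (vtx j)).2 := by
  rw [TileType.mem_members] at hi hj
  have r : ∀ k < 18, yRank k < 18 := by decide
  have e : ∀ k < 18, vtx k = yOrder.getD (yRank k) v0 := by decide
  have := lt_of_pairwise_filter (f := fun u => (z u).2) hz.y_order h (r j hj.1)
    (e i hi.1 ▸ hi.2) (e j hj.1 ▸ hj.2)
  rwa [← e i hi.1, ← e j hj.1] at this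

theorem IsFrameCell.fst_lt_iff (hz : IsFrameCell t.vertices z) {i j : ℕ} (hi : i ∈ t.members)
    (hj : j ∈ t.members) : (z (vtx i)).1 < (z (vtx j)).1 ↔ i < j := by
  refine ⟨fun h => ?_, hz.fst_lt hi hj⟩
  rcases lt_trichotomy i j with h' | rfl | h'
  · exact h'
  · exact absurd h (lt_irrefl _)
  · exact absurd h (hz.fst_lt hj hi h').not_gt

theorem IsFrameCell.snd_lt_iff (hz : IsFrameCell t.vertices z) {i j : ℕ} (hi : i ∈ t.members)
    (hj : j ∈ t.members) : (z (vtx i)).2 < (z (vtx j)).2 ↔ yRank i < yRank j := by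
  refine ⟨fun h => ?_, hz.snd_lt hi hj⟩
  rcases lt_trichotomy (yRank i) (yRank j) with h' | h' | h'
  · exact h'
  · have inj : ∀ i < 18, ∀ j < 18, yRank i = yRank j → i = j := by decide
    rw [inj i (TileType.mem_members.1 hi).1 j (TileType.mem_members.1 hj).1 h'] at h
    exact absurd h (lt_irrefl _)
  · exact absurd h (hz.snd_lt hj hi h').not_gt

/-- The orientation of three vertices that are given by their numbers. -/
noncomputable def turn (z : Vtx → ℝ × ℝ) (i j k : ℕ) : ℝ :=
  orient (z (vtx i)) (z (vtx j)) (z (vtx k))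

theorem IsFrameCell.turn_ne_zero (hz : IsFrameCell t.vertices z) {i j k : ℕ} (hi : i ∈ t.members)
    (hj : j ∈ t.members) (hk : k ∈ t.members) (hij : i < j) (hjk : j < k) : turn z i j k ≠ 0 := by
  have h1 := (hz.fst_lt hi hj hij)
  have h2 := (hz.fst_lt hj hk hjk)
  rw [TileType.mem_members] at hi hj hk
  refine hz.general_position _ hi.2 _ hj.2 _ hk.2 ?_ ?_ ?_ <;> intro h <;> rw [h] at h1
  · exact lt_irrefl _ h1
  · exact lt_irrefl _ (h1.trans h2)
  · exact lt_irrefl _ (h ▸ h2)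

def pairsOf (l : List (Vtx × Vtx)) : List (ℕ × ℕ) := l.map fun e => (idx e.1, idx e.2)

theorem exists_of_mem_pairsOf {l : List (Vtx × Vtx)} {i j : ℕ} (h : (i, j) ∈ pairsOf l) :
    (vtx i, vtx j) ∈ l := by
  obtain ⟨e, he, h⟩ := List.mem_map.1 h
  obtain ⟨rfl, rfl⟩ := Prod.mk.inj h
  rwa [vtx_idx, vtx_idx]

theorem IsFrameCell.turn_upper (hz : IsFrameCell t.vertices z) {i j k : ℕ}
    (h : (i, j) ∈ pairsOf upperEdges) (hk : k ∈ t.members) : turn z i j k ≤ 0 ∧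
      (k ≠ i → k ≠ j → turn z i j k < 0) := by
  have hij : i < 18 ∧ j < 18 := by
    obtain ⟨e, -, h⟩ := List.mem_map.1 h
    obtain ⟨rfl, rfl⟩ := Prod.mk.inj h
    exact ⟨idx_lt _, idx_lt _⟩
  have hk' := TileType.mem_members.1 hk
  have h' : k ≠ i → k ≠ j → turn z i j k < 0 := fun hi hj =>
    hz.north_east _ (exists_of_mem_pairsOf h) _ hk'.2
      (fun e => hi (by rw [← idx_vtx k hk'.1, e, idx_vtx i hij.1]))
      (fun e => hj (by rw [← idx_vtx k hk'.1, e, idx_vtx j hij.2]))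
  refine ⟨?_, h'⟩
  by_cases hi : k = i
  · rw [hi, turn, orient_self_left]
  by_cases hj : k = j
  · rw [hj, turn, orient_self_right]
  exact (h' hi hj).le

theorem turn_convex {l : List Vtx} (hl : ∀ e ∈ links l, ∀ c ∈ l, c ≠ e.1 → c ≠ e.2 →
    orient (z e.1) (z e.2) (z c) < 0) {i j k : ℕ}
    (h : (i, j) ∈ pairsOf (links l)) (hk : k < 18) (hkl : vtx k ∈ l) : turn z i j k ≤ 0 ∧
      (k ≠ i → k ≠ j → turn z i j k < 0) := by
  have hij : i < 18 ∧ j < 18 := by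
    obtain ⟨e, -, h⟩ := List.mem_map.1 h
    obtain ⟨rfl, rfl⟩ := Prod.mk.inj h
    exact ⟨idx_lt _, idx_lt _⟩
  have h' : k ≠ i → k ≠ j → turn z i j k < 0 := fun hi hj =>
    hl _ (exists_of_mem_pairsOf h) _ hkl
      (fun e => hi (by rw [← idx_vtx k hk, e, idx_vtx i hij.1]))
      (fun e => hj (by rw [← idx_vtx k hk, e, idx_vtx j hij.2]))
  refine ⟨?_, h'⟩
  by_cases hi : k = i
  · rw [hi, turn, orient_self_left]
  by_cases hj : k = j
  · rw [hj, turn, orient_self_right]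
  exact (h' hi hj).le

/-- The vertex after `j` on the boundary. -/
def next (j : ℕ) : ℕ := if j = 12 then 17 else j + 1

/-- The upper boundary edge that starts at `j` has all other vertices below its line. -/
theorem IsFrameCell.turn_neg_of_north (hz : IsFrameCell t.vertices z) {i j k : ℕ}
    (hi : i ∈ t.members) (hj : j ∈ t.members) (hk : k ∈ t.members) (hij : i < j) (hjk : j < k)
    (h : 6 ≤ j ∧ j ≤ 12) : turn z i j k < 0 := by
  have e : ∀ j, 6 ≤ j ∧ j ≤ 12 → (j, next j) ∈ pairsOf upperEdges ∧ isInner (next j) = false ∧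
      j < next j ∧ next j < 18 := by
    rintro j ⟨h1, h2⟩
    interval_cases j <;> decide
  obtain ⟨h1, h2, h3, h4⟩ := e j h
  have hn : next j ∈ t.members := TileType.mem_members_of_outer h4 h2
  exact orient_neg_of_edge_above (hz.fst_lt hi hj hij) (hz.fst_lt hj hk hjk) (hz.fst_lt hj hn h3)
    ((hz.turn_upper h1 hi).2 hij.ne (hij.trans h3).ne) (hz.turn_upper h1 hk).1

theorem IsFrameCell.turn_neg_of_chain (hz : IsFrameCell t.vertices z) {l : List Vtx}
    (hl : ∀ e ∈ links l, ∀ c ∈ l, c ≠ e.1 → c ≠ e.2 → orient (z e.1) (z e.2) (z c) < 0)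
    {i j k : ℕ}
    (hi : i ∈ t.members) (hj : j ∈ t.members) (hk : k ∈ t.members) (hij : i < j) (hjk : j < k)
    (hil : vtx i ∈ l) (hkl : vtx k ∈ l) (h : (j, j + 1) ∈ pairsOf (links l))
    (hn : isInner (j + 1) = false) : turn z i j k < 0 := by
  have hi' := TileType.mem_members.1 hi
  have hk' := TileType.mem_members.1 hk
  have hn : j + 1 ∈ t.members := TileType.mem_members_of_outer (by omega) hn
  exact orient_neg_of_edge_above (hz.fst_lt hi hj hij) (hz.fst_lt hj hk hjk)
    (hz.fst_lt hj hn (by omega))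
    ((turn_convex hl h hi'.1 hil).2 (by omega) (by omega)) (turn_convex hl h hk'.1 hkl).1

/-- The line through the west edge that starts at `i` separates the other two: `k` is above it by
steepness, and `j` is on or below it by convexity. For the south boundary, the edge that ends at `k`
plays this role. -/
theorem IsFrameCell.turn_pos_of_west (hz : IsFrameCell t.vertices z) {i j k : ℕ}
    (hi : i ∈ t.members) (hj : j ∈ t.members) (hk : k ∈ t.members) (hij : i < j) (hjk : j < k)
    (hj4 : j ≤ 4) (hk4 : 4 < k) (hk' : isInner k = false) : 0 < turn z i j k := by
  have e : ∀ i < 4, (i, i + 1) ∈ pairsOf (links westPath) := by decide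
  have e' : ∀ j < 5, vtx j ∈ westPath := by decide
  have e'' : ∀ k < 18, 4 < k → isInner k = false → vtx k ∈ northPath ++ eastPath ++ southPath ∧
    vtx k ∉ westPath := by decide
  have hn : i + 1 ∈ t.members := TileType.mem_members_of_outer (by omega)
    (by have := hij.trans_le hj4; interval_cases i <;> rfl)
  obtain ⟨h1, h2⟩ := e'' k (TileType.mem_members.1 hk).1 hk4 hk'
  exact orient_pos_of_edge_left (hz.fst_lt hi hj hij) (hz.fst_lt hj hk hjk)
    (hz.fst_lt hi hn (by omega))
    (turn_convex hz.west_convex (e i (by omega)) (by omega) (e' j (by omega))).1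
    (hz.west_steep _ (exists_of_mem_pairsOf (e i (by omega))) _ h1 h2)

theorem IsFrameCell.turn_pos_of_south (hz : IsFrameCell t.vertices z) {i j k : ℕ}
    (hi : i ∈ t.members) (hj : j ∈ t.members) (hk : k ∈ t.members) (hij : i < j) (hjk : j < k)
    (hj4 : 14 ≤ j) (hi4 : isSouth i = false) (hi' : isInner i = false) : 0 < turn z i j k := by
  have e : ∀ k < 18, 15 ≤ k → (k - 1, k) ∈ pairsOf (links southPath) := by decide
  have e' : ∀ j < 18, 14 ≤ j → vtx j ∈ southPath := by decide
  have e'' : ∀ k < 18, isSouth k = false → isInner k = false →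
    vtx k ∈ northPath ++ eastPath ++ westPath ∧ vtx k ∉ southPath := by decide
  have hk' := (TileType.mem_members.1 hk).1
  have hj' := (TileType.mem_members.1 hj).1
  have hn : k - 1 ∈ t.members := TileType.mem_members_of_outer (by omega)
    (by have : 15 ≤ k := by omega
        interval_cases k <;> rfl)
  obtain ⟨h1, h2⟩ := e'' i (TileType.mem_members.1 hi).1 hi4 hi'
  exact orient_pos_of_edge_right (hz.fst_lt hi hj hij) (hz.fst_lt hj hk hjk)
    (hz.fst_lt hn hk (by omega))
    (hz.south_flat _ (exists_of_mem_pairsOf (e k hk' (by omega))) _ h1 h2)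
    (turn_convex hz.south_convex (e k hk' (by omega)) (by omega) (e' j hj' (by omega))).1

theorem IsFrameCell.orientation_sound (hz : IsFrameCell t.vertices z) {i j k : ℕ}
    (hi : i ∈ t.members) (hj : j ∈ t.members) (hk : k ∈ t.members) (hij : i < j) (hjk : j < k)
    {s : Bool} (h : orientation i j k = some s) : 0 < turn z i j k ↔ s = true := by
  have pos : 0 < turn z i j k → some true = some s → (0 < turn z i j k ↔ s = true) :=
    fun h1 h2 => iff_of_true h1 (Option.some.inj h2).symm
  have neg : turn z i j k < 0 → some false = some s → (0 < turn z i j k ↔ s = true) :=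
    fun h1 h2 => iff_of_false h1.not_gt (by rw [← Option.some.inj h2]; exact Bool.false_ne_true)
  have hi' := TileType.mem_members.1 hi
  have hj' := TileType.mem_members.1 hj
  have hk' := TileType.mem_members.1 hk
  simp only [orientation, Bool.cond_eq_ite] at h
  split_ifs at h with h1 h2 h3 h4 h5 h6 h7 h8
  · refine neg (hz.turn_neg_of_north hi hj hk hij hjk ?_) h
    simpa using h1
  · refine neg (hz.turn_neg_of_chain hz.west_convex hi hj hk hij hjk ?_ ?_ ?_ ?_) h
    all_goals have hk4 : k ≤ 4 := by simpa using h2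
    · exact (by decide : ∀ i < 5, vtx i ∈ westPath) i (by omega)
    · exact (by decide : ∀ i < 5, vtx i ∈ westPath) k (by omega)
    · exact (by decide : ∀ i < 4, (i, i + 1) ∈ pairsOf (links westPath)) j (by omega)
    · exact (by decide : ∀ i < 4, isInner (i + 1) = false) j (by omega)
  · have e : ∀ i < 18, isSouth i = true → vtx i ∈ southPath := by decide
    simp only [Bool.and_eq_true] at h3
    refine neg (hz.turn_neg_of_chain hz.south_convex hi hj hk hij hjk (e i hi'.1 h3.1.1)
      (e k hk'.1 h3.2) ?_ ?_) h
    all_goals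
      have hj4 : 14 ≤ j := by
        have := h3.1.1
        have := h3.1.2
        simp [isSouth] at *
        omega
    · exact (by decide : ∀ j < 17, 14 ≤ j → (j, j + 1) ∈ pairsOf (links southPath)) j (by omega) hj4
    · exact (by decide : ∀ j < 17, 14 ≤ j → isInner (j + 1) = false) j (by omega) hj4
  · simp only [Bool.not_eq_true', Bool.or_eq_false_iff] at h4
    refine pos ?_ h
    by_cases hj4 : j ≤ 4
    · refine hz.turn_pos_of_west hi hj hk hij hjk hj4 ?_ h4.2
      simpa using h2
    · have hj14 : 14 ≤ j := (by decide : ∀ j < 18, ¬ j ≤ 4 →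
        ¬ (Nat.ble 6 j && Nat.ble j 12) = true →
        isInner j = false → 14 ≤ j) j hj'.1 hj4 h1 h4.1.2
      refine hz.turn_pos_of_south hi hj hk hij hjk hj14 ?_ h4.1.1
      by_contra hc
      rw [Bool.not_eq_false] at hc
      have e : ∀ j, 14 ≤ j → isSouth j = true := fun j hj => by
        rw [isSouth, Nat.ble_eq_true_of_le hj, Bool.or_true]
      rw [hc, e j hj14, e k (by omega)] at h3
      exact h3 rfl
  · simp only [Bool.and_eq_true, Nat.blt_eq] at h5
    exact neg (orient_neg_of_high (hz.fst_lt hi hj hij) (hz.fst_lt hj hk hjk)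
      (hz.snd_lt hi hj h5.1) (hz.snd_lt hk hj h5.2)) h
  · simp only [Bool.and_eq_true, Nat.blt_eq] at h6
    exact pos (orient_pos_of_low (hz.fst_lt hi hj hij) (hz.fst_lt hj hk hjk)
      (hz.snd_lt hj hi h6.1) (hz.snd_lt hj hk h6.2)) h
  · simp only [Bool.and_eq_true, Nat.beq_eq] at h7
    obtain ⟨⟨rfl, rfl⟩, rfl⟩ := h7
    refine pos ?_ h
    have := hz.p_place hj'.2
    change 0 < orient (z b7) (z p) (z b3)
    rw [orient_swap]
    linarith
  · simp only [Bool.and_eq_true, Nat.beq_eq] at h8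
    obtain ⟨⟨rfl, rfl⟩, rfl⟩ := h8
    refine pos ?_ h
    have := hz.q_place hj'.2
    change 0 < orient (z v3) (z q) (z v7)
    rw [orient_swap]
    linarith


/-! ### Soundness of the combinatorial description -/

theorem code_eq (i j : ℕ) : code i j = if j - i = 0 then 18 * j + i else 18 * i + j :=
  ifZero_eq _ _ _

theorem code_comm (i j : ℕ) : code i j = code j i := by
  rw [code_eq, code_eq]
  split_ifs <;> omega

theorem code_injective {i j k l : ℕ} (hi : i < 18) (hj : j < 18) (hk : k < 18) (hl : l < 18)
    (h : code i j = code k l) : i = k ∧ j = l ∨ i = l ∧ j = k := by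
  rw [code_eq, code_eq] at h
  split_ifs at h <;> omega

/-- The numbers of the edges of `T` and of the triples that are oriented counterclockwise. -/
def Describes (z : Vtx → ℝ × ℝ) (T : SimpleGraph Vtx) (v : ℕ) : Prop :=
  -- Codes of edges are below 324 = 18 * 18. Codes of triples are not, since they store `k + 1` as
  -- the leading digit.
  if v < 324 then T.Adj (vtx (v / 18)) (vtx (v % 18))
  else 0 < turn z (v / 18 % 18) (v % 18) (v / 324 - 1)

theorem describes_code {z : Vtx → ℝ × ℝ} {T : SimpleGraph Vtx} {i j : ℕ} (hi : i < 18)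
    (hj : j < 18) : Describes z T (code i j) ↔ T.Adj (vtx i) (vtx j) := by
  rw [code_eq]
  split_ifs
  · rw [Describes, if_pos (by omega), show (18 * j + i) / 18 = j by omega,
      show (18 * j + i) % 18 = i by omega, T.adj_comm]
  · rw [Describes, if_pos (by omega), show (18 * i + j) / 18 = i by omega,
      show (18 * i + j) % 18 = j by omega]

theorem describes_code_idx {z : Vtx → ℝ × ℝ} {T : SimpleGraph Vtx} (u v : Vtx) :
    Describes z T (code (idx u) (idx v)) ↔ T.Adj u v := by
  rw [describes_code (idx_lt u) (idx_lt v), vtx_idx, vtx_idx]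

theorem describes_triple {z : Vtx → ℝ × ℝ} {T : SimpleGraph Vtx} {i j k : ℕ} (hi : i < 18)
    (hj : j < 18) : Describes z T (triple i j k) ↔ 0 < turn z i j k := by
  change Describes z T (324 * (k + 1) + (18 * i + j)) ↔ _
  rw [Describes, if_neg (by omega), show (324 * (k + 1) + (18 * i + j)) / 18 % 18 = i by omega,
    show (324 * (k + 1) + (18 * i + j)) % 18 = j by omega,
    show (324 * (k + 1) + (18 * i + j)) / 324 - 1 = k by omega]

theorem mem_of_mem_pairs {l : List ℕ} (hl : l.Pairwise (· < ·)) {x : ℕ × ℕ} (h : x ∈ pairs l) :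
    x.1 ∈ l ∧ x.2 ∈ l ∧ x.1 < x.2 := by
  induction l with
  | nil => exact absurd h List.not_mem_nil
  | cons a l ih =>
    rw [List.pairwise_cons] at hl
    rcases List.mem_append.1 h with h | h
    · obtain ⟨b, hb, rfl⟩ := List.mem_map.1 h
      exact ⟨by simp, by simp [hb], hl.1 b hb⟩
    · obtain ⟨h1, h2, h3⟩ := ih hl.2 h
      exact ⟨by simp [h1], by simp [h2], h3⟩

theorem mem_of_mem_triples {l : List ℕ} (hl : l.Pairwise (· < ·)) {x : ℕ × ℕ × ℕ}
    (h : x ∈ triples l) : x.1 ∈ l ∧ x.2.1 ∈ l ∧ x.2.2 ∈ l ∧ x.1 < x.2.1 ∧ x.2.1 < x.2.2 := by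
  induction l with
  | nil => exact absurd h List.not_mem_nil
  | cons a l ih =>
    rw [List.pairwise_cons] at hl
    rcases List.mem_append.1 h with h | h
    · obtain ⟨b, hb, rfl⟩ := List.mem_map.1 h
      obtain ⟨h1, h2, h3⟩ := mem_of_mem_pairs hl.2 hb
      exact ⟨by simp, by simp [h1], by simp [h2], hl.1 _ h1, h3⟩
    · obtain ⟨h1, h2, h3, h4⟩ := ih hl.2 h
      exact ⟨by simp [h1], by simp [h2], by simp [h3], h4⟩

theorem mem_of_mem_quadruples {l : List ℕ} (hl : l.Pairwise (· < ·)) {x : ℕ × ℕ × ℕ × ℕ}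
    (h : x ∈ quadruples l) : x.1 ∈ l ∧ x.2.1 ∈ l ∧ x.2.2.1 ∈ l ∧ x.2.2.2 ∈ l ∧
      x.1 < x.2.1 ∧ x.2.1 < x.2.2.1 ∧ x.2.2.1 < x.2.2.2 := by
  induction l with
  | nil => exact absurd h List.not_mem_nil
  | cons a l ih =>
    rw [List.pairwise_cons] at hl
    rcases List.mem_append.1 h with h | h
    · obtain ⟨b, hb, rfl⟩ := List.mem_map.1 h
      obtain ⟨h1, h2, h3, h4, h5⟩ := mem_of_mem_triples hl.2 hb
      exact ⟨by simp, by simp [h1], by simp [h2], by simp [h3], hl.1 _ h1, h4, h5⟩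
    · obtain ⟨h1, h2, h3, h4, h5⟩ := ih hl.2 h
      exact ⟨by simp [h1], by simp [h2], by simp [h3], by simp [h4], h5⟩

/-- The properties of plane triangulations of a gadget that the search uses. -/
structure IsDrawn (t : TileType) (z : Vtx → ℝ × ℝ) (T : SimpleGraph Vtx) : Prop where
  mem_vertices : ∀ a b, T.Adj a b → a ∈ t.vertices
  nonCrossing : NonCrossing z T
  boundary : ∀ e ∈ boundaryEdges, T.Adj e.1 e.2
  unblocked : ∀ e ∈ blocked, ¬ T.Adj (vtx e.1) (vtx e.2)

variable {T : SimpleGraph Vtx}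

theorem IsDrawn.consistent (hz : IsFrameCell t.vertices z) (hT : IsDrawn t z T) :
    Consistent (Describes z T) (initTrue t.members)
      (join (initFalse t.members) (foreign t.members)) := by
  have tri : ∀ s i, i ∈ ((triples t.members).filter fun x =>
      orientation x.1 x.2.1 x.2.2 == some s).map (fun x => triple x.1 x.2.1 x.2.2) →
      (Describes z T i ↔ s = true) := by
    intro s i hi
    obtain ⟨x, hx, rfl⟩ := List.mem_map.1 hi
    obtain ⟨hx, ho⟩ := List.mem_filter.1 hx
    obtain ⟨h1, h2, h3, h4, h5⟩ := mem_of_mem_triples t.members_sorted hx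
    rw [describes_triple (TileType.mem_members.1 h1).1 (TileType.mem_members.1 h2).1]
    exact hz.orientation_sound h1 h2 h3 h4 h5 (by simpa using ho)
  refine ⟨fun i hi => ?_, fun i hi => ?_⟩
  · rcases List.mem_append.1 (mem_bits_maskOf.1 hi) with h | h
    · obtain ⟨x, hx, rfl⟩ := List.mem_map.1 h
      obtain ⟨e, he, rfl⟩ := List.mem_map.1 hx
      rw [describes_code_idx]
      exact hT.boundary e he
    · exact (tri _ _ h).2 rfl
  · rcases mem_bits_join.1 hi with hi | hi
    · rcases List.mem_append.1 (mem_bits_maskOf.1 hi) with h | h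
      · obtain ⟨x, hx, rfl⟩ := List.mem_map.1 h
        have := (by decide : ∀ e ∈ blocked, e.1 < 18 ∧ e.2 < 18) x hx
        rw [describes_code this.1 this.2]
        exact hT.unblocked x hx
      · exact fun hc => Bool.false_ne_true ((tri _ _ h).1 hc)
    · obtain ⟨x, hx, rfl⟩ := List.mem_map.1 (mem_bits_maskOf.1 hi)
      obtain ⟨hx, hV⟩ := List.mem_filter.1 hx
      obtain ⟨h1, h2, -⟩ := mem_of_mem_pairs List.pairwise_lt_range hx
      rw [List.mem_range] at h1 h2
      rw [describes_code h1 h2]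
      intro h
      have m1 := TileType.mem_members.2 ⟨h1, hT.mem_vertices _ _ h⟩
      have m2 := TileType.mem_members.2 ⟨h2, hT.mem_vertices _ _ h.symm⟩
      simp [m1, m2] at hV

theorem vtx_ne {i j : ℕ} (hi : i < 18) (hj : j < 18) (h : i ≠ j) : vtx i ≠ vtx j := fun e => by
  rw [← idx_vtx i hi, ← idx_vtx j hj, e] at h
  exact h rfl

theorem NonCrossing.not_interleaved (hT : NonCrossing z T) (hz : IsFrameCell t.vertices z)
    {i j k l : ℕ} (hi : i ∈ t.members) (hj : j ∈ t.members) (hk : k ∈ t.members)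
    (hl : l ∈ t.members) (hij : i < j) (hjk : j < k) (hkl : k < l) (h1 : T.Adj (vtx i) (vtx k))
    (h2 : T.Adj (vtx j) (vtx l)) : ¬ 0 < turn z i j k * turn z j k l := by
  intro h
  refine not_disjoint_of_interleaved (hz.fst_lt hi hj hij) (hz.fst_lt hj hk hjk)
    (hz.fst_lt hk hl hkl) h (hT _ _ _ _ h1 h2 ?_)
  rw [TileType.mem_members] at hi hj hk hl
  rw [Ne, Sym2.eq_iff, not_or, not_and_or, not_and_or]
  exact ⟨.inl (vtx_ne hi.1 hj.1 (by omega)), .inl (vtx_ne hi.1 hl.1 (by omega))⟩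

theorem NonCrossing.not_nested (hT : NonCrossing z T) (hz : IsFrameCell t.vertices z)
    {i j k l : ℕ} (hi : i ∈ t.members) (hj : j ∈ t.members) (hk : k ∈ t.members)
    (hl : l ∈ t.members) (hij : i < j) (hjk : j < k) (hkl : k < l) (h1 : T.Adj (vtx i) (vtx l))
    (h2 : T.Adj (vtx j) (vtx k)) : ¬ turn z i j l * turn z i k l < 0 := by
  intro h
  refine not_disjoint_of_nested (hz.fst_lt hi hj hij) (hz.fst_lt hj hk hjk)
    (hz.fst_lt hk hl hkl) h (hT _ _ _ _ h1 h2 ?_)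
  rw [TileType.mem_members] at hi hj hk hl
  rw [Ne, Sym2.eq_iff, not_or, not_and_or, not_and_or]
  exact ⟨.inl (vtx_ne hi.1 hj.1 (by omega)), .inl (vtx_ne hi.1 hk.1 (by omega))⟩

/-! ### Chords of the boundary cycle -/

/-- The known orientations show that the edges `x` and `y` cross, where the leftmost end is an end
of `x`. -/
def crossesFirst (x y : ℕ × ℕ) : Bool :=
  Nat.blt x.1 y.1 && Nat.blt y.1 x.2 && (orientation x.1 y.1 x.2).isSome &&
    ((Nat.blt x.2 y.2 && orientation x.1 y.1 x.2 == orientation y.1 x.2 y.2) ||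
      (Nat.blt y.1 y.2 && Nat.blt y.2 x.2 &&
        orientation x.1 y.2 x.2 == (orientation x.1 y.1 x.2).map not))

def excludes (x y : ℕ × ℕ) : Bool :=
  blocked.elem x || blocked.elem y || crossesFirst x y || crossesFirst y x

theorem mul_pos_of_pos_iff_pos {x y : ℝ} (hx : x ≠ 0) (hy : y ≠ 0) (h : 0 < x ↔ 0 < y) :
    0 < x * y := by
  rcases hx.lt_or_gt with h1 | h1
  · exact mul_pos_of_neg_of_neg h1 (lt_of_le_of_ne (not_lt.1 (mt h.2 h1.not_gt)) hy)
  · exact mul_pos h1 (h.1 h1)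

theorem mul_neg_of_pos_iff_not_pos {x y : ℝ} (hx : x ≠ 0) (hy : y ≠ 0) (h : 0 < x ↔ ¬ 0 < y) :
    x * y < 0 := by
  rcases hx.lt_or_gt with h1 | h1
  · exact mul_neg_of_neg_of_pos h1 (not_not.1 (mt h.2 h1.not_gt))
  · exact mul_neg_of_pos_of_neg h1 (lt_of_le_of_ne (not_lt.1 (h.1 h1)) hy)

theorem IsDrawn.not_crossesFirst (hz : IsFrameCell t.vertices z) (hT : IsDrawn t z T)
    {x y : ℕ × ℕ} (hx : T.Adj (vtx x.1) (vtx x.2)) (hy : T.Adj (vtx y.1) (vtx y.2))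
    (hx1 : x.1 ∈ t.members) (hx2 : x.2 ∈ t.members) (hy1 : y.1 ∈ t.members)
    (hy2 : y.2 ∈ t.members) : crossesFirst x y = false := by
  by_contra hc
  simp only [crossesFirst, Bool.not_eq_false, Bool.and_eq_true, Bool.or_eq_true, Nat.blt_eq,
    beq_iff_eq, Option.isSome_iff_exists] at hc
  obtain ⟨⟨⟨h1, h2⟩, s, h3⟩, ⟨h4, h5⟩ | ⟨⟨h4, h5⟩, h6⟩⟩ := hc
  · rw [h3] at h5
    refine hT.nonCrossing.not_interleaved hz hx1 hy1 hx2 hy2 h1 h2 h4 hx hy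
      (mul_pos_of_pos_iff_pos (hz.turn_ne_zero hx1 hy1 hx2 h1 h2)
        (hz.turn_ne_zero hy1 hx2 hy2 h2 h4) ?_)
    rw [hz.orientation_sound hx1 hy1 hx2 h1 h2 h3, hz.orientation_sound hy1 hx2 hy2 h2 h4 h5.symm]
  · rw [h3] at h6
    refine hT.nonCrossing.not_nested hz hx1 hy1 hy2 hx2 h1 h4 h5 hx hy
      (mul_neg_of_pos_iff_not_pos (hz.turn_ne_zero hx1 hy1 hx2 h1 h2)
        (hz.turn_ne_zero hx1 hy2 hx2 (h1.trans h4) h5) ?_)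
    rw [hz.orientation_sound hx1 hy1 hx2 h1 h2 h3,
      hz.orientation_sound hx1 hy2 hx2 (h1.trans h4) h5 h6]
    cases s <;> decide

/-- The chords of the boundary cycle, including its edges. -/
def chords : List (ℕ × ℕ) := pairs [0, 1, 2, 3, 4, 6, 7, 8, 9, 10, 11, 12, 14, 15, 16, 17]

noncomputable def isExclusion : Rule → Bool
  | .excl e m =>
    (fun u => Nat.beq (body (diff e u)) 0 && Nat.beq (body (diff m u)) 0)
      (maskOf (chords.map fun x => code x.1 x.2)) &&
    chords.all fun x => !(body e).testBit (code x.1 x.2) ||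
      chords.all fun y => !(body m).testBit (code y.1 y.2) || excludes x y
  | _ => false

-- The exclusions were read off the cyclic order. Instead of a general argument that interleaving
-- chords cross, each pair is confirmed by the known orientations, unless one of the chords is
-- blocked.
set_option maxRecDepth 1000000 in
theorem all_isExclusion : exclRules.all isExclusion = true := by decide +kernel

theorem IsDrawn.exclRules_hold (hz : IsFrameCell t.vertices z) (hT : IsDrawn t z T) :
    ∀ r ∈ exclRules, r.Holds (Describes z T) := by
  intro r hr
  have h := List.all_eq_true.1 all_isExclusion r hr
  cases r with
  | clause p n => exact absurd h Bool.false_ne_true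
  | count m k => exact absurd h Bool.false_ne_true
  | excl e m =>
    simp only [isExclusion, Bool.and_eq_true, Nat.beq_eq, List.all_eq_true, Bool.or_eq_true,
      Bool.not_eq_true', body_eq_zero] at h
    have sub : ∀ {a}, bits (diff a (maskOf (chords.map fun x => code x.1 x.2))) = ∅ →
        ∀ i ∈ bits a, ∃ x ∈ chords, code x.1 x.2 = i := fun {a} ha i hi => by
      by_contra hc
      refine Set.eq_empty_iff_forall_notMem.1 ha i (mem_bits_diff.2 ⟨hi, fun h' => hc ?_⟩)
      exact List.mem_map.1 (mem_bits_maskOf.1 h')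
    have mem : ∀ x ∈ chords, x.1 ∈ t.members ∧ x.2 ∈ t.members := fun x hx => by
      have := (by decide +kernel : ∀ x ∈ chords, (x.1 < 18 ∧ isInner x.1 = false) ∧
        (x.2 < 18 ∧ isInner x.2 = false)) x hx
      exact ⟨TileType.mem_members_of_outer this.1.1 this.1.2,
        TileType.mem_members_of_outer this.2.1 this.2.2⟩
    rintro ⟨i, hi, hαi⟩ j hj hαj
    obtain ⟨x, hx, rfl⟩ := sub h.1.1 i hi
    obtain ⟨y, hy, rfl⟩ := sub h.1.2 j hj
    obtain ⟨x1, x2⟩ := mem x hx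
    obtain ⟨y1, y2⟩ := mem y hy
    rw [describes_code (TileType.mem_members.1 x1).1 (TileType.mem_members.1 x2).1] at hαi
    rw [describes_code (TileType.mem_members.1 y1).1 (TileType.mem_members.1 y2).1] at hαj
    have := (((h.2 x hx).resolve_left (by rw [mem_bits] at hi; simp [hi])) y hy).resolve_left
      (by rw [mem_bits] at hj; simp [hj])
    simp only [excludes, Bool.or_eq_true, List.elem_eq_mem, decide_eq_true_eq] at this
    rcases this with ((h | h) | h) | h
    · exact hT.unblocked x h hαi
    · exact hT.unblocked y h hαj
    · rw [hT.not_crossesFirst hz hαi hαj x1 x2 y1 y2] at h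
      exact Bool.false_ne_true h
    · rw [hT.not_crossesFirst hz hαj hαi y1 y2 x1 x2] at h
      exact Bool.false_ne_true h

/-! ### Clauses -/

def Satisfies (α : ℕ → Prop) (l : List (ℕ × Bool)) : Prop := ∃ x ∈ l, (α x.1 ↔ x.2 = true)

theorem Satisfies.holds {α : ℕ → Prop} {l : List (ℕ × Bool)} (h : Satisfies α l) :
    (clauseOf l).Holds α := by
  rw [clauseOf, force_eq, force_eq]
  obtain ⟨⟨i, s⟩, hi, hs⟩ := h
  cases s with
  | true =>
    exact .inl ⟨i, mem_bits_maskOf.2 (List.mem_map.2 ⟨_, List.mem_filter.2 ⟨hi, rfl⟩, rfl⟩),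
      hs.2 rfl⟩
  | false =>
    exact .inr ⟨i, mem_bits_maskOf.2 (List.mem_map.2 ⟨_, List.mem_filter.2 ⟨hi, rfl⟩, rfl⟩),
      fun h => Bool.false_ne_true (hs.1 h)⟩

theorem Between.satisfies {α : ℕ → Prop} {x y w : ℝ} {a b c : ℕ} (h : Between x y w)
    (hx : x ≠ 0) (hw : w ≠ 0) (ha : α a ↔ 0 < x) (hb : α b ↔ 0 < y) (hc : α c ↔ 0 < w)
    (s : Bool) : Satisfies α (signotope a b c s) := by
  by_contra hn
  simp only [Satisfies, signotope, List.mem_cons, List.not_mem_nil, or_false, exists_eq_or_imp,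
    exists_eq_left, not_or, ha, hb, hc] at hn
  obtain ⟨h1, h2, h3⟩ := hn
  cases s with
  | true =>
    have hx' : x < 0 := lt_of_le_of_ne (by simpa using h1) hx
    have hw' : w < 0 := lt_of_le_of_ne (by simpa using h3) hw
    have := h.neg hx' hw'
    simp at h2
    linarith
  | false =>
    have := h.pos (by simpa using h1) (by simpa using h3)
    simp at h2
    linarith

theorem iff_of_not_iff {p q r : Prop} (hp : ¬ (p ↔ r)) (hq : ¬ (q ↔ r)) : p ↔ q := by
  tauto

theorem iff_not_of_not_iff {p q : Prop} {s : Bool} (hp : ¬ (p ↔ s = true))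
    (hq : ¬ (q ↔ (!s) = true)) : p ↔ ¬ q := by
  cases s <;> simp at hp hq <;> tauto

/-- A violated crossing clause exhibits two crossing edges, and a violated sign clause contradicts
one of the four betweenness relations. -/
theorem IsDrawn.clauseRules_hold (hz : IsFrameCell t.vertices z) (hT : IsDrawn t z T) :
    ∀ r ∈ clauseRules t.members, r.Holds (Describes z T) := by
  intro r hr
  obtain ⟨c, hc, rfl⟩ := List.mem_map.1 hr
  obtain ⟨⟨i, j, k, l⟩, hx, hc⟩ := List.mem_flatMap.1 hc
  obtain ⟨hi, hj, hk, hl, hij, hjk, hkl⟩ := mem_of_mem_quadruples (t.members_sorted.filter _) hx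
  simp only at hi hj hk hl hij hjk hkl
  replace hi := List.mem_of_mem_filter hi
  replace hj := List.mem_of_mem_filter hj
  replace hk := List.mem_of_mem_filter hk
  replace hl := List.mem_of_mem_filter hl
  have hi' := (TileType.mem_members.1 hi).1
  have hj' := (TileType.mem_members.1 hj).1
  have hk' := (TileType.mem_members.1 hk).1
  have hl' := (TileType.mem_members.1 hl).1
  have n1 := hz.turn_ne_zero hi hj hk hij hjk
  have n2 := hz.turn_ne_zero hi hj hl hij (hjk.trans hkl)
  have n3 := hz.turn_ne_zero hi hk hl (hij.trans hjk) hkl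
  have n4 := hz.turn_ne_zero hj hk hl hjk hkl
  have d1 := describes_triple (z := z) (T := T) (k := k) hi' hj'
  have d2 := describes_triple (z := z) (T := T) (k := l) hi' hj'
  have d3 := describes_triple (z := z) (T := T) (k := l) hi' hk'
  have d4 := describes_triple (z := z) (T := T) (k := l) hj' hk'
  have x1 := hz.fst_lt hi hj hij
  have x2 := hz.fst_lt hj hk hjk
  have x3 := hz.fst_lt hk hl hkl
  apply Satisfies.holds
  have cross : ∀ s, c ∈ crossClauses i j k l s → Satisfies (Describes z T) c := by
    intro s hs
    by_contra hn
    rcases List.mem_cons.1 hs with rfl | hs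
    · simp only [Satisfies, List.mem_cons, List.not_mem_nil, or_false, exists_eq_or_imp,
        exists_eq_left, not_or, d1, d4, describes_code hi' hk', describes_code hj' hl'] at hn
      obtain ⟨h1, h2, h3, h4⟩ := hn
      refine hT.nonCrossing.not_interleaved hz hi hj hk hl hij hjk hkl (by simpa using h1)
        (by simpa using h2) (mul_pos_of_pos_iff_pos n1 n4 ?_)
      exact iff_of_not_iff h3 h4
    · obtain rfl := List.mem_singleton.1 hs
      simp only [Satisfies, List.mem_cons, List.not_mem_nil, or_false, exists_eq_or_imp,
        exists_eq_left, not_or, d2, d3, describes_code hi' hl', describes_code hj' hk'] at hn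
      obtain ⟨h1, h2, h3, h4⟩ := hn
      refine hT.nonCrossing.not_nested hz hi hj hk hl hij hjk hkl (by simpa using h1)
        (by simpa using h2) (mul_neg_of_pos_iff_not_pos n2 n3 ?_)
      exact iff_not_of_not_iff h3 h4
  have sign : ∀ s, c ∈ signClauses i j k l s → Satisfies (Describes z T) c := by
    intro s hs
    simp only [signClauses, List.mem_cons, List.not_mem_nil, or_false] at hs
    rcases hs with rfl | rfl | rfl | rfl
    · exact (between_fix_first x1 x2 x3).satisfies n1 n3 d1 d2 d3 s
    · exact (between_fix_second x1 x2 x3).satisfies n1 n4 d1 d2 d4 s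
    · exact (between_fix_third x1 x2 x3).satisfies n1 n4 d1 d3 d4 s
    · exact (between_fix_fourth x1 x2 x3).satisfies n2 n4 d2 d3 d4 s
  simp only [quadClauses, Bool.cond_eq_ite] at hc
  split_ifs at hc with h1 h2
  · exact absurd hc List.not_mem_nil
  · rcases List.mem_append.1 hc with hc | hc
    · exact (List.mem_append.1 hc).elim (cross true) (cross false)
    · exact (List.mem_append.1 hc).elim (sign true) (sign false)
  · rw [List.append_nil] at hc
    exact (List.mem_append.1 hc).elim (cross true) (cross false)


/-! ### The region of a frame cell -/

theorem orient_sub_orient {a b x y : ℝ × ℝ} (h : x.1 = y.1) :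
    orient a b x - orient a b y = (b.1 - a.1) * (x.2 - y.2) := by
  unfold orient
  rw [h]
  ring

theorem mem_segment_coords {a b s : ℝ × ℝ} (h : s ∈ segment ℝ a b) :
    ∃ r : ℝ, 0 ≤ r ∧ r ≤ 1 ∧ s.1 = a.1 + r * (b.1 - a.1) ∧ s.2 = a.2 + r * (b.2 - a.2) := by
  obtain ⟨u, v, hu, hv, huv, rfl⟩ := h
  refine ⟨v, hv, by linarith, ?_, ?_⟩
  · change u * a.1 + v * b.1 = _
    rw [← eq_sub_iff_add_eq] at huv
    rw [huv]
    ring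
  · change u * a.2 + v * b.2 = _
    rw [← eq_sub_iff_add_eq] at huv
    rw [huv]
    ring

theorem orient_of_mem_segment {a b s : ℝ × ℝ} (h : s ∈ segment ℝ a b) : orient a b s = 0 := by
  obtain ⟨r, -, -, h1, h2⟩ := mem_segment_coords h
  unfold orient
  rw [h1, h2]
  ring

theorem fst_of_mem_segment {a b s : ℝ × ℝ} (hab : a.1 ≤ b.1) (h : s ∈ segment ℝ a b) :
    a.1 ≤ s.1 ∧ s.1 ≤ b.1 := by
  obtain ⟨r, h0, h1, h2, -⟩ := mem_segment_coords h
  constructor <;> nlinarith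

theorem exists_mem_segment {a b : ℝ × ℝ} (hab : a.1 < b.1) {r : ℝ} (ha : a.1 ≤ r) (hb : r ≤ b.1) :
    ∃ s ∈ segment ℝ a b, s.1 = r := by
  have h := sub_pos.2 hab
  refine ⟨_, ⟨1 - (r - a.1) / (b.1 - a.1), (r - a.1) / (b.1 - a.1), ?_, ?_, by ring, rfl⟩, ?_⟩
  · rw [sub_nonneg, div_le_one h]
    linarith
  · exact div_nonneg (by linarith) h.le
  · change (1 - (r - a.1) / (b.1 - a.1)) * a.1 + (r - a.1) / (b.1 - a.1) * b.1 = r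
    field_simp
    ring

theorem mem_segment_of_orient {a b x : ℝ × ℝ} (hab : a.1 < b.1) (h1 : a.1 ≤ x.1) (h2 : x.1 ≤ b.1)
    (h : orient a b x = 0) : x ∈ segment ℝ a b := by
  obtain ⟨s, hs, e⟩ := exists_mem_segment hab h1 h2
  have := orient_sub_orient (a := a) (b := b) e
  rw [h, orient_of_mem_segment hs, sub_zero, eq_comm, mul_eq_zero] at this
  have e' := this.resolve_left (sub_pos.2 hab).ne'
  rwa [show x = s from Prod.ext e.symm (by linarith)]

def SpannedBy (z : Vtx → ℝ × ℝ) (e : ℕ × ℕ) (x : ℝ × ℝ) : Prop :=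
  (z (vtx e.1)).1 ≤ x.1 ∧ x.1 ≤ (z (vtx e.2)).1

/-- By `orient_sub_orient`, this is the vertical distance from the line of the edge, with sign,
times the width of the edge. -/
noncomputable def height (z : Vtx → ℝ × ℝ) (e : ℕ × ℕ) (x : ℝ × ℝ) : ℝ :=
  orient (z (vtx e.1)) (z (vtx e.2)) x

def Above (z : Vtx → ℝ × ℝ) (l : List (ℕ × ℕ)) (x : ℝ × ℝ) : Prop :=
  ∃ e ∈ l, SpannedBy z e x ∧ 0 ≤ height z e x

def Below (z : Vtx → ℝ × ℝ) (l : List (ℕ × ℕ)) (x : ℝ × ℝ) : Prop :=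
  ∃ e ∈ l, SpannedBy z e x ∧ height z e x ≤ 0

def lowerPairs : List (ℕ × ℕ) := pairsOf lowerEdges

def upperPairs : List (ℕ × ℕ) := pairsOf upperEdges

theorem exists_polyline_iff {l : List (Vtx × Vtx)} {r : ℝ → Prop} {x : ℝ × ℝ} :
    (∃ s ∈ polyline z l, s.1 = x.1 ∧ r s.2) ↔
      ∃ e ∈ pairsOf l, ∃ s ∈ segment ℝ (z (vtx e.1)) (z (vtx e.2)), s.1 = x.1 ∧ r s.2 := by
  constructor
  · rintro ⟨s, ⟨e, he, hs⟩, h⟩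
    exact ⟨_, List.mem_map.2 ⟨e, he, rfl⟩, s, by rwa [vtx_idx, vtx_idx], h⟩
  · rintro ⟨e, he, s, hs, h⟩
    exact ⟨s, ⟨_, exists_of_mem_pairsOf he, hs⟩, h⟩

theorem exists_segment_le_iff {e : ℕ × ℕ} (he : (z (vtx e.1)).1 < (z (vtx e.2)).1) {x : ℝ × ℝ} :
    (∃ s ∈ segment ℝ (z (vtx e.1)) (z (vtx e.2)), s.1 = x.1 ∧ s.2 ≤ x.2) ↔
      SpannedBy z e x ∧ 0 ≤ height z e x := by
  constructor
  · rintro ⟨s, hs, h1, h2⟩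
    have := orient_sub_orient (a := z (vtx e.1)) (b := z (vtx e.2)) h1.symm
    rw [orient_of_mem_segment hs, sub_zero] at this
    rw [SpannedBy, ← h1, height, this]
    exact ⟨fst_of_mem_segment he.le hs, mul_nonneg (by linarith) (by linarith)⟩
  · rintro ⟨⟨h1, h2⟩, h3⟩
    obtain ⟨s, hs, h⟩ := exists_mem_segment he h1 h2
    have := orient_sub_orient (a := z (vtx e.1)) (b := z (vtx e.2)) h.symm
    rw [orient_of_mem_segment hs, sub_zero] at this
    rw [height, this] at h3
    exact ⟨s, hs, h, by nlinarith⟩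

theorem exists_segment_ge_iff {e : ℕ × ℕ} (he : (z (vtx e.1)).1 < (z (vtx e.2)).1) {x : ℝ × ℝ} :
    (∃ s ∈ segment ℝ (z (vtx e.1)) (z (vtx e.2)), s.1 = x.1 ∧ x.2 ≤ s.2) ↔
      SpannedBy z e x ∧ height z e x ≤ 0 := by
  constructor
  · rintro ⟨s, hs, h1, h2⟩
    have := orient_sub_orient (a := z (vtx e.1)) (b := z (vtx e.2)) h1.symm
    rw [orient_of_mem_segment hs, sub_zero] at this
    rw [SpannedBy, ← h1, height, this]
    exact ⟨fst_of_mem_segment he.le hs,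
      mul_nonpos_of_nonneg_of_nonpos (by linarith) (by linarith)⟩
  · rintro ⟨⟨h1, h2⟩, h3⟩
    obtain ⟨s, hs, h⟩ := exists_mem_segment he h1 h2
    have := orient_sub_orient (a := z (vtx e.1)) (b := z (vtx e.2)) h.symm
    rw [orient_of_mem_segment hs, sub_zero] at this
    rw [height, this] at h3
    exact ⟨s, hs, h, by nlinarith⟩

theorem mem_members_of_mem_boundary {e : ℕ × ℕ} (he : e ∈ lowerPairs ++ upperPairs) :
    e.1 ∈ t.members ∧ e.2 ∈ t.members ∧ e.1 < e.2 := by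
  have := (by decide +kernel : ∀ e ∈ lowerPairs ++ upperPairs,
    (e.1 < 18 ∧ isInner e.1 = false) ∧ (e.2 < 18 ∧ isInner e.2 = false) ∧ e.1 < e.2) e he
  exact ⟨TileType.mem_members_of_outer this.1.1 this.1.2,
    TileType.mem_members_of_outer this.2.1.1 this.2.1.2, this.2.2⟩

/-- Replaces points on the boundary paths by sign conditions on the edges over x, which are affine
in x. -/
theorem IsFrameCell.mem_region (hz : IsFrameCell t.vertices z) {x : ℝ × ℝ} :
    x ∈ region z ↔ Above z lowerPairs x ∧ Below z upperPairs x := by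
  have e : x ∈ region z ↔ (∃ s ∈ polyline z lowerEdges, s.1 = x.1 ∧ s.2 ≤ x.2) ∧
      ∃ u ∈ polyline z upperEdges, u.1 = x.1 ∧ x.2 ≤ u.2 :=
    ⟨fun ⟨s, hs, u, hu, h1, h2, h3, h4⟩ => ⟨⟨s, hs, h1, h3⟩, ⟨u, hu, h2, h4⟩⟩,
      fun ⟨⟨s, hs, h1, h3⟩, ⟨u, hu, h2, h4⟩⟩ => ⟨s, hs, u, hu, h1, h2, h3, h4⟩⟩
  rw [e, exists_polyline_iff (r := (· ≤ x.2)), exists_polyline_iff (r := (x.2 ≤ ·))]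
  refine and_congr (exists_congr fun e => and_congr_right fun he => ?_)
    (exists_congr fun e => and_congr_right fun he => ?_)
  · obtain ⟨h1, h2, h3⟩ := mem_members_of_mem_boundary (t := t)
      (List.mem_append_left upperPairs he)
    exact exists_segment_le_iff (hz.fst_lt h1 h2 h3)
  · obtain ⟨h1, h2, h3⟩ := mem_members_of_mem_boundary (t := t)
      (List.mem_append_right lowerPairs he)
    exact exists_segment_ge_iff (hz.fst_lt h1 h2 h3)

/-- Some vertex `m` of the same chain lies strictly above the chord. The lower boundary passes
through `m`, so the point of the chord vertically below `m` is outside the region. -/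
theorem IsTriangulation.unblocked (hz : IsFrameCell t.vertices z)
    (hT : IsTriangulation t.vertices z T) : ∀ e ∈ blocked, ¬ T.Adj (vtx e.1) (vtx e.2) := by
  intro e he hadj
  obtain ⟨m, hm, hl, ho⟩ := (by decide +kernel : ∀ e ∈ blocked,
    ∃ m < 18, (e.1 < 18 ∧ e.2 < 18 ∧ e.1 < m ∧ m < e.2 ∧ isInner e.1 = false ∧ isInner m = false ∧
      isInner e.2 = false ∧ ∀ a ∈ lowerPairs, a.1 ≤ m → m ≤ a.2 → m = a.1 ∨ m = a.2) ∧
      orientation e.1 m e.2 = some false) e he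
  obtain ⟨h1, h2, h3, h4, i1, i2, i3, hl⟩ := hl
  have m1 : e.1 ∈ t.members := TileType.mem_members_of_outer h1 i1
  have m2 : m ∈ t.members := TileType.mem_members_of_outer hm i2
  have m3 : e.2 ∈ t.members := TileType.mem_members_of_outer h2 i3
  have x1 := hz.fst_lt m1 m2 h3
  have x2 := hz.fst_lt m2 m3 h4
  obtain ⟨x, hx, ex⟩ := exists_mem_segment (x1.trans x2) x1.le x2.le
  obtain ⟨a, ha, ⟨s1, s2⟩, ht⟩ := (hz.mem_region.1 (hT.inside _ _ hadj hx)).1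
  obtain ⟨a1, a2, a3⟩ := mem_members_of_mem_boundary (t := t) (List.mem_append_left upperPairs ha)
  rw [ex] at s1 s2
  have e1 := orient_sub_orient (a := z (vtx a.1)) (b := z (vtx a.2)) ex
  have e2 := orient_sub_orient (a := z (vtx e.1)) (b := z (vtx e.2)) ex
  have e3 : orient (z (vtx a.1)) (z (vtx a.2)) (z (vtx m)) = 0 := by
    rcases hl a ha (not_lt.1 (mt (hz.fst_lt_iff m2 a1).2 s1.not_gt))
      (not_lt.1 (mt (hz.fst_lt_iff a2 m2).2 s2.not_gt)) with rfl | rfl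
    · exact orient_self_left _ _
    · exact orient_self_right _ _
  have h5 : turn z e.1 m e.2 < 0 := lt_of_le_of_ne
    (not_lt.1 (mt (hz.orientation_sound m1 m2 m3 h3 h4 ho).1 Bool.false_ne_true))
    (hz.turn_ne_zero m1 m2 m3 h3 h4)
  rw [turn, orient_swap] at h5
  rw [orient_of_mem_segment hx] at e2
  rw [e3] at e1
  rw [height] at ht
  have h6 := hz.fst_lt a1 a2 a3
  nlinarith

theorem IsTriangulation.isDrawn (hz : IsFrameCell t.vertices z)
    (hT : IsTriangulation t.vertices z T) : IsDrawn t z T :=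
  ⟨hT.mem_vertices, hT.nonCrossing, hT.boundary, hT.unblocked hz⟩

/-! ### Degrees -/

theorem TileType.U_adj {χ : LocalColoring} {a b : Vtx} :
    (t.U χ).Adj a b ↔ a ≠ b ∧ ((a, b) ∈ t.edges χ ∨ (b, a) ∈ t.edges χ) := by
  rw [TileType.U, SimpleGraph.fromRel_adj]
  rfl

theorem TileType.code_mem_mask {χ : LocalColoring} {a b : Vtx} (hab : a ≠ b) :
    code (idx a) (idx b) ∈ bits (t.mask χ) ↔ (t.U χ).Adj a b := by
  rw [TileType.U_adj, and_iff_right hab, TileType.mask, mem_bits_maskOf, List.mem_map]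
  constructor
  · rintro ⟨⟨c, d⟩, h, e⟩
    rcases code_injective (idx_lt _) (idx_lt _) (idx_lt _) (idx_lt _) e with ⟨h1, h2⟩ | ⟨h1, h2⟩
    · rw [← idx_injective h1, ← idx_injective h2]
      exact .inl h
    · rw [← idx_injective h1, ← idx_injective h2]
      exact .inr h
  · rintro (h | h)
    · exact ⟨_, h, rfl⟩
    · exact ⟨_, h, code_comm _ _⟩

theorem mem_bits_seenMask {V : List ℕ} {D : Direction} {i c : ℕ} :
    c ∈ bits (seenMask V D i) ↔ ∃ j ∈ V, seen D i j = true ∧ code i j = c := by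
  rw [seenMask, mem_bits_maskOf, List.mem_map]
  simp only [List.mem_filter, and_assoc]

theorem IsFrameCell.sees_iff (hz : IsFrameCell t.vertices z) {u v : Vtx} (hu : u ∈ t.vertices)
    (hv : v ∈ t.vertices) (D : Direction) :
    D.Sees (z u) (z v) ↔ seen D (idx u) (idx v) = true := by
  rw [← TileType.idx_mem] at hu hv
  have x1 := hz.fst_lt_iff hu hv
  have x2 := hz.fst_lt_iff hv hu
  have y1 := hz.snd_lt_iff hu hv
  have y2 := hz.snd_lt_iff hv hu
  rw [vtx_idx, vtx_idx] at x1 x2 y1 y2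
  cases D
  · exact y1.trans (Iff.of_eq Nat.blt_eq.symm)
  · exact y2.trans (Iff.of_eq Nat.blt_eq.symm)
  · exact x1.trans (Iff.of_eq Nat.blt_eq.symm)
  · exact x2.trans (Iff.of_eq Nat.blt_eq.symm)

/-- The neighbors in a direction correspond to their edges at `v`, and the set of candidates is the
same in all frame cells. -/
theorem IsFrameCell.cardinalDegree_eq (hz : IsFrameCell t.vertices z)
    (hT : ∀ a b, T.Adj a b → a ∈ t.vertices) (D : Direction) {v : Vtx} (hv : v ∈ t.vertices) :
    cardinalDegree z T D v =
      {c | c ∈ bits (seenMask t.members D (idx v)) ∧ Describes z T c}.ncard := by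
  have e : {c | c ∈ bits (seenMask t.members D (idx v)) ∧ Describes z T c} =
      (fun u => code (idx v) (idx u)) '' {u | T.Adj v u ∧ D.Sees (z v) (z u)} := by
    ext c
    simp only [Set.mem_ofPred_eq, mem_bits_seenMask, Set.mem_image]
    constructor
    · rintro ⟨⟨j, hj, hs, rfl⟩, h⟩
      have hj' := TileType.mem_members.1 hj
      rw [describes_code (idx_lt v) hj'.1, vtx_idx] at h
      refine ⟨vtx j, ⟨h, (hz.sees_iff hv hj'.2 D).2 ?_⟩, ?_⟩
      · rwa [idx_vtx j hj'.1]
      · rw [idx_vtx j hj'.1]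
    · rintro ⟨u, ⟨h, hs⟩, rfl⟩
      have hu := hT _ _ h.symm
      exact ⟨⟨idx u, TileType.idx_mem.2 hu, (hz.sees_iff hv hu D).1 hs, rfl⟩,
        (describes_code_idx v u).2 h⟩
  rw [e, Set.InjOn.ncard_image]
  · rfl
  · rintro u - w - h
    rcases code_injective (idx_lt _) (idx_lt _) (idx_lt _) (idx_lt _) h with ⟨-, h⟩ | ⟨h1, h2⟩
    · exact idx_injective h
    · exact idx_injective (h2.trans h1)

theorem mem_colorings (χ : LocalColoring) : χ ∈ colorings := by
  have e : χ = mkColoring (χ .red) (χ .blue) := by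
    funext h
    cases h <;> rfl
  rw [e]
  cases χ .red <;> cases χ .blue <;> simp [colorings]

theorem TileType.edges_inner : ∀ t : TileType, ∀ χ ∈ colorings, ((t.edges χ).all fun e =>
    (!isInner (idx e.1) || decide (e.1 ∈ t.interior)) &&
      (!isInner (idx e.2) || decide (e.2 ∈ t.interior))) = true := by
  decide +kernel

theorem TileType.mem_members_of_mem_edges {χ : LocalColoring} {e : Vtx × Vtx}
    (he : e ∈ t.edges χ) : idx e.1 ∈ t.members ∧ idx e.2 ∈ t.members := by
  have h := List.all_eq_true.1 (t.edges_inner χ (mem_colorings χ)) e he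
  rw [Bool.and_eq_true] at h
  refine ⟨List.mem_filter.2 ⟨List.mem_range.2 (idx_lt _), ?_⟩,
    List.mem_filter.2 ⟨List.mem_range.2 (idx_lt _), ?_⟩⟩
  · rw [vtx_idx]
    exact h.1
  · rw [vtx_idx]
    exact h.2

theorem TileType.mem_vertices_of_adj {χ : LocalColoring} (a b : Vtx) (h : (t.U χ).Adj a b) :
    a ∈ t.vertices := by
  rw [← TileType.idx_mem]
  rcases (TileType.U_adj.1 h).2 with h | h
  · exact (TileType.mem_members_of_mem_edges h).1
  · exact (TileType.mem_members_of_mem_edges h).2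

theorem seen_irrefl {D : Direction} {i : ℕ} : seen D i i = false := by
  rw [← Bool.not_eq_true]
  cases D <;> exact fun h => absurd (Nat.blt_eq.mp h) (lt_irrefl _)

theorem IsFrameCell.cardinalDegree_U (hz : IsFrameCell t.vertices z) (χ : LocalColoring)
    (D : Direction) {v : Vtx} (hv : v ∈ t.vertices) : cardinalDegree z (t.U χ) D v =
      popcount 18 (body (Nat.land (seenMask t.members D (idx v)) (t.mask χ))) := by
  have e : {c | c ∈ bits (seenMask t.members D (idx v)) ∧ Describes z (t.U χ) c} =
      ones (body (Nat.land (seenMask t.members D (idx v)) (t.mask χ))) := by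
    rw [ones_body]
    ext c
    rw [mem_bits_land, Set.mem_ofPred_eq]
    refine and_congr_right fun hc => ?_
    obtain ⟨j, hj, hs, rfl⟩ := mem_bits_seenMask.1 hc
    have hj' := TileType.mem_members.1 hj
    rw [← idx_vtx j hj'.1, describes_code_idx, TileType.code_mem_mask]
    intro e
    rw [e, idx_vtx j hj'.1, seen_irrefl] at hs
    exact Bool.false_ne_true hs
  rw [hz.cardinalDegree_eq TileType.mem_vertices_of_adj D hv, e, popcount_eq]
  -- A gadget has at most 18 vertices, so 18 rounds of `popcount` suffice.
  have sub : ones (body (Nat.land (seenMask t.members D (idx v)) (t.mask χ))) ⊆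
      ((t.members.map (code (idx v))).toFinset : Set ℕ) := by
    intro c hc
    obtain ⟨j, hj, -, rfl⟩ := mem_bits_seenMask.1 (mem_bits_land.1 hc).1
    simpa using ⟨j, hj, rfl⟩
  refine (Set.ncard_le_ncard sub (Finset.finite_toSet _)).trans ?_
  rw [Set.ncard_coe_finset]
  refine (List.toFinset_card_le _).trans ?_
  rw [List.length_map]
  exact t.length_members_le


/-! ### Valid triangulations are intended -/

theorem code_mem_allPairs {u v : Vtx} (h : u ≠ v) : code (idx u) (idx v) ∈ bits allPairs := by
  have mem : ∀ i < 18, ∀ j < 18, i < j → (pairs (List.range 18)).elem (i, j) = true := by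
    decide +kernel
  rw [allPairs, mem_bits_maskOf, List.mem_map]
  rcases lt_or_gt_of_ne (idx_injective.ne h) with h | h
  · exact ⟨_, List.mem_of_elem_eq_true (mem _ (idx_lt u) _ (idx_lt v) h), rfl⟩
  · exact ⟨_, List.mem_of_elem_eq_true (mem _ (idx_lt v) _ (idx_lt u) h), code_comm _ _⟩

theorem eq_U_of_agrees {t' f' : ℕ} {χ : LocalColoring} (h : Consistent (Describes z T) t' f')
    (ha : agrees t' f' (t.mask χ) = true) : T = t.U χ := by
  simp only [agrees, Bool.and_eq_true, Nat.beq_eq, body_eq_zero] at ha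
  have h1 := Set.eq_empty_iff_forall_notMem.1 ha.1
  have h2 := Set.eq_empty_iff_forall_notMem.1 ha.2
  ext u v
  by_cases huv : u = v
  · subst huv
    exact iff_of_false (T.irrefl) ((t.U χ).irrefl)
  rw [← TileType.code_mem_mask huv, ← describes_code_idx (z := z)]
  constructor
  · intro hT
    by_contra hn
    refine h2 _ (mem_bits_diff.2 ⟨mem_bits_diff.2 ⟨code_mem_allPairs huv, hn⟩, fun hf => ?_⟩)
    exact h.2 _ hf hT
  · intro hm
    by_contra hn
    exact h1 _ (mem_bits_diff.2 ⟨hm, fun ht => hn (h.1 _ ht)⟩)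

theorem mem_constrained {l : List ℕ} {c : ℕ × Direction} :
    c ∈ constrained l ↔ c.1 ∈ l ∧ vtx c.1 ∉ unconstrained c.2 := by
  obtain ⟨i, D⟩ := c
  simp only [constrained, List.mem_flatMap, List.mem_map, List.mem_filter, Prod.mk.injEq]
  constructor
  · rintro ⟨i, hi, D, ⟨-, hD⟩, rfl, rfl⟩
    exact ⟨hi, by simpa using hD⟩
  · rintro ⟨hi, hD⟩
    exact ⟨i, hi, D, ⟨by cases D <;> simp, by simpa using hD⟩, rfl, rfl⟩

/-- The coloring `χ` may vary with the vertex, as condition (1) of validity allows; the rules only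
need one `χ'` that prescribes the same degrees on all of `l`. -/
theorem IsFrameCell.countRules_hold (hz : IsFrameCell t.vertices z)
    (hT : ∀ a b, T.Adj a b → a ∈ t.vertices) {l : List ℕ} (hl : ∀ i ∈ l, i ∈ t.members)
    {χ' : LocalColoring} (h : ∀ i ∈ l, ∃ χ, Matches t z T (vtx i) χ ∧
      sameDegrees t.members (t.mask χ) (t.mask χ') l = true) :
    ∀ r ∈ countRules t.members (t.mask χ') l, r.Holds (Describes z T) := by
  intro r hr
  obtain ⟨⟨i, D⟩, hc, rfl⟩ := List.mem_map.1 hr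
  rw [force_eq, force_eq]
  obtain ⟨hi, hD⟩ := mem_constrained.1 hc
  obtain ⟨χ, hχ, hs⟩ := h i hi
  have hi' := TileType.mem_members.1 (hl i hi)
  have e := hχ D hD
  rw [hz.cardinalDegree_eq hT D hi'.2, hz.cardinalDegree_U χ D hi'.2, idx_vtx i hi'.1] at e
  have e' := List.all_eq_true.1 hs _ hc
  rw [force_eq, Nat.beq_eq] at e'
  exact e.trans e'

theorem exists_sameDegrees {reps : List LocalColoring} {l : List ℕ}
    (h : repsCheck t t.members reps l = true) (χ : LocalColoring) :
    ∃ χ' ∈ reps, sameDegrees t.members (t.mask χ) (t.mask χ') l = true :=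
  List.any_eq_true.1 (List.all_eq_true.1 h χ (mem_colorings χ))

theorem exists_mem_zip {γ δ : Type*} {l : List γ} {m : List δ} (h : l.length ≤ m.length) {a : γ}
    (ha : a ∈ l) : ∃ b, (a, b) ∈ l.zip m := by
  obtain ⟨i, hi, rfl⟩ := List.mem_iff_getElem.1 ha
  have : i < (l.zip m).length := by
    rw [List.length_zip]
    omega
  exact ⟨m[i], by rw [← List.getElem_zip (h := this)]; exact List.getElem_mem _⟩

/-- The west and south colorings of `T` are replaced by representatives `a` and `b` with the same
degrees. All rules of the search for this pair then hold in `T`, so `T` agrees with the graph found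
at some tip. -/
theorem IsValid.exists_eq_U (hz : IsFrameCell t.vertices z) (hT : IsValid t z T) (c : Certificate)
    (hc : validCheck t c = true) : ∃ χ, T = t.U χ := by
  simp only [validCheck, Bool.and_eq_true, force_eq, List.all_eq_true] at hc
  obtain ⟨⟨⟨hw, hs⟩, ho⟩, hlw, hc⟩ := hc
  have hd := hT.triangulation.isDrawn hz
  have inner : ∀ l : List ℕ, (l.all fun i => Nat.blt i 18 && !isInner i) = true →
      ∀ i ∈ l, i ∈ t.members := fun l hl i hi => by
    have := List.all_eq_true.1 hl i hi
    rw [Bool.and_eq_true, Nat.blt_eq, Bool.not_eq_true'] at this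
    exact TileType.mem_members_of_outer this.1 this.2
  obtain ⟨χw, hχw⟩ := hT.west
  obtain ⟨χs, hχs⟩ := hT.south
  obtain ⟨a, ha, hwa⟩ := exists_sameDegrees hw χw
  obtain ⟨b, hb, hsb⟩ := exists_sameDegrees hs χs
  obtain ⟨a', ha'⟩ := exists_mem_zip (of_decide_eq_true hlw) ha
  obtain ⟨hls, hc⟩ := hc _ ha'
  obtain ⟨b', hb'⟩ := exists_mem_zip (of_decide_eq_true hls) hb
  have rules : ∀ r ∈ countRules t.members (t.mask a) westList ++
      countRules t.members (t.mask b) southList ++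
      countRules t.members (t.mask (mkColoring .light .light)) (otherList t.members) ++
      (exclRules ++ clauseRules t.members), r.Holds (Describes z T) := by
    intro r hr
    rcases List.mem_append.1 hr with hr | hr
    · rcases List.mem_append.1 hr with hr | hr
      · rcases List.mem_append.1 hr with hr | hr
        · refine hz.countRules_hold hd.mem_vertices (inner _ (by decide)) ?_ r hr
          intro i hi
          exact ⟨χw, hχw _ ((by decide : ∀ i ∈ westList, vtx i ∈ westPath) i hi), hwa⟩
        · refine hz.countRules_hold hd.mem_vertices (inner _ (by decide)) ?_ r hr
          intro i hi
          exact ⟨χs, hχs _ ((by decide : ∀ i ∈ southList, vtx i ∈ southPath) i hi), hsb⟩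
      · refine hz.countRules_hold hd.mem_vertices (fun i hi => List.mem_of_mem_filter hi) ?_ r hr
        intro i hi
        obtain ⟨χ, hχ⟩ := hT.each_vertex _
          (TileType.mem_members.1 (List.mem_of_mem_filter hi)).2
        obtain ⟨χ', hχ', h⟩ := exists_sameDegrees ho χ
        rw [List.mem_singleton.1 hχ'] at h
        exact ⟨χ, hχ, h⟩
    · rcases List.mem_append.1 hr with hr | hr
      · exact hd.exclRules_hold hz r hr
      · exact hd.clauseRules_hold hz r hr
  have hh := hc _ hb'
  dsimp only at hh
  obtain ⟨t', f', h', hleaf⟩ := search_sound (hd.consistent hz) rules hh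
  rw [List.any_eq_true] at hleaf
  obtain ⟨χ, -, hχ⟩ := hleaf
  exact ⟨χ, eq_U_of_agrees h' hχ⟩


/-! ### Triangles -/

section Triangle

variable {a b c x : ℝ × ℝ}

/-- The three orientations divided by `orient a b c` are the barycentric coordinates of x. -/
theorem mem_convexHull_of_orient (h : 0 < orient a b c) (h1 : 0 ≤ orient b c x)
    (h2 : 0 ≤ orient c a x) (h3 : 0 ≤ orient a b x) : x ∈ convexHull ℝ {a, b, c} := by
  have e : orient b c x + orient c a x + orient a b x = orient a b c := by
    unfold orient
    ring
  have hx : x = ∑ i : Fin 3, (![orient b c x / orient a b c, orient c a x / orient a b c,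
      orient a b x / orient a b c] : Fin 3 → ℝ) i • (![a, b, c] : Fin 3 → ℝ × ℝ) i := by
    have h' := h.ne'
    simp only [Fin.sum_univ_three, Matrix.cons_val]
    refine Prod.ext ?_ ?_
    · simp only [Prod.fst_add, Prod.smul_fst, smul_eq_mul]
      field_simp
      unfold orient
      ring
    · simp only [Prod.snd_add, Prod.smul_snd, smul_eq_mul]
      field_simp
      unfold orient
      ring
  rw [hx]
  refine (convex_convexHull ℝ _).sum_mem ?_ ?_ ?_
  · intro i _
    fin_cases i
    exacts [div_nonneg h1 h.le, div_nonneg h2 h.le, div_nonneg h3 h.le]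
  · simp only [Fin.sum_univ_three, Matrix.cons_val]
    rw [← add_div, ← add_div, e, div_self h.ne']
  · intro i _
    refine subset_convexHull ℝ _ ?_
    fin_cases i <;> simp

theorem mem_convexHull_of_orient_neg (h : orient a b c < 0) (h1 : orient b c x ≤ 0)
    (h2 : 0 ≤ orient a c x) (h3 : orient a b x ≤ 0) : x ∈ convexHull ℝ {a, b, c} := by
  rw [Set.pair_comm]
  refine mem_convexHull_of_orient ?_ ?_ ?_ h2
  · rw [orient_swap]
    linarith
  · rw [orient_reverse]
    linarith
  · rw [orient_reverse]
    linarith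

/-- A point is not in the interior of the convex hull of points on one side of a line through it. -/
theorem notMem_interior_convexHull {d e v : ℝ × ℝ} {s : Set (ℝ × ℝ)} (hde : d ≠ e)
    (h : ∀ y ∈ s, orient d e y ≤ orient d e v) : v ∉ interior (convexHull ℝ s) := by
  intro hv
  have hull : convexHull ℝ s ⊆ {y | orient d e y ≤ orient d e v} := by
    refine convexHull_min h ?_
    intro y hy w hw r q hr hq hrq
    have hy' : orient d e y ≤ orient d e v := hy
    have hw' : orient d e w ≤ orient d e v := hw
    change orient d e (r • y + q • w) ≤ orient d e v
    have e1 : orient d e (r • y + q • w) = r * orient d e y + q * orient d e w := by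
      obtain rfl : r = 1 - q := by linarith
      simp only [orient, Prod.fst_add, Prod.snd_add, Prod.smul_fst, Prod.smul_snd, smul_eq_mul]
      ring
    rw [e1]
    calc r * orient d e y + q * orient d e w ≤ r * orient d e v + q * orient d e v :=
          add_le_add (mul_le_mul_of_nonneg_left hy' hr) (mul_le_mul_of_nonneg_left hw' hq)
      _ = orient d e v := by rw [← add_mul, hrq, one_mul]
  -- Moving v along the normal of the line increases the orientation, so points arbitrarily close to
  -- v are outside the hull.
  have cont : Filter.Tendsto (fun r : ℝ => v + r • ((-(e.2 - d.2), e.1 - d.1) : ℝ × ℝ))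
      (nhdsWithin 0 (Set.Ioi 0)) (nhds v) := by
    have : Continuous fun r : ℝ => v + r • ((-(e.2 - d.2), e.1 - d.1) : ℝ × ℝ) := by fun_prop
    have h0 := this.tendsto 0
    rw [zero_smul, add_zero] at h0
    exact h0.mono_left nhdsWithin_le_nhds
  obtain ⟨r, hr, hr0⟩ := ((cont.eventually (mem_interior_iff_mem_nhds.1 hv)).and
    self_mem_nhdsWithin).exists
  have h1 : orient d e (v + r • ((-(e.2 - d.2), e.1 - d.1) : ℝ × ℝ)) ≤ orient d e v := hull hr
  have h2 : orient d e (v + r • ((-(e.2 - d.2), e.1 - d.1) : ℝ × ℝ)) =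
      orient d e v + r * ((e.1 - d.1) ^ 2 + (e.2 - d.2) ^ 2) := by
    simp only [orient, Prod.fst_add, Prod.snd_add, Prod.smul_fst, Prod.smul_snd, smul_eq_mul]
    ring
  have h3 : 0 < (e.1 - d.1) ^ 2 + (e.2 - d.2) ^ 2 := by
    by_contra hc
    refine hde (Prod.ext ?_ ?_) <;> nlinarith [sq_nonneg (e.1 - d.1), sq_nonneg (e.2 - d.2)]
  have := mul_pos hr0 h3
  linarith

theorem notMem_interior_of_fst_le {v : ℝ × ℝ} {s : Set (ℝ × ℝ)} (h : ∀ y ∈ s, v.1 ≤ y.1) :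
    v ∉ interior (convexHull ℝ s) := by
  refine notMem_interior_convexHull (d := (0, 0)) (e := (0, 1)) (by simp) fun y hy => ?_
  have := h y hy
  simp [orient]
  exact this

theorem notMem_interior_of_le_fst {v : ℝ × ℝ} {s : Set (ℝ × ℝ)} (h : ∀ y ∈ s, y.1 ≤ v.1) :
    v ∉ interior (convexHull ℝ s) := by
  refine notMem_interior_convexHull (d := (0, 0)) (e := (0, -1)) (by simp) fun y hy => ?_
  have := h y hy
  simp [orient]
  exact this

/-- The eight lemmas below locate a point relative to the sides of a triangle with vertices in
x-order. In each, an affine identity writes the required orientation (or its negative), times a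
positive width, as a sum of two nonnegative products. -/
theorem nonneg_of_mul_eq_add {x u v w : ℝ} (hu : 0 < u) (hv : 0 ≤ v) (hw : 0 ≤ w)
    (h : x * u = v + w) : 0 ≤ x :=
  nonneg_of_mul_nonneg_left (h ▸ add_nonneg hv hw) hu

theorem orient_left_of_below (hab : a.1 < b.1) (hbc : b.1 < c.1) (h : 0 ≤ orient a b c)
    (hx : a.1 ≤ x.1) (hacx : 0 ≤ orient a c x) : 0 ≤ orient a b x :=
  nonneg_of_mul_eq_add (u := c.1 - a.1) (v := orient a c x * (b.1 - a.1))
    (w := orient a b c * (x.1 - a.1)) (by linarith) (mul_nonneg hacx (by linarith))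
    (mul_nonneg h (by linarith)) (by unfold orient; ring)

theorem orient_right_of_below (hab : a.1 < b.1) (hbc : b.1 < c.1) (h : 0 ≤ orient a b c)
    (hx : x.1 ≤ c.1) (hacx : 0 ≤ orient a c x) : 0 ≤ orient b c x :=
  nonneg_of_mul_eq_add (u := c.1 - a.1) (v := orient a c x * (c.1 - b.1))
    (w := orient a b c * (c.1 - x.1)) (by linarith) (mul_nonneg hacx (by linarith))
    (mul_nonneg h (by linarith)) (by unfold orient; ring)

theorem orient_base_of_left (hab : a.1 < b.1) (hbc : b.1 < c.1) (h : orient a b c ≤ 0)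
    (hx : a.1 ≤ x.1) (habx : 0 ≤ orient a b x) : 0 ≤ orient a c x :=
  nonneg_of_mul_eq_add (u := b.1 - a.1) (v := orient a b x * (c.1 - a.1))
    (w := -orient a b c * (x.1 - a.1)) (by linarith) (mul_nonneg habx (by linarith))
    (mul_nonneg (by linarith) (by linarith)) (by unfold orient; ring)

theorem orient_base_of_right (hab : a.1 < b.1) (hbc : b.1 < c.1) (h : orient a b c ≤ 0)
    (hx : x.1 ≤ c.1) (hbcx : 0 ≤ orient b c x) : 0 ≤ orient a c x :=
  nonneg_of_mul_eq_add (u := c.1 - b.1) (v := orient b c x * (c.1 - a.1))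
    (w := -orient a b c * (c.1 - x.1)) (by linarith) (mul_nonneg hbcx (by linarith))
    (mul_nonneg (by linarith) (by linarith)) (by unfold orient; ring)

theorem orient_right_of_left (hab : a.1 < b.1) (hbc : b.1 < c.1) (h : 0 ≤ orient a b c)
    (hx : x.1 ≤ b.1) (habx : 0 ≤ orient a b x) : 0 ≤ orient b c x :=
  nonneg_of_mul_eq_add (u := b.1 - a.1) (v := orient a b x * (c.1 - b.1))
    (w := orient a b c * (b.1 - x.1)) (by linarith) (mul_nonneg habx (by linarith))
    (mul_nonneg h (by linarith)) (by unfold orient; ring)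

theorem orient_left_of_right (hab : a.1 < b.1) (hbc : b.1 < c.1) (h : 0 ≤ orient a b c)
    (hx : b.1 ≤ x.1) (hbcx : 0 ≤ orient b c x) : 0 ≤ orient a b x :=
  nonneg_of_mul_eq_add (u := c.1 - b.1) (v := orient b c x * (b.1 - a.1))
    (w := orient a b c * (x.1 - b.1)) (by linarith) (mul_nonneg hbcx (by linarith))
    (mul_nonneg h (by linarith)) (by unfold orient; ring)

theorem orient_right_nonpos_of_left (hab : a.1 < b.1) (hbc : b.1 < c.1) (h : orient a b c ≤ 0)
    (hx : x.1 ≤ b.1) (habx : orient a b x ≤ 0) : orient b c x ≤ 0 :=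
  neg_nonneg.1 (nonneg_of_mul_eq_add (u := b.1 - a.1) (v := -orient a b x * (c.1 - b.1))
    (w := -orient a b c * (b.1 - x.1)) (by linarith) (mul_nonneg (by linarith) (by linarith))
    (mul_nonneg (by linarith) (by linarith)) (by unfold orient; ring))

theorem orient_left_nonpos_of_right (hab : a.1 < b.1) (hbc : b.1 < c.1) (h : orient a b c ≤ 0)
    (hx : b.1 ≤ x.1) (hbcx : orient b c x ≤ 0) : orient a b x ≤ 0 :=
  neg_nonneg.1 (nonneg_of_mul_eq_add (u := c.1 - b.1) (v := -orient b c x * (b.1 - a.1))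
    (w := -orient a b c * (x.1 - b.1)) (by linarith) (mul_nonneg (by linarith) (by linarith))
    (mul_nonneg (by linarith) (by linarith)) (by unfold orient; ring))

end Triangle

/-! ### Sweeping a frame cell -/

section Sweep

variable (u tr fa : ℕ) (V : List ℕ)

def known (s : Bool) (i j k : ℕ) : Bool := (body (bif s then tr else fa)).testBit (triple i j k)

/-- No vertex is in the triangle `i < j < k`, where `s` tells whether `j` is below `i k`. -/
def isEmpty (s : Bool) (i j k : ℕ) : Bool :=
  V.all fun v => Nat.ble v i || Nat.ble k v || Nat.beq v j || known tr fa (!s) i v k ||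
    (Nat.blt v j && known tr fa s i v j) || (Nat.blt j v && known tr fa s j v k)

noncomputable def isTriangle (i j k : ℕ) : Bool :=
  V.elem i && V.elem j && V.elem k && Nat.blt i j && Nat.blt j k &&
    ((body u).testBit (code i j) && (body u).testBit (code j k) && (body u).testBit (code i k))

/-- Move a path from the lower boundary to the upper boundary by replacing two sides of a triangle
by the third one or vice versa. The list `cur` contains the edges of the path, and `seen` contains
all edges of all paths. -/
noncomputable def sweep (edges : List (ℕ × ℕ)) :
    List (ℕ × ℕ × ℕ) → List (ℕ × ℕ) → List (ℕ × ℕ) → List (ℕ × ℕ × ℕ) → Bool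
  | [], cur, seen, faces =>
    (cur.all fun e => upperPairs.elem e) && (edges.all fun e => seen.elem e) &&
      -- A point on the upper boundary may remain above the last path without being in a counted
      -- triangle; hence each upper edge must be a side of a face.
      upperPairs.all fun e => faces.any fun f =>
        e == (f.1, f.2.1) || e == (f.2.1, f.2.2) || e == (f.1, f.2.2)
  | (i, j, k) :: l, cur, seen, faces =>
    isTriangle u V i j k &&
      -- If `j` is below the segment from `i` to `k`, the path moves up from the two short sides to
      -- the long one; otherwise from the long side to the two short ones.
      ((known tr fa true i j k && isEmpty tr fa V true i j k && seen.elem (i, j) &&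
          seen.elem (j, k) &&
          sweep edges l ((i, k) :: cur.filter fun e => !(e == (i, j) || e == (j, k)))
            ((i, k) :: seen) ((i, j, k) :: faces)) ||
        (known tr fa false i j k && isEmpty tr fa V false i j k && seen.elem (i, k) &&
          sweep edges l ((i, j) :: (j, k) :: cur.filter fun e => !(e == (i, k)))
            ((i, j) :: (j, k) :: seen) ((i, j, k) :: faces)))

end Sweep

/-- The triangle `i < j < k` is a face of `T`. -/
structure IsFace (t : TileType) (z : Vtx → ℝ × ℝ) (T : SimpleGraph Vtx) (f : ℕ × ℕ × ℕ) : Prop where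
  adj₁ : T.Adj (vtx f.1) (vtx f.2.1)
  adj₂ : T.Adj (vtx f.2.1) (vtx f.2.2)
  adj₃ : T.Adj (vtx f.1) (vtx f.2.2)
  empty : ∀ v ∈ t.vertices,
    z v ∉ interior (convexHull ℝ {z (vtx f.1), z (vtx f.2.1), z (vtx f.2.2)})

def InTriangle (z : Vtx → ℝ × ℝ) (f : ℕ × ℕ × ℕ) (x : ℝ × ℝ) : Prop :=
  x ∈ convexHull ℝ {z (vtx f.1), z (vtx f.2.1), z (vtx f.2.2)}

theorem known_iff {tr fa : ℕ} (h : Consistent (Describes z T) tr fa) {s : Bool} {i j k : ℕ}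
    (hi : i < 18) (hj : j < 18) (hk : known tr fa s i j k = true) :
    0 < turn z i j k ↔ s = true := by
  rw [← describes_triple (T := T) hi hj]
  cases s with
  | true => exact iff_of_true (h.1 _ hk) rfl
  | false => exact iff_of_false (h.2 _ hk) Bool.false_ne_true

theorem turn_neg_of_known {tr fa : ℕ} (hz : IsFrameCell t.vertices z)
    (h : Consistent (Describes z T) tr fa) {i j k : ℕ}
    (hi : i ∈ t.members) (hj : j ∈ t.members) (hk : k ∈ t.members) (hij : i < j) (hjk : j < k)
    (hs : known tr fa false i j k = true) : turn z i j k < 0 :=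
  lt_of_le_of_ne (not_lt.1 (mt (known_iff h (TileType.mem_members.1 hi).1
    (TileType.mem_members.1 hj).1 hs).1 Bool.false_ne_true)) (hz.turn_ne_zero hi hj hk hij hjk)

theorem turn_pos_of_known {tr fa : ℕ}
    (h : Consistent (Describes z T) tr fa) {i j k : ℕ}
    (hi : i ∈ t.members) (hj : j ∈ t.members)
    (hs : known tr fa true i j k = true) : 0 < turn z i j k :=
  (known_iff h (TileType.mem_members.1 hi).1 (TileType.mem_members.1 hj).1 hs).2 rfl

/-- Each alternative of the test yields a line through `v`, vertical or parallel to a side, with the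
whole triangle on one closed side. -/
theorem isEmpty_sound {tr fa : ℕ} (hz : IsFrameCell t.vertices z)
    (h : Consistent (Describes z T) tr fa) {s : Bool} {i j k : ℕ}
    (hi : i ∈ t.members) (hj : j ∈ t.members) (hk : k ∈ t.members) (hij : i < j) (hjk : j < k)
    (hs : known tr fa s i j k = true) (he : isEmpty tr fa t.members s i j k = true) :
    ∀ v ∈ t.vertices, z v ∉ interior (convexHull ℝ {z (vtx i), z (vtx j), z (vtx k)}) := by
  intro v hv
  rw [← TileType.idx_mem] at hv
  have hv' := List.all_eq_true.1 he _ hv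
  generalize hw : idx v = w at *
  rw [← vtx_idx v, hw]
  have x1 := hz.fst_lt hi hj hij
  have x2 := hz.fst_lt hj hk hjk
  have sides : ∀ {d e : ℝ × ℝ}, d ≠ e → orient d e (z (vtx i)) ≤ orient d e (z (vtx w)) →
      orient d e (z (vtx j)) ≤ orient d e (z (vtx w)) →
      orient d e (z (vtx k)) ≤ orient d e (z (vtx w)) →
      z (vtx w) ∉ interior (convexHull ℝ {z (vtx i), z (vtx j), z (vtx k)}) := by
    intro d e hde h1 h2 h3
    refine notMem_interior_convexHull hde ?_
    rintro y (rfl | rfl | rfl)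
    exacts [h1, h2, h3]
  have ne : ∀ {d e : ℝ × ℝ}, d.1 < e.1 → d ≠ e ∧ e ≠ d := fun h =>
    ⟨fun hc => h.ne (congrArg Prod.fst hc), fun hc => h.ne (congrArg Prod.fst hc.symm)⟩
  by_cases hwi : w ≤ i
  · refine notMem_interior_of_fst_le ?_
    have : (z (vtx w)).1 ≤ (z (vtx i)).1 := not_lt.1 fun hc => by
      have := (hz.fst_lt_iff hi hv).1 hc
      omega
    rintro y (rfl | rfl | rfl) <;> linarith
  by_cases hwk : k ≤ w
  · refine notMem_interior_of_le_fst ?_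
    have : (z (vtx k)).1 ≤ (z (vtx w)).1 := not_lt.1 fun hc => by
      have := (hz.fst_lt_iff hv hk).1 hc
      omega
    rintro y (rfl | rfl | rfl) <;> linarith
  simp only [Bool.or_eq_true, Bool.and_eq_true, Nat.ble_eq, Nat.beq_eq, Nat.blt_eq, hwi, hwk,
    false_or] at hv'
  rw [not_le] at hwi hwk
  rcases hv' with ((rfl | hk') | ⟨hwj, hk'⟩) | ⟨hwj, hk'⟩ <;> cases s
  · have h1 := turn_neg_of_known hz h hi hj hk hij hjk hs
    rw [turn, orient_swap] at h1
    refine sides (ne (x1.trans x2)).1 ?_ le_rfl ?_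
    · rw [orient_self_left]; linarith
    · rw [orient_self_right]; linarith
  · have h1 := turn_pos_of_known h hi hj hs
    rw [turn, orient_swap] at h1
    refine sides (ne (x1.trans x2)).2 ?_ le_rfl ?_
    · rw [orient_self_right, orient_reverse]; linarith
    · rw [orient_self_left, orient_reverse]; linarith
  · have h1 := turn_neg_of_known hz h hi hj hk hij hjk hs
    have h2 := turn_pos_of_known h hi hv hk'
    rw [turn, orient_swap] at h1 h2
    refine sides (ne (x1.trans x2)).2 ?_ ?_ ?_
    · rw [orient_self_right, orient_reverse]; linarith
    · simp only [orient_reverse (z (vtx i)) (z (vtx k))]; linarith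
    · rw [orient_self_left, orient_reverse]; linarith
  · have h1 := turn_pos_of_known h hi hj hs
    have h2 := turn_neg_of_known hz h hi hv hk hwi hwk hk'
    rw [turn, orient_swap] at h1 h2
    refine sides (ne (x1.trans x2)).1 ?_ ?_ ?_
    · rw [orient_self_left]; linarith
    · linarith
    · rw [orient_self_right]; linarith
  · have h1 := turn_neg_of_known hz h hi hj hk hij hjk hs
    have h2 := turn_neg_of_known hz h hi hv hj hwi hwj hk'
    rw [turn] at h1 h2
    rw [orient_swap] at h2
    refine sides (ne x1).1 ?_ ?_ ?_
    · rw [orient_self_left]; linarith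
    · rw [orient_self_right]; linarith
    · linarith
  · have h1 := turn_pos_of_known h hi hj hs
    have h2 := turn_pos_of_known h hi hv hk'
    rw [turn] at h1 h2
    rw [orient_swap] at h2
    refine sides (ne x1).2 ?_ ?_ ?_
    · rw [orient_self_right, orient_reverse]; linarith
    · rw [orient_self_left, orient_reverse]; linarith
    · simp only [orient_reverse (z (vtx i)) (z (vtx j))]; linarith
  · have h1 := turn_neg_of_known hz h hi hj hk hij hjk hs
    have h2 := turn_neg_of_known hz h hj hv hk hwj hwk hk'
    rw [turn] at h1 h2
    rw [← orient_rotate] at h1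
    rw [orient_swap] at h2
    refine sides (ne x2).1 ?_ ?_ ?_
    · linarith
    · rw [orient_self_left]; linarith
    · rw [orient_self_right]; linarith
  · have h1 := turn_pos_of_known h hi hj hs
    have h2 := turn_pos_of_known h hj hv hk'
    rw [turn] at h1 h2
    rw [← orient_rotate] at h1
    rw [orient_swap] at h2
    refine sides (ne x2).2 ?_ ?_ ?_
    · simp only [orient_reverse (z (vtx j)) (z (vtx k))]; linarith
    · rw [orient_self_right, orient_reverse]; linarith
    · rw [orient_self_left, orient_reverse]; linarith

theorem isTriangle_sound {χ : LocalColoring} {i j k : ℕ}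
    (h : isTriangle (t.mask χ) t.members i j k = true) : (i ∈ t.members ∧ j ∈ t.members ∧
      k ∈ t.members ∧ i < j ∧ j < k) ∧ (t.U χ).Adj (vtx i) (vtx j) ∧
      (t.U χ).Adj (vtx j) (vtx k) ∧ (t.U χ).Adj (vtx i) (vtx k) := by
  simp only [isTriangle, Bool.and_eq_true, Nat.blt_eq, List.elem_eq_mem, decide_eq_true_eq] at h
  obtain ⟨⟨⟨⟨⟨hi, hj⟩, hk⟩, hij⟩, hjk⟩, ⟨h1, h2⟩, h3⟩ := h
  have adj : ∀ {a b}, a ∈ t.members → b ∈ t.members → a < b →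
      (body (t.mask χ)).testBit (code a b) = true → (t.U χ).Adj (vtx a) (vtx b) :=
    fun {a b} ha hb hab h => by
      have ha' := (TileType.mem_members.1 ha).1
      have hb' := (TileType.mem_members.1 hb).1
      rw [← TileType.code_mem_mask (vtx_ne ha' hb' hab.ne), idx_vtx a ha', idx_vtx b hb']
      exact h
  exact ⟨⟨hi, hj, hk, hij, hjk⟩, adj hi hj hij h1, adj hj hk hjk h2,
    adj hi hk (hij.trans hjk) h3⟩

/-- The points over the edge `e` are above the lower boundary. -/
def OverLower (z : Vtx → ℝ × ℝ) (e : ℕ × ℕ) : Prop :=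
  ∀ x, SpannedBy z e x → 0 ≤ height z e x → Above z lowerPairs x

/-- Two invariants: a point above the lower boundary is in a triangle already swept or above the
current path (`hcur`), and what lies over an edge used so far is above the lower boundary (`hseen`).
In one step, a point above a replaced side is above the new part of the path or in the triangle. The
new sides inherit `hseen`, since they lie above the old ones. -/
theorem sweep_sound {χ : LocalColoring} {tr fa : ℕ} (hz : IsFrameCell t.vertices z)
    (h : Consistent (Describes z (t.U χ)) tr fa) {edges : List (ℕ × ℕ)} (l : List (ℕ × ℕ × ℕ))
    (cur seen : List (ℕ × ℕ)) (faces : List (ℕ × ℕ × ℕ))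
    (hs : sweep (t.mask χ) tr fa t.members edges l cur seen faces = true)
    (hfaces : ∀ f ∈ faces, IsFace t z (t.U χ) f)
    (hcur : ∀ x, Above z lowerPairs x → (∃ f ∈ faces, InTriangle z f x) ∨ Above z cur x)
    (hseen : ∀ e ∈ seen, OverLower z e) :
    (∀ e ∈ edges, OverLower z e) ∧ ∃ faces : List (ℕ × ℕ × ℕ),
      (∀ f ∈ faces, IsFace t z (t.U χ) f) ∧
      (∀ x, Above z lowerPairs x → (∃ f ∈ faces, InTriangle z f x) ∨ Above z upperPairs x) ∧
      ∀ e ∈ upperPairs, ∃ f ∈ faces, e = (f.1, f.2.1) ∨ e = (f.2.1, f.2.2) ∨ e = (f.1, f.2.2) := by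
  induction l generalizing cur seen faces with
  | nil =>
    simp only [sweep, Bool.and_eq_true, List.all_eq_true, List.elem_eq_mem, decide_eq_true_eq,
      List.any_eq_true, Bool.or_eq_true, beq_iff_eq, or_assoc] at hs
    obtain ⟨⟨h1, h2⟩, h3⟩ := hs
    refine ⟨fun e he => hseen e (h2 e he), faces, hfaces, fun x hx => ?_, h3⟩
    exact (hcur x hx).imp_right fun ⟨e, he, hx⟩ => ⟨e, h1 e he, hx⟩
  | cons f l ih =>
    obtain ⟨i, j, k⟩ := f
    simp only [sweep, Bool.and_eq_true, Bool.or_eq_true, List.elem_eq_mem,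
      decide_eq_true_eq] at hs
    obtain ⟨ht, hs⟩ := hs
    obtain ⟨⟨hi, hj, hk, hij, hjk⟩, a1, a2, a3⟩ := isTriangle_sound ht
    have x1 := hz.fst_lt hi hj hij
    have x2 := hz.fst_lt hj hk hjk
    have newFaces : ∀ s, known tr fa s i j k = true → isEmpty tr fa t.members s i j k = true →
        ∀ f ∈ (i, j, k) :: faces, IsFace t z (t.U χ) f := fun s h1 h2 f hf => by
      rcases List.mem_cons.1 hf with rfl | hf
      · exact ⟨a1, a2, a3, isEmpty_sound hz h hi hj hk hij hjk h1 h2⟩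
      · exact hfaces f hf
    have old : ∀ {x}, (∃ f ∈ faces, InTriangle z f x) →
        ∃ f ∈ (i, j, k) :: faces, InTriangle z f x := fun ⟨f, hf, hx⟩ =>
      ⟨f, List.mem_cons_of_mem _ hf, hx⟩
    have new : ∀ {x}, InTriangle z (i, j, k) x → ∃ f ∈ (i, j, k) :: faces, InTriangle z f x :=
      fun hx => ⟨_, List.mem_cons_self, hx⟩
    rcases hs with ⟨⟨⟨⟨hk1, he⟩, s1⟩, s2⟩, hs⟩ | ⟨⟨⟨hk1, he⟩, s1⟩, hs⟩
    · have o : 0 < orient (z (vtx i)) (z (vtx j)) (z (vtx k)) := turn_pos_of_known h hi hj hk1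
      refine ih _ _ _ hs (newFaces _ hk1 he) ?_ ?_
      · intro x hx
        rcases hcur x hx with hx | ⟨e, hec, ⟨hl, hr⟩, hx⟩
        · exact .inl (old hx)
        by_cases hac : 0 ≤ height z (i, k) x
        · by_cases he1 : e = (i, j)
          · subst he1
            exact .inr ⟨(i, k), List.mem_cons_self, ⟨hl, hr.trans x2.le⟩, hac⟩
          by_cases he2 : e = (j, k)
          · subst he2
            exact .inr ⟨(i, k), List.mem_cons_self, ⟨x1.le.trans hl, hr⟩, hac⟩
          exact .inr ⟨e, List.mem_cons_of_mem _ (List.mem_filter.2 ⟨hec, by simp [he1, he2]⟩),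
            ⟨hl, hr⟩, hx⟩
        · have hca : 0 ≤ orient (z (vtx k)) (z (vtx i)) x := by
            rw [not_le, height] at hac
            rw [orient_reverse]
            exact neg_nonneg.2 hac.le
          by_cases he1 : e = (i, j)
          · subst he1
            exact .inl (new (mem_convexHull_of_orient o (orient_right_of_left x1 x2 o.le hr hx)
              hca hx))
          by_cases he2 : e = (j, k)
          · subst he2
            exact .inl (new (mem_convexHull_of_orient o hx hca
              (orient_left_of_right x1 x2 o.le hl hx)))
          exact .inr ⟨e, List.mem_cons_of_mem _ (List.mem_filter.2 ⟨hec, by simp [he1, he2]⟩),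
            ⟨hl, hr⟩, hx⟩
      · intro e he
        rcases List.mem_cons.1 he with rfl | he
        · rintro x ⟨hl, hr⟩ hx
          rcases le_total x.1 (z (vtx j)).1 with hm | hm
          · exact hseen _ s1 x ⟨hl, hm⟩ (orient_left_of_below x1 x2 o.le hl hx)
          · exact hseen _ s2 x ⟨hm, hr⟩ (orient_right_of_below x1 x2 o.le hr hx)
        · exact hseen e he
    · have o : orient (z (vtx i)) (z (vtx j)) (z (vtx k)) < 0 :=
        turn_neg_of_known hz h hi hj hk hij hjk hk1
      refine ih _ _ _ hs (newFaces _ hk1 he) ?_ ?_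
      · intro x hx
        rcases hcur x hx with hx | ⟨e, hec, ⟨hl, hr⟩, hx⟩
        · exact .inl (old hx)
        by_cases he1 : e = (i, k)
        · subst he1
          rcases le_total x.1 (z (vtx j)).1 with hm | hm
          · rcases le_total 0 (height z (i, j) x) with hab | hab
            · exact .inr ⟨(i, j), List.mem_cons_self, ⟨hl, hm⟩, hab⟩
            · exact .inl (new (mem_convexHull_of_orient_neg o
                (orient_right_nonpos_of_left x1 x2 o.le hm hab) hx hab))
          · rcases le_total 0 (height z (j, k) x) with hab | hab
            · exact .inr ⟨(j, k), by simp, ⟨hm, hr⟩, hab⟩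
            · exact .inl (new (mem_convexHull_of_orient_neg o hab hx
                (orient_left_nonpos_of_right x1 x2 o.le hm hab)))
        exact .inr ⟨e, List.mem_cons_of_mem _ (List.mem_cons_of_mem _
          (List.mem_filter.2 ⟨hec, by simp [he1]⟩)), ⟨hl, hr⟩, hx⟩
      · intro e he
        rcases List.mem_cons.1 he with rfl | he
        · rintro x ⟨hl, hr⟩ hx
          exact hseen _ s1 x ⟨hl, hr.trans x2.le⟩ (orient_base_of_left x1 x2 o.le hl hx)
        rcases List.mem_cons.1 he with rfl | he
        · rintro x ⟨hl, hr⟩ hx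
          exact hseen _ s1 x ⟨x1.le.trans hl, hr⟩ (orient_base_of_right x1 x2 o.le hr hx)
        · exact hseen e he


/-! ### Intended triangulations are valid -/

def sortPair (i j : ℕ) : ℕ × ℕ := bif Nat.blt i j then (i, j) else (j, i)

/-- All edges and non-edges of the graph are given at the start. Without branching, propagation then
derives the orientations that a drawing without crossings forces on p and q, which the sweep needs.
If the graph must have crossings, propagation finds a contradiction and no sweep is needed. -/
noncomputable def intendedCheck (t : TileType) (χ : LocalColoring) (l : List (ℕ × ℕ × ℕ)) : Bool :=
  (fun V => force (t.mask χ) fun u => (blocked.all fun e => !(body u).testBit (code e.1 e.2)) &&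
    force (join (initTrue V) u) fun t₀ =>
      force (join (join (initFalse V) (foreign V)) (diff allPairs u)) fun f₀ =>
        search (fun tr fa => sweep u tr fa V
          ((t.edges χ).map fun e => sortPair (idx e.1) (idx e.2)) l lowerPairs lowerPairs [])
          Tree.tip (exclRules ++ clauseRules V) t₀ f₀) t.members

theorem sortPair_cases {u v : Vtx} (h : u ≠ v) : (idx u < idx v ∧
    sortPair (idx u) (idx v) = (idx u, idx v)) ∨ (idx v < idx u ∧
      sortPair (idx u) (idx v) = (idx v, idx u)) := by
  simp only [sortPair, Bool.cond_eq_ite, Nat.blt_eq]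
  rcases lt_or_gt_of_ne (idx_injective.ne h) with h | h
  · exact .inl ⟨h, if_pos h⟩
  · exact .inr ⟨h, if_neg h.not_gt⟩

theorem TileType.edges_ne {χ : LocalColoring} {e : Vtx × Vtx} (he : e ∈ t.edges χ) :
    e.1 ≠ e.2 := by
  have key : ∀ t : TileType, ∀ χ ∈ colorings,
      ((t.edges χ).all fun e => decide (e.1 ≠ e.2)) = true := by
    decide +kernel
  exact of_decide_eq_true (List.all_eq_true.1 (key t χ (mem_colorings χ)) e he)

theorem TileType.boundary_adj (t : TileType) (χ : LocalColoring) :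
    ∀ e ∈ boundaryEdges, (t.U χ).Adj e.1 e.2 := by
  intro e he
  refine TileType.U_adj.2 ⟨(by decide +kernel : ∀ e ∈ boundaryEdges, e.1 ≠ e.2) e he, .inl ?_⟩
  exact List.mem_append_left _ (List.mem_append_left _ (List.mem_append_left _ he))

theorem IsFrameCell.fst_le (hz : IsFrameCell t.vertices z) {i j : ℕ} (hi : i ∈ t.members)
    (hj : j ∈ t.members) (h : i ≤ j) : (z (vtx i)).1 ≤ (z (vtx j)).1 := by
  rcases h.eq_or_lt with rfl | h
  · exact le_rfl
  · exact (hz.fst_lt hi hj h).le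

/-- The cell is below its upper boundary. -/
theorem IsFrameCell.below_upper (hz : IsFrameCell t.vertices z) {i j : ℕ} (hi : i ∈ t.members)
    (hj : j ∈ t.members) (h : i < j) {x : ℝ × ℝ} (hx : x ∈ segment ℝ (z (vtx i)) (z (vtx j))) :
    Below z upperPairs x := by
  have m0 : 0 ∈ t.members := TileType.mem_members_of_outer (by norm_num) rfl
  have m17 : 17 ∈ t.members := TileType.mem_members_of_outer (by norm_num) rfl
  obtain ⟨h1, h2⟩ := fst_of_mem_segment (hz.fst_lt hi hj h).le hx
  have h0 := (hz.fst_le m0 hi (Nat.zero_le _)).trans h1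
  have h17 := h2.trans (hz.fst_le hj m17 (Nat.le_of_lt_succ (TileType.mem_members.1 hj).1))
  -- Otherwise x would be to the right of the end of each edge in turn, and the last edge would
  -- still contain its abscissa.
  have span : ∃ e ∈ upperPairs, SpannedBy z e x := by
    by_contra hc
    have s : ∀ e ∈ upperPairs, (z (vtx e.1)).1 ≤ x.1 → (z (vtx e.2)).1 ≤ x.1 := fun e he h => by
      by_contra h'
      exact hc ⟨e, he, h, (not_le.1 h').le⟩
    have e : upperPairs =
        [(0, 6), (6, 7), (7, 8), (8, 9), (9, 10), (10, 11), (11, 12), (12, 17)] := by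
      decide +kernel
    have h12 := s (11, 12) (by simp [e]) (s (10, 11) (by simp [e]) (s (9, 10) (by simp [e])
      (s (8, 9) (by simp [e]) (s (7, 8) (by simp [e]) (s (6, 7) (by simp [e])
        (s (0, 6) (by simp [e]) h0))))))
    exact hc ⟨(12, 17), by simp [e], h12, h17⟩
  obtain ⟨e, he, hs⟩ := span
  refine ⟨e, he, hs, ?_⟩
  -- All vertices are on or below the line of a hull edge, and so are points between two of them.
  have n1 := (hz.turn_upper he hi).1
  have n2 := (hz.turn_upper he hj).1
  obtain ⟨r, q, hr, hq, hrq, rfl⟩ := hx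
  have e1 : height z e (r • z (vtx i) + q • z (vtx j)) =
      r * turn z e.1 e.2 i + q * turn z e.1 e.2 j := by
    obtain rfl : r = 1 - q := by linarith
    simp only [height, turn, orient, Prod.fst_add, Prod.snd_add, Prod.smul_fst, Prod.smul_snd,
      smul_eq_mul]
    ring
  rw [e1]
  exact add_nonpos (mul_nonpos_of_nonneg_of_nonpos hr n1) (mul_nonpos_of_nonneg_of_nonpos hq n2)

theorem IsFrameCell.mem_segment_of_above_of_below (hz : IsFrameCell t.vertices z) {x : ℝ × ℝ}
    (ha : Above z upperPairs x) (hb : Below z upperPairs x) :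
    ∃ e ∈ upperPairs, x ∈ segment ℝ (z (vtx e.1)) (z (vtx e.2)) := by
  obtain ⟨e, he, ⟨l1, r1⟩, h1⟩ := ha
  obtain ⟨d, hd, ⟨l2, r2⟩, h2⟩ := hb
  have mem : ∀ e ∈ upperPairs, e.1 ∈ t.members ∧ e.2 ∈ t.members ∧ e.1 < e.2 := fun e he =>
    mem_members_of_mem_boundary (List.mem_append_right lowerPairs he)
  obtain ⟨e1, e2, e3⟩ := mem e he
  obtain ⟨d1, d2, d3⟩ := mem d hd
  refine ⟨e, he, mem_segment_of_orient (hz.fst_lt e1 e2 e3) l1 r1 (le_antisymm ?_ h1)⟩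
  have up : ∀ {d : ℕ × ℕ} {y : ℝ × ℝ}, d ∈ upperPairs → x.1 = y.1 →
      orient (z (vtx d.1)) (z (vtx d.2)) y = 0 → height z d x =
        ((z (vtx d.2)).1 - (z (vtx d.1)).1) * (x.2 - y.2) ∧
          0 < (z (vtx d.2)).1 - (z (vtx d.1)).1 := fun {d y} hd hxy h => by
    obtain ⟨d1, d2, d3⟩ := mem d hd
    rw [← orient_sub_orient hxy, h, sub_zero]
    exact ⟨rfl, sub_pos.2 (hz.fst_lt d1 d2 d3)⟩
  have cmp : ∀ y : ℝ × ℝ, x.1 = y.1 → orient (z (vtx d.1)) (z (vtx d.2)) y = 0 →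
      orient (z (vtx e.1)) (z (vtx e.2)) y = 0 →
        orient (z (vtx e.1)) (z (vtx e.2)) x ≤ 0 := fun y hxy hdy hey => by
    obtain ⟨u1, p1⟩ := up hd hxy hdy
    obtain ⟨u2, p2⟩ := up he hxy hey
    rw [u1] at h2
    change height z e x ≤ 0
    rw [u2]
    exact mul_nonpos_of_nonneg_of_nonpos p2.le (nonpos_of_mul_nonpos_right h2 p1)
  -- Two different upper edges over the same abscissa share the vertex at this abscissa, through
  -- which their heights are compared.
  rcases (by decide +kernel : ∀ e ∈ upperPairs, ∀ d ∈ upperPairs, e = d ∨ e.2 ≤ d.1 ∨ d.2 ≤ e.1)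
    e he d hd with rfl | h | h
  · exact h2
  · have hx1 : (z (vtx d.1)).1 = x.1 := le_antisymm l2 (r1.trans (hz.fst_le e2 d1 h))
    have : e.2 = d.1 := h.antisymm (not_lt.1 fun hc => by
      have := hz.fst_lt e2 d1 hc
      linarith)
    refine cmp (z (vtx d.1)) hx1.symm (orient_self_left _ _) ?_
    rw [← this, orient_self_right]
  · have hx1 : (z (vtx e.1)).1 = x.1 := le_antisymm l1 (r2.trans (hz.fst_le d2 e1 h))
    have : d.2 = e.1 := h.antisymm (not_lt.1 fun hc => by
      have := hz.fst_lt d2 e1 hc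
      linarith)
    refine cmp (z (vtx e.1)) hx1.symm ?_ (orient_self_left _ _)
    rw [← this, orient_self_right]

/-- The absence of crossings is what makes the derived orientations true. The edges of the swept
paths give `inside`, and the swept triangles give `faces`. -/
theorem isTriangulation_of_intendedCheck (hz : IsFrameCell t.vertices z) {χ : LocalColoring}
    (hU : NonCrossing z (t.U χ)) (l : List (ℕ × ℕ × ℕ)) (hc : intendedCheck t χ l = true) :
    IsTriangulation t.vertices z (t.U χ) := by
  simp only [intendedCheck, force_eq, Bool.and_eq_true, List.all_eq_true,
    Bool.not_eq_true'] at hc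
  obtain ⟨hbl, hc⟩ := hc
  have hd : IsDrawn t z (t.U χ) := by
    refine ⟨TileType.mem_vertices_of_adj, hU, t.boundary_adj χ, fun e he h => ?_⟩
    have := (by decide : ∀ e ∈ blocked, e.1 < 18 ∧ e.2 < 18) e he
    have h' := (TileType.code_mem_mask h.ne).2 h
    rw [idx_vtx _ this.1, idx_vtx _ this.2, mem_bits, hbl e he] at h'
    exact Bool.false_ne_true h'
  have des : ∀ i, i ∈ bits (t.mask χ) → Describes z (t.U χ) i := by
    intro i hi
    obtain ⟨e, he, rfl⟩ := List.mem_map.1 (mem_bits_maskOf.1 hi)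
    rw [describes_code_idx, ← TileType.code_mem_mask]
    · exact hi
    · exact TileType.edges_ne he
  have cons := ((hd.consistent hz).join_left des).join_right (a := diff allPairs (t.mask χ))
    fun i hi => by
      obtain ⟨h1, h2⟩ := mem_bits_diff.1 hi
      obtain ⟨x, hx, rfl⟩ := List.mem_map.1 (mem_bits_maskOf.1 h1)
      obtain ⟨b1, b2, b3⟩ := mem_of_mem_pairs List.pairwise_lt_range hx
      rw [List.mem_range] at b1 b2
      rw [describes_code b1 b2]
      intro h
      refine h2 ?_
      have := (TileType.code_mem_mask h.ne).2 h
      rwa [idx_vtx _ b1, idx_vtx _ b2] at this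
  obtain ⟨tr, fa, hcons, hs⟩ := search_sound cons (fun r hr => (List.mem_append.1 hr).elim
    (hd.exclRules_hold hz r) (hd.clauseRules_hold hz r)) hc
  obtain ⟨hover, faces, hf, hcover, hup⟩ := sweep_sound hz hcons _ _ _ _ hs (by simp)
    (fun x hx => .inr hx) (fun e he x h1 h2 => ⟨e, he, h1, h2⟩)
  refine ⟨hd.mem_vertices, hU, hd.boundary, ?_, ?_⟩
  · intro a b hab x hx
    wlog hlt : idx a < idx b generalizing a b
    · exact this b a hab.symm (by rwa [segment_symm])
        (lt_of_le_of_ne (not_lt.1 hlt) (idx_injective.ne hab.ne'))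
    have ha : idx a ∈ t.members := TileType.idx_mem.2 (hd.mem_vertices _ _ hab)
    have hb : idx b ∈ t.members := TileType.idx_mem.2 (hd.mem_vertices _ _ hab.symm)
    rw [hz.mem_region]
    rw [← vtx_idx a, ← vtx_idx b] at hx
    refine ⟨?_, hz.below_upper ha hb hlt hx⟩
    have hm : (idx a, idx b) ∈ (t.edges χ).map fun e => sortPair (idx e.1) (idx e.2) := by
      rcases (TileType.U_adj.1 hab).2 with h | h
      · rcases sortPair_cases hab.ne with ⟨-, e⟩ | ⟨h', -⟩
        · exact List.mem_map.2 ⟨_, h, e⟩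
        · omega
      · rcases sortPair_cases hab.ne' with ⟨h', -⟩ | ⟨-, e⟩
        · omega
        · exact List.mem_map.2 ⟨_, h, e⟩
    exact hover _ hm x (fst_of_mem_segment (hz.fst_lt ha hb hlt).le hx)
      (orient_of_mem_segment hx).ge
  · intro x hx
    obtain ⟨h1, h2⟩ := hz.mem_region.1 hx
    have : ∃ f ∈ faces, InTriangle z f x := by
      rcases hcover x h1 with h | h
      · exact h
      obtain ⟨e, he, hx⟩ := hz.mem_segment_of_above_of_below h h2
      obtain ⟨f, hff, hef⟩ := hup e he
      refine ⟨f, hff, (convex_convexHull ℝ _).segment_subset (subset_convexHull ℝ _ ?_)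
        (subset_convexHull ℝ _ ?_) hx⟩ <;> rcases hef with rfl | rfl | rfl <;> simp
    obtain ⟨f, hff, hx⟩ := this
    exact ⟨_, _, _, (hf f hff).adj₁, (hf f hff).adj₂, (hf f hff).adj₃, hx, (hf f hff).empty⟩

theorem IsTriangulation.isValid {χ : LocalColoring}
    (h : IsTriangulation t.vertices z (t.U χ)) : IsValid t z (t.U χ) :=
  ⟨h, fun _ _ => ⟨χ, fun _ _ => rfl⟩, ⟨χ, fun _ _ _ _ => rfl⟩, ⟨χ, fun _ _ _ _ => rfl⟩⟩

/-- Each coloring has the same edges as one that is listed with a sweep. -/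
noncomputable def intendedChecks (t : TileType)
    (l : List (LocalColoring × List (ℕ × ℕ × ℕ))) : Bool :=
  (colorings.all fun χ => l.any fun c => decide (t.edges χ = t.edges c.1)) &&
    l.all fun c => intendedCheck t c.1 c.2

theorem isCorrect_of_checks (hz : IsFrameCell t.vertices z) {c : Certificate}
    (hc : validCheck t c = true) {l : List (LocalColoring × List (ℕ × ℕ × ℕ))}
    (hl : intendedChecks t l = true) : IsCorrect t z := by
  ext T
  constructor
  · intro hT
    exact ⟨hT.triangulation.nonCrossing, IsValid.exists_eq_U hz hT c hc⟩
  · rintro ⟨hT, χ, rfl⟩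
    rw [intendedChecks, Bool.and_eq_true, List.all_eq_true, List.all_eq_true] at hl
    obtain ⟨c, hc, he⟩ := List.any_eq_true.1 (hl.1 χ (mem_colorings χ))
    have e : t.U χ = t.U c.1 := by
      ext a b
      rw [TileType.U_adj, TileType.U_adj, of_decide_eq_true he]
    rw [e] at hT
    change IsValid t z (t.U χ)
    rw [e]
    exact (isTriangulation_of_intendedCheck hz hT c.2 (hl.2 c hc)).isValid

/-! ### Exchanging the colors -/

def Hue.other : Hue → Hue
  | .red => .blue
  | .blue => .red

def Shade.other : Shade → Shade
  | .light => .dark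
  | .dark => .light

/-- Exchange colors and shades. -/
def exchange (χ : LocalColoring) : LocalColoring := fun h => (χ h.other).other

theorem exchange_exchange (χ : LocalColoring) : exchange (exchange χ) = χ := by
  funext h
  cases h
  · change (χ .red).other.other = χ .red
    cases χ .red <;> rfl
  · change (χ .blue).other.other = χ .blue
    cases χ .blue <;> rfl

/-- Validity and being intended only quantify over colorings, which `exchange` permutes. -/
theorem IsCorrect.of_exchange {t' : TileType} (hV : t.vertices = t'.vertices)
    (hU : ∀ χ, t.U χ = t'.U (exchange χ)) (h : IsCorrect t' z) : IsCorrect t z := by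
  have hM : ∀ T v χ, Matches t z T v χ ↔ Matches t' z T v (exchange χ) := fun T v χ => by
    rw [Matches, Matches, hU]
  have ex : ∀ P : LocalColoring → Prop, (∃ χ, P (exchange χ)) ↔ ∃ χ, P χ := fun P =>
    ⟨fun ⟨χ, h⟩ => ⟨_, h⟩, fun ⟨χ, h⟩ => ⟨exchange χ, by rwa [exchange_exchange]⟩⟩
  have hv : ∀ T, IsValid t z T ↔ IsValid t' z T := fun T => by
    constructor
    · rintro ⟨h1, h2, h3, h4⟩
      simp only [hM, hV] at h1 h2 h3 h4
      exact ⟨h1, fun v hv => (ex _).1 (h2 v hv), (ex _).1 h3, (ex _).1 h4⟩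
    · rintro ⟨h1, h2, h3, h4⟩
      refine ⟨hV ▸ h1, fun v hv => ?_, ?_, ?_⟩
      · simp only [hM]
        exact (ex _).2 (h2 v (hV ▸ hv))
      · simp only [hM]
        exact (ex _).2 h3
      · simp only [hM]
        exact (ex _).2 h4
  have hi : intended t z = intended t' z := by
    ext T
    refine and_congr_right fun _ => ?_
    simp only [hU]
    exact ex fun χ => T = t'.U χ
  rw [IsCorrect, hi, ← h]
  exact Set.ext hv

open TileType

/-! ### The checks -/

-- A certificate lists representatives for the west and the south boundary and a tree for each pair
-- of them. The tree `[0]` means that propagation alone suffices.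
set_option maxRecDepth 1000000 in
theorem valid_blank : validCheck .blank
    ⟨[mkColoring .light .light], [mkColoring .light .light], [[[0]]]⟩ =
      true := by
  decide +kernel

-- The triples are the triangles of the gadget in the order of the sweep.
set_option maxRecDepth 1000000 in
theorem intended_blank : intendedChecks .blank
    [(mkColoring .light .light, [(4, 12, 14), (4, 11, 12), (4, 10, 11), (4, 9, 10), (4, 8, 9),
    (4, 7, 8), (4, 6, 7), (3, 4, 6), (2, 3, 6), (1, 2, 6), (0, 1, 6), (12, 14, 15), (12, 15,
    16), (12, 16, 17)])] =
      true := by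
  decide +kernel

-- Numbers below 324 in a tree are edges: 195 = 18 * 10 + 15 is the edge from v1 to v6.
set_option maxRecDepth 1000000 in
theorem valid_SE : validCheck (.SE .red)
    ⟨[mkColoring .light .light], [mkColoring .light .light, mkColoring .dark .light], [[[195,
    0, 0], [0]]]⟩ =
      true := by
  decide +kernel

set_option maxRecDepth 1000000 in
theorem intended_SE : intendedChecks (.SE .red)
    [(mkColoring .light .light, [(4, 10, 14), (4, 9, 10), (4, 8, 9), (4, 7, 8), (4, 6, 7), (3,
    4, 6), (2, 3, 6), (1, 2, 6), (0, 1, 6), (10, 11, 14), (11, 14, 15), (11, 12, 15), (12, 15,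
    16), (12, 16, 17)]), (mkColoring .dark .light, [(4, 10, 14), (4, 9, 10), (4, 8, 9), (4, 7,
    8), (4, 6, 7), (3, 4, 6), (2, 3, 6), (1, 2, 6), (0, 1, 6), (10, 14, 15), (10, 11, 15),
    (11, 12, 15), (12, 15, 16), (12, 16, 17)])] =
      true := by
  decide +kernel

set_option maxRecDepth 1000000 in
theorem valid_SW : validCheck (.SW .red)
    ⟨[mkColoring .light .light, mkColoring .dark .light], [mkColoring .light .light,
    mkColoring .dark .light], [[[25, 0, 26, 0, 27, 0, 32, 0, 0], [51, 0, 0]], [[25, 0, 26, 0,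
    27, 0, 32, 0, 33, 0, 0], [33, 0, 0]]]⟩ =
      true := by
  decide +kernel

set_option maxRecDepth 1000000 in
theorem intended_SW : intendedChecks (.SW .red)
    [(mkColoring .light .light, [(3, 4, 14), (2, 3, 14), (1, 2, 14), (1, 14, 15), (1, 6, 15),
    (0, 1, 6), (6, 7, 15), (7, 8, 15), (8, 9, 15), (9, 10, 15), (10, 11, 15), (11, 12, 15),
    (12, 15, 16), (12, 16, 17)]), (mkColoring .dark .light, [(3, 4, 14), (2, 3, 14), (2, 14,
    15), (1, 2, 15), (1, 6, 15), (0, 1, 6), (6, 7, 15), (7, 8, 15), (8, 9, 15), (9, 10, 15),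
    (10, 11, 15), (11, 12, 15), (12, 15, 16), (12, 16, 17)])] =
      true := by
  decide +kernel

set_option maxRecDepth 1000000 in
theorem valid_NW : validCheck (.NW .red)
    ⟨[mkColoring .light .light, mkColoring .dark .light], [mkColoring .light .light], [[[0]],
    [[0]]]⟩ =
      true := by
  decide +kernel

set_option maxRecDepth 1000000 in
theorem intended_NW : intendedChecks (.NW .red)
    [(mkColoring .light .light, [(4, 12, 14), (4, 11, 12), (4, 10, 11), (4, 9, 10), (4, 8, 9),
    (4, 7, 8), (3, 4, 7), (2, 3, 7), (1, 2, 7), (1, 6, 7), (0, 1, 6), (12, 14, 15), (12, 15,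
    16), (12, 16, 17)]), (mkColoring .dark .light, [(4, 12, 14), (4, 11, 12), (4, 10, 11), (4,
    9, 10), (4, 8, 9), (4, 7, 8), (3, 4, 7), (2, 3, 7), (2, 6, 7), (1, 2, 6), (0, 1, 6), (12,
    14, 15), (12, 15, 16), (12, 16, 17)])] =
      true := by
  decide +kernel

-- Larger numbers in a tree branch on orientations: 2975 and 2651 ask whether p is below the line
-- from b7 to b1 and to b2, respectively.
set_option maxRecDepth 1000000 in
theorem valid_NS : validCheck (.NS .red)
    ⟨[mkColoring .light .light], [mkColoring .light .light, mkColoring .dark .light], [[[29,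
    0, 30, 0, 32, 0, 33, 0, 34, 0, 48, 0, 50, 0, 51, 0, 52, 0, 69, 0, 47, 0, 28, 0, 66, 0, 46,
    0, 65, 0, 64, 0, 2975, 106, 0, 96, 0, 63, 0, 0, 0], [29, 0, 30, 0, 32, 0, 33, 0, 34, 0,
    48, 0, 50, 0, 51, 0, 52, 0, 66, 0, 47, 0, 28, 0, 65, 0, 101, 2651, 2975, 60, 0, 0, 0, 0,
    0]]]⟩ =
      true := by
  decide +kernel

set_option maxRecDepth 1000000 in
theorem intended_NS : intendedChecks (.NS .red)
    [(mkColoring .light .light, [(3, 4, 14), (3, 5, 14), (5, 14, 15), (5, 12, 15), (5, 11,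
    12), (5, 10, 11), (5, 9, 10), (5, 8, 9), (5, 7, 8), (3, 5, 7), (3, 6, 7), (2, 3, 6), (1,
    2, 6), (0, 1, 6), (12, 15, 16), (12, 16, 17)]), (mkColoring .dark .light, [(3, 4, 14), (3,
    14, 15), (3, 5, 15), (5, 12, 15), (5, 11, 12), (5, 10, 11), (5, 9, 10), (5, 8, 9), (5, 7,
    8), (5, 6, 7), (3, 5, 6), (2, 3, 6), (1, 2, 6), (0, 1, 6), (12, 15, 16), (12, 16, 17)])] =
      true := by
  decide +kernel

set_option maxRecDepth 1000000 in
theorem valid_EW : validCheck (.EW .red)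
    ⟨[mkColoring .light .light, mkColoring .dark .light], [mkColoring .light .light], [[[25,
    0, 26, 0, 27, 0, 33, 0, 34, 0, 4891, 0, 5053, 211, 5035, 139, 5017, 121, 0, 0, 0, 0, 0, 0,
    0]], [[25, 0, 26, 0, 27, 0, 32, 0, 33, 0, 34, 0, 5035, 51, 0, 52, 0, 116, 0, 117, 0, 122,
    0, 123, 0, 121, 135, 0, 140, 0, 141, 0, 139, 158, 0, 176, 0, 0, 0, 0, 0]]]⟩ =
      true := by
  decide +kernel

set_option maxRecDepth 1000000 in
theorem intended_EW : intendedChecks (.EW .red)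
    [(mkColoring .light .light, [(3, 4, 14), (2, 3, 14), (1, 2, 14), (1, 13, 14), (1, 6, 13),
    (0, 1, 6), (6, 7, 13), (7, 8, 13), (8, 9, 13), (9, 10, 13), (10, 11, 13), (11, 13, 14),
    (11, 12, 14), (12, 14, 15), (12, 15, 16), (12, 16, 17)]), (mkColoring .dark .light, [(3,
    4, 14), (2, 3, 14), (2, 13, 14), (1, 2, 13), (1, 6, 13), (0, 1, 6), (6, 7, 13), (7, 8,
    13), (8, 9, 13), (9, 10, 13), (10, 13, 14), (10, 11, 14), (11, 12, 14), (12, 14, 15), (12,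
    15, 16), (12, 16, 17)])] =
      true := by
  decide +kernel

-- Neither boundary distinguishes the two shades of the wire by its degrees, so a single search has
-- to account for both graphs.
set_option maxRecDepth 1000000 in
theorem valid_NE : validCheck (.NE .red)
    ⟨[mkColoring .light .light], [mkColoring .light .light], [[[31, 0, 32, 0, 33, 0, 34, 0,
    50, 0, 51, 0, 52, 0, 69, 0, 28, 0, 46, 0, 49, 0, 70, 0, 105, 0, 106, 0, 64, 0, 26, 0, 27,
    0, 44, 0, 45, 0, 23, 0, 62, 0, 41, 0, 63, 0, 60, 68, 104, 61, 194, 0, 0, 0, 0, 0, 0]]]⟩ =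
      true := by
  decide +kernel

set_option maxRecDepth 1000000 in
theorem intended_NE : intendedChecks (.NE .red)
    [(mkColoring .light .light, [(3, 4, 14), (3, 5, 14), (5, 13, 14), (5, 10, 13), (5, 9, 10),
    (5, 8, 9), (5, 7, 8), (3, 5, 7), (3, 6, 7), (2, 3, 6), (1, 2, 6), (0, 1, 6), (10, 11, 13),
    (11, 13, 14), (11, 12, 14), (12, 14, 15), (12, 15, 16), (12, 16, 17)]), (mkColoring .dark
    .light, [(3, 4, 14), (3, 13, 14), (3, 5, 13), (5, 10, 13), (5, 9, 10), (5, 8, 9), (5, 7,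
    8), (5, 6, 7), (3, 5, 6), (2, 3, 6), (1, 2, 6), (0, 1, 6), (10, 13, 14), (10, 11, 14),
    (11, 12, 14), (12, 14, 15), (12, 15, 16), (12, 16, 17)])] =
      true := by
  decide +kernel

set_option maxRecDepth 1000000 in
theorem valid_crossing1 : validCheck .crossing1
    ⟨[mkColoring .light .light, mkColoring .light .dark], [mkColoring .light .light,
    mkColoring .light .dark, mkColoring .dark .light, mkColoring .dark .dark], [[[25, 0, 26,
    0, 27, 0, 32, 0, 34, 0, 213, 0, 0], [25, 0, 26, 0, 27, 0, 32, 0, 33, 0, 0], [25, 0, 26, 0,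
    27, 0, 32, 0, 34, 0, 159, 178, 0, 0, 0], [25, 0, 26, 0, 27, 0, 32, 0, 33, 0, 0]], [[25, 0,
    26, 0, 27, 0, 32, 0, 0], [25, 0, 26, 0, 27, 0, 34, 0, 213, 0, 0], [25, 0, 26, 0, 27, 0,
    32, 0, 0], [25, 0, 26, 0, 27, 0, 34, 0, 159, 178, 0, 0, 0]]]⟩ =
      true := by
  decide +kernel

set_option maxRecDepth 1000000 in
theorem intended_crossing1 : intendedChecks .crossing1
    [(mkColoring .light .light, [(3, 4, 14), (2, 3, 14), (2, 14, 15), (1, 2, 15), (1, 6, 15),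
    (0, 1, 6), (6, 7, 15), (7, 8, 15), (8, 9, 15), (9, 10, 15), (10, 11, 15), (11, 15, 16),
    (11, 12, 16), (12, 16, 17)]), (mkColoring .light .dark, [(3, 4, 14), (2, 3, 14), (1, 2,
    14), (1, 14, 15), (1, 6, 15), (0, 1, 6), (6, 7, 15), (7, 8, 15), (8, 9, 15), (9, 10, 15),
    (10, 11, 15), (11, 15, 16), (11, 12, 16), (12, 16, 17)]), (mkColoring .dark .light, [(3,
    4, 14), (2, 3, 14), (2, 14, 15), (1, 2, 15), (1, 6, 15), (0, 1, 6), (6, 7, 15), (7, 8,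
    15), (8, 9, 15), (9, 10, 15), (10, 15, 16), (10, 11, 16), (11, 12, 16), (12, 16, 17)]),
    (mkColoring .dark .dark, [(3, 4, 14), (2, 3, 14), (1, 2, 14), (1, 14, 15), (1, 6, 15), (0,
    1, 6), (6, 7, 15), (7, 8, 15), (8, 9, 15), (9, 10, 15), (10, 15, 16), (10, 11, 16), (11,
    12, 16), (12, 16, 17)])] =
      true := by
  decide +kernel

set_option maxRecDepth 1000000 in
theorem valid_crossing2 : validCheck .crossing2
    ⟨[mkColoring .light .light], [mkColoring .light .light, mkColoring .light .dark,
    mkColoring .dark .light, mkColoring .dark .dark], [[[0], [0], [0], [0]]]⟩ =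
      true := by
  decide +kernel

-- The light–light graph contains the crossing chords v3 v7 and v2 v5; it needs no sweep, since
-- propagation refutes it.
set_option maxRecDepth 1000000 in
theorem intended_crossing2 : intendedChecks .crossing2
    [(mkColoring .light .light, []), (mkColoring .light .dark, [(4, 11, 14), (4, 10, 11), (4,
    9, 10), (4, 8, 9), (4, 7, 8), (4, 6, 7), (3, 4, 6), (2, 3, 6), (1, 2, 6), (0, 1, 6), (11,
    12, 14), (12, 14, 15), (12, 15, 16), (12, 16, 17)]), (mkColoring .dark .light, [(4, 11,
    14), (4, 10, 11), (4, 9, 10), (4, 8, 9), (4, 7, 8), (4, 6, 7), (3, 4, 6), (2, 3, 6), (1,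
    2, 6), (0, 1, 6), (11, 14, 15), (11, 15, 16), (11, 12, 16), (12, 16, 17)]), (mkColoring
    .dark .dark, [(4, 11, 14), (4, 10, 11), (4, 9, 10), (4, 8, 9), (4, 7, 8), (4, 6, 7), (3,
    4, 6), (2, 3, 6), (1, 2, 6), (0, 1, 6), (11, 14, 15), (11, 12, 15), (12, 15, 16), (12, 16,
    17)])] =
      true := by
  decide +kernel

-- The light–light and dark–dark colorings give the west boundary the same degrees and share a
-- representative. In the former, b1 b6 and b3 b7 cross. The tree branches on the edge 43 between b6
-- and b2.
set_option maxRecDepth 1000000 in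
theorem valid_crossing3 : validCheck .crossing3
    ⟨[mkColoring .light .light, mkColoring .light .dark, mkColoring .dark .light], [mkColoring
    .light .light], [[[43, 0, 0]], [[0]], [[0]]]⟩ =
      true := by
  decide +kernel

set_option maxRecDepth 1000000 in
theorem intended_crossing3 : intendedChecks .crossing3
    [(mkColoring .light .light, []), (mkColoring .light .dark, [(4, 12, 14), (4, 11, 12), (4,
    10, 11), (4, 9, 10), (4, 8, 9), (3, 4, 8), (2, 3, 8), (2, 7, 8), (2, 6, 7), (1, 2, 6), (0,
    1, 6), (12, 14, 15), (12, 15, 16), (12, 16, 17)]), (mkColoring .dark .light, [(4, 12, 14),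
    (4, 11, 12), (4, 10, 11), (4, 9, 10), (4, 8, 9), (3, 4, 8), (3, 7, 8), (3, 6, 7), (2, 3,
    6), (1, 2, 6), (0, 1, 6), (12, 14, 15), (12, 15, 16), (12, 16, 17)]), (mkColoring .dark
    .dark, [(4, 12, 14), (4, 11, 12), (4, 10, 11), (4, 9, 10), (4, 8, 9), (3, 4, 8), (3, 7,
    8), (2, 3, 7), (2, 6, 7), (1, 2, 6), (0, 1, 6), (12, 14, 15), (12, 15, 16), (12, 16,
    17)])] =
      true := by
  decide +kernel

set_option maxRecDepth 1000000 in
theorem valid_crossing4 : validCheck .crossing4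
    ⟨[mkColoring .light .light, mkColoring .dark .light], [mkColoring .light .light,
    mkColoring .light .dark], [[[30, 0, 32, 0, 33, 0, 34, 0, 42, 0, 48, 0, 50, 0, 51, 0, 52,
    0, 29, 0, 60, 0, 66, 0, 47, 0, 28, 0, 65, 0, 101, 2975, 97, 3299, 23, 0, 0, 0, 0, 0, 0],
    [30, 0, 32, 0, 33, 0, 34, 0, 42, 0, 48, 0, 50, 0, 51, 0, 52, 0, 29, 0, 60, 0, 69, 0, 47,
    0, 28, 0, 66, 0, 46, 0, 65, 0, 64, 0, 63, 0, 106, 0, 0]], [[29, 0, 30, 0, 32, 0, 33, 0,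
    34, 0, 48, 0, 50, 0, 51, 0, 52, 0, 28, 0, 60, 0, 66, 0, 47, 0, 65, 0, 101, 2975, 97, 3299,
    61, 0, 0, 0, 0, 0, 0], [29, 0, 30, 0, 32, 0, 33, 0, 34, 0, 48, 0, 50, 0, 51, 0, 52, 0, 28,
    0, 60, 0, 69, 0, 47, 0, 66, 0, 46, 0, 27, 0, 65, 0, 64, 0, 63, 0, 106, 0, 0]]]⟩ =
      true := by
  decide +kernel

set_option maxRecDepth 1000000 in
theorem intended_crossing4 : intendedChecks .crossing4
    [(mkColoring .light .light, [(3, 4, 14), (3, 14, 15), (3, 5, 15), (5, 12, 15), (5, 11,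
    12), (5, 10, 11), (5, 9, 10), (5, 8, 9), (5, 7, 8), (3, 5, 7), (2, 3, 7), (1, 2, 7), (1,
    6, 7), (0, 1, 6), (12, 15, 16), (12, 16, 17)]), (mkColoring .light .dark, [(3, 4, 14), (3,
    5, 14), (5, 14, 15), (5, 12, 15), (5, 11, 12), (5, 10, 11), (5, 9, 10), (5, 8, 9), (3, 5,
    8), (3, 7, 8), (2, 3, 7), (1, 2, 7), (1, 6, 7), (0, 1, 6), (12, 15, 16), (12, 16, 17)]),
    (mkColoring .dark .light, [(3, 4, 14), (3, 14, 15), (3, 5, 15), (5, 12, 15), (5, 11, 12),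
    (5, 10, 11), (5, 9, 10), (5, 8, 9), (5, 7, 8), (3, 5, 7), (2, 3, 7), (2, 6, 7), (1, 2, 6),
    (0, 1, 6), (12, 15, 16), (12, 16, 17)]), (mkColoring .dark .dark, [(3, 4, 14), (3, 5, 14),
    (5, 14, 15), (5, 12, 15), (5, 11, 12), (5, 10, 11), (5, 9, 10), (5, 8, 9), (3, 5, 8), (3,
    7, 8), (2, 3, 7), (2, 6, 7), (1, 2, 6), (0, 1, 6), (12, 15, 16), (12, 16, 17)])] =
      true := by
  decide +kernel

theorem isCorrect_of_red {f : Hue → TileType} {z : Vtx → ℝ × ℝ}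
    (hV : (f .blue).vertices = (f .red).vertices)
    (hU : ∀ χ ∈ colorings, (f .blue).edges χ = (f .red).edges (exchange χ))
    (h : IsFrameCell (f .red).vertices z → IsCorrect (f .red) z) (u : Hue)
    (hz : IsFrameCell (f u).vertices z) : IsCorrect (f u) z := by
  cases u with
  | red => exact h hz
  | blue =>
    refine IsCorrect.of_exchange hV (fun χ => ?_) (h (hV ▸ hz))
    ext a b
    rw [TileType.U_adj, TileType.U_adj, hU χ (mem_colorings χ)]

end CellGadget

theorem mainTheorem7 (t : CellGadget.TileType) (z : CellGadget.Vtx → ℝ × ℝ)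
    (hz : CellGadget.IsFrameCell t.vertices z) : CellGadget.IsCorrect t z := by
  open CellGadget in
  cases t with
  | blank => exact isCorrect_of_checks hz valid_blank intended_blank
  | SE h =>
    exact isCorrect_of_red (f := TileType.SE) (by rfl) (by decide)
      (fun hz => isCorrect_of_checks hz valid_SE intended_SE) h hz
  | SW h =>
    exact isCorrect_of_red (f := TileType.SW) (by rfl) (by decide)
      (fun hz => isCorrect_of_checks hz valid_SW intended_SW) h hz
  | NS h =>
    exact isCorrect_of_red (f := TileType.NS) (by rfl) (by decide)
      (fun hz => isCorrect_of_checks hz valid_NS intended_NS) h hz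
  | NW h =>
    exact isCorrect_of_red (f := TileType.NW) (by rfl) (by decide)
      (fun hz => isCorrect_of_checks hz valid_NW intended_NW) h hz
  | NE h =>
    exact isCorrect_of_red (f := TileType.NE) (by rfl) (by decide)
      (fun hz => isCorrect_of_checks hz valid_NE intended_NE) h hz
  | EW h =>
    exact isCorrect_of_red (f := TileType.EW) (by rfl) (by decide)
      (fun hz => isCorrect_of_checks hz valid_EW intended_EW) h hz
  | crossing1 => exact isCorrect_of_checks hz valid_crossing1 intended_crossing1
  | crossing2 => exact isCorrect_of_checks hz valid_crossing2 intended_crossing2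
  | crossing3 => exact isCorrect_of_checks hz valid_crossing3 intended_crossing3
  | crossing4 => exact isCorrect_of_checks hz valid_crossing4 intended_crossing4
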